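/- **Setting.** A market $\mathcal M$ has $m$ businesses. Business $j$ has a fit probability $\pi_j\in(0,1)$ and a quality $Q_j\in[0,1]$; these are unknown to consumers, who know independent priors on $[0,1]$ for all $\pi_j$ and $Q_j$ (the true parameters lie in the supports of the priors). There is a search cost $c\ge 0$. Consumers $i=1,2,\dots$ arrive one per round, with i.i.d. values $V_i$ from a regular distribution with a density and bounded support in $[0,\overline V]$, $\overline V$ being the supremum of the support. Fits $F_{ij}$ and quality realizations $q_{ij}$ are independent Bernoulli variables with means $\pi_j$ and $Q_j$. In round $i$ each business $j$ posts a price $P_{ij}\ge 0$ by a (possibly randomized) pricing rule, a function of the history so far. Let $\hat\pi_j,\hat Q_j$ be the posterior means of $\pi_j,Q_j$ given the fit and quality data of the history, and let $\sigma_j(P,\hat\pi_j,\hat Q_j,V)=V\hat Q_j-P-c/\hat\pi_j$. Consumer $i$ inspects, at cost $c$ each, the businesses with positive index $\sigma_j(P_{ij},\hat\pi_j,\hat Q_j,V_i)$ in decreasing order of index (ties between businesses are resolved by a priority order drawn from a fixed law) until she finds a fit, and transacts with that business at its price. Her utility is $V_iq_{ij}-P_{ij}$ if she transacts with $j$ (and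 $0$ if she does not transact), minus her search costs. The history records the prices, the fits of the inspected businesses, and the quality realization of the transaction. Pricing rules are *demand-responsive* if after every history each business almost surely chooses a price $P$ with $\sigma_j(P,\hat\pi_j,\hat Q_j,\overline V)>0$, provided that such a price $P\ge0$ exists; they are *uniformly* demand-responsive if moreover this index is bounded below by a positive number that depends only on $j$, $\hat\pi_j$ and $\hat Q_j$. Business $j$ is *learned* in an infinite history if the posterior beliefs about $(\pi_j,Q_j)$ converge in probability to the true values; $S(\mathcal M)$ is the random set of learned businesses. The market is *symmetric* if almost surely all businesses in $S(\mathcal M)$ have the same $(\pi_j,Q_j)$. A *market equilibrium* consists of limit beliefs about all businesses and a price distribution $\Gamma_j$ on $[0,\infty)$ for each $j$, such that each business is either learned (beliefs are the point mass at $(\pi_j,Q_j)$) or lost ($\sigma_j(0,\hat\pi_j,\hat Q_j,\overline V)\le0$ under the beliefs), and each price in the support of $\Gamma_j$ maximizes the expected revenue of $j$ from a consumer who searches by the index policy with these beliefs, when the other businesses draw their prices independently from their distributions. It is *symmetric* if all learned businesses have the same $\Gamma_j$. Consumer welfare is the expected utility of such a consumer, and total welfare is consumer welfare plus the expected revenues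 of all businesses. *Canonical* consumer and total welfare of $\mathcal M$ are the welfares at a symmetric market equilibrium with learned set $S(\mathcal M)$; they are random through the history. **Theorem.** Let $\mathcal M,\widetilde{\mathcal M}$ be symmetric markets with demand-responsive pricing rules that are identical except for a reduced search cost $\tilde c<c$. (The pricing rules may also differ between the two markets, if those of $\widetilde{\mathcal M}$ are uniformly demand-responsive.) Then there is a coupling of the histories of the two markets over which, almost surely, symmetric market equilibria with learned sets $S(\mathcal M)$ and $S(\widetilde{\mathcal M})$ exist in the respective markets, and, for all such equilibria, consumer welfare in $\mathcal M$ is at most consumer welfare in $\widetilde{\mathcal M}$ and total welfare in $\mathcal M$ is at most total welfare in $\widetilde{\mathcal M}$. That is, $\widetilde{\mathcal M}$ has weakly higher canonical consumer welfare and weakly higher canonical total welfare. -/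

import Mathlib

open MeasureTheory ProbabilityTheory Filter Topology unitInterval
open scoped NNReal ENNReal Classical

noncomputable section

/-- The discrete measurable structure on the finite set of priority orders of the businesses. -/
instance permMeasurableSpace (m : ℕ) : MeasurableSpace (Equiv.Perm (Fin m)) := ⊤

/-- What one round reveals about the businesses: for each business, the fit if the business was
inspected in this round, and the quality realization if the transaction was with this business. -/
structure Feedback (m : ℕ) where
  fit : Fin m → Option Bool
  sale : Fin m → Option Bool

instance feedbackMeasurableSpace (m : ℕ) : MeasurableSpace (Feedback m) := ⊤

/-- The record of one round: the posted prices and the feedback. -/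
abbrev Round (m : ℕ) : Type := (Fin m → ℝ≥0) × Feedback m

/-- A finite history of `n` rounds. -/
abbrev FinHistory (m n : ℕ) : Type := Fin n → Round m

/-- An infinite history. -/
abbrev History (m : ℕ) : Type := ℕ → Round m

/-- The prefix of an infinite history formed by its first `n` rounds. -/
def History.take {m : ℕ} (h : History m) (n : ℕ) : FinHistory m n := fun i => h i

/-- A market with `m` businesses; prices are not part of it, they are set endogenously.
`fit j` and `quality j` are the true parameters of business `j`; they are a potential
realization of the priors `priorFit j` and `priorQuality j` (independent over all `j`). -/
structure Market (m : ℕ) where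
  fit : Fin m → I
  fit_pos : ∀ j, 0 < fit j
  fit_lt_one : ∀ j, fit j < 1
  quality : Fin m → I
  priorFit : Fin m → ProbabilityMeasure I
  priorQuality : Fin m → ProbabilityMeasure I
  fit_mem_support : ∀ j, fit j ∈ (priorFit j : Measure I).support
  quality_mem_support : ∀ j, quality j ∈ (priorQuality j : Measure I).support
  /-- the distribution of consumer values -/
  valueLaw : ProbabilityMeasure ℝ
  density : ℝ → ℝ≥0
  density_measurable : Measurable density
  valueLaw_eq : (valueLaw : Measure ℝ) = volume.withDensity (fun v => (density v : ℝ≥0∞))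
  /-- the highest consumer value -/
  vmax : ℝ
  value_mem : ∀ᵐ v ∂(valueLaw : Measure ℝ), v ∈ Set.Icc 0 vmax
  value_near_vmax : ∀ v < vmax, 0 < (valueLaw : Measure ℝ) (Set.Ioi v)
  /-- regularity: the virtual value is nondecreasing -/
  regular : MonotoneOn (fun v => v - (1 - cdf (valueLaw : Measure ℝ) v) / (density v : ℝ))
    {v | 0 < density v}
  /-- the law of the priority order by which a consumer resolves ties between businesses whose
  indices are equal -/
  tieLaw : PMF (Equiv.Perm (Fin m))
  /-- the search cost -/
  cost : ℝ≥0

/-- Possibly randomized pricing rules of all businesses: the price of business `j` after a history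
of `n` rounds is a function of this history and of a fresh uniform random number. -/
structure PricingRules (m : ℕ) where
  price : Fin m → (n : ℕ) → FinHistory m n → I → ℝ≥0
  measurable_price : ∀ j n, Measurable (fun x : FinHistory m n × I => price j n x.1 x.2)

/-- What is random about one consumer: the value, the priority order for ties, and for each
business the fit and the quality realization. -/
abbrev Consumer (m : ℕ) : Type := ℝ × Equiv.Perm (Fin m) × (Fin m → Bool × Bool)

namespace Consumer

variable {m : ℕ}

def value (a : Consumer m) : ℝ := a.1

def rank (a : Consumer m) (j : Fin m) : Fin m := a.2.1 j

def fit (a : Consumer m) (j : Fin m) : Bool := (a.2.2 j).1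

def quality (a : Consumer m) (j : Fin m) : Bool := (a.2.2 j).2

/-- Given the indices `x`, business `k` comes before business `j` in the search order. -/
def Before (a : Consumer m) (x : Fin m → ℝ) (k j : Fin m) : Prop :=
  x j < x k ∨ (x k = x j ∧ a.rank k < a.rank j)

/-- The index policy: businesses with positive index are inspected in decreasing order of their
index until the first fit. So `j` is inspected iff its index is positive and no business that comes
before it is a fit. -/
def Inspects (a : Consumer m) (x : Fin m → ℝ) (j : Fin m) : Prop :=
  0 < x j ∧ ∀ k, a.Before x k j → a.fit k = false

/-- The consumer transacts with the first inspected business that is a fit. -/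
def Transacts (a : Consumer m) (x : Fin m → ℝ) (j : Fin m) : Prop :=
  a.Inspects x j ∧ a.fit j = true

/-- The total utility of a consumer who searches with indices `x` at prices `p` and search
cost `c`: the value if the need is met, minus the price paid, minus the search costs. -/
def utility (a : Consumer m) (c : ℝ≥0) (x : Fin m → ℝ) (p : Fin m → ℝ≥0) : ℝ :=
  ∑ j, ((if a.Transacts x j then (if a.quality j then a.value else 0) - (p j : ℝ) else 0)
    - (if a.Inspects x j then (c : ℝ) else 0))

/-- The revenue of business `j`. -/
def revenue (a : Consumer m) (x : Fin m → ℝ) (p : Fin m → ℝ≥0) (j : Fin m) : ℝ :=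
  if a.Transacts x j then (p j : ℝ) else 0

end Consumer

/-- The mean of a belief about a parameter. -/
def beliefMean (μ : Measure I) : ℝ := ∫ x, (x : ℝ) ∂μ

/-- A candidate steady state: for each business the limit beliefs about its fit probability and
about its quality, and the distribution of its price. -/
structure SteadyState (m : ℕ) where
  beliefFit : Fin m → ProbabilityMeasure I
  beliefQuality : Fin m → ProbabilityMeasure I
  price : Fin m → ProbabilityMeasure ℝ≥0

namespace Market

variable {m : ℕ} (M : Market m)

/-- The market that is identical except for the search cost. -/
def withCost (c : ℝ≥0) : Market m := { M with cost := c }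

/-- The search index `V Q - P - c / π` of a business with price `p` and (posterior mean) fit
probability `π` and quality `q`, for a consumer with value `v`. -/
def index (p : ℝ≥0) (π q v : ℝ) : ℝ := v * q - p - M.cost / π

/-! ### Beliefs -/

/-- The likelihood of the feedback of one round, when the parameters (fit probability and quality)
of the businesses are `θ`. -/
def feedbackLikelihood (f : Feedback m) (θ : Fin m → I × I) : ℝ≥0∞ :=
  ∏ j, ((match f.fit j with
      | none => 1
      | some true => ENNReal.ofReal (θ j).1
      | some false => ENNReal.ofReal (1 - (θ j).1)) *
    (match f.sale j with
      | none => 1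
      | some true => ENNReal.ofReal (θ j).2
      | some false => ENNReal.ofReal (1 - (θ j).2)))

/-- The likelihood of a finite history. The choices of the consumers and the prices depend on the
parameters only through the history, and their probabilities are factors that do not depend
on `θ`; they cancel in Bayes' rule and are omitted. -/
def likelihood {n : ℕ} (H : FinHistory m n) (θ : Fin m → I × I) : ℝ≥0∞ :=
  ∏ i, feedbackLikelihood (H i).2 θ

/-- The common prior on the parameters of all businesses. -/
def prior : Measure (Fin m → I × I) :=
  Measure.pi (fun j => (M.priorFit j : Measure I).prod (M.priorQuality j : Measure I))

/-- The posterior on the parameters of all businesses given a finite history (Bayes' rule). -/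
def posterior {n : ℕ} (H : FinHistory m n) : Measure (Fin m → I × I) :=
  (∫⁻ θ, likelihood H θ ∂M.prior)⁻¹ • M.prior.withDensity (likelihood H)

/-- The posterior belief about the fit probability of business `j`. -/
def posteriorFit {n : ℕ} (H : FinHistory m n) (j : Fin m) : Measure I :=
  (M.posterior H).map (fun θ => (θ j).1)

/-- The posterior belief about the quality of business `j`. -/
def posteriorQuality {n : ℕ} (H : FinHistory m n) (j : Fin m) : Measure I :=
  (M.posterior H).map (fun θ => (θ j).2)

/-- The index of business `j` after history `H`, at price `p`, for a consumer with value `v`. -/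
def indexAfter {n : ℕ} (H : FinHistory m n) (j : Fin m) (p : ℝ≥0) (v : ℝ) : ℝ :=
  M.index p (beliefMean (M.posteriorFit H j)) (beliefMean (M.posteriorQuality H j)) v

/-! ### Market dynamics -/

/-- The law of one consumer: value, priority order, fits and quality realizations are independent,
the fit and the quality realization for `j` have means `fit j` and `quality j`. -/
def consumerLaw : Measure (Consumer m) :=
  (M.valueLaw : Measure ℝ).prod (M.tieLaw.toMeasure.prod
    (Measure.pi fun j =>
      (bernoulliMeasure true false (M.fit j)).prod (bernoulliMeasure true false (M.quality j))))

/-- The law of all randomness: in every round a fresh consumer and, for each business, a fresh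
uniform random number for its pricing rule. -/
def noiseLaw (_ : PricingRules m) : Measure (ℕ → Consumer m × (Fin m → I)) :=
  Measure.infinitePi (fun _ => M.consumerLaw.prod (Measure.pi fun _ => (volume : Measure I)))

/-- The round that follows history `H`: the businesses post prices, the consumer searches by the
index policy with her posterior means, the feedback is recorded. -/
def nextRound (ρ : PricingRules m) {n : ℕ} (H : FinHistory m n)
    (s : Consumer m × (Fin m → I)) : Round m :=
  let p : Fin m → ℝ≥0 := fun j => ρ.price j n H (s.2 j)
  let x : Fin m → ℝ := fun j => M.indexAfter H j (p j) s.1.value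
  (p, { fit := fun j => if s.1.Inspects x j then some (s.1.fit j) else none
        sale := fun j => if s.1.Transacts x j then some (s.1.quality j) else none })

/-- The first `n` rounds, as a function of the randomness. -/
def runFor (ρ : PricingRules m) (ω : ℕ → Consumer m × (Fin m → I)) : (n : ℕ) → FinHistory m n
  | 0 => Fin.elim0
  | n + 1 => Fin.snoc (α := fun _ => Round m) (runFor ρ ω n)
      (M.nextRound ρ (runFor ρ ω n) (ω n))

/-- The infinite history, as a function of the randomness. -/
def run (ρ : PricingRules m) (ω : ℕ → Consumer m × (Fin m → I)) : History m :=
  fun n => M.nextRound ρ (M.runFor ρ ω n) (ω n)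

/-- The law of the infinite history. -/
def historyLaw (ρ : PricingRules m) : Measure (History m) :=
  (M.noiseLaw ρ).map (M.run ρ)

/-- Business `j` is learned in history `h`: the posterior beliefs about its fit probability and its
quality converge in probability to the true values. -/
def Learned (h : History m) (j : Fin m) : Prop :=
  (∀ ε > 0, Tendsto (fun n => M.posteriorFit (h.take n) j {x | |(x : ℝ) - M.fit j| < ε})
    atTop (𝓝 1)) ∧
  (∀ ε > 0, Tendsto (fun n => M.posteriorQuality (h.take n) j {x | |(x : ℝ) - M.quality j| < ε})
    atTop (𝓝 1))

/-- The learned set of a history. -/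
def learnedSet (h : History m) : Set (Fin m) := {j | M.Learned h j}

/-- Demand-responsive pricing rules: after every history, each business chooses (almost surely) a
price at which the highest-value consumer has a positive index for it, if there is one. -/
def DemandResponsive (ρ : PricingRules m) : Prop :=
  ∀ (n : ℕ) (H : FinHistory m n) (j : Fin m), (∃ p : ℝ≥0, 0 < M.indexAfter H j p M.vmax) →
    ∀ᵐ u : I, 0 < M.indexAfter H j (ρ.price j n H u) M.vmax

/-- Demand-responsive pricing rules for which the positive index is bounded below by a positive
number that depends only on the business and the posterior means. -/
def UniformlyDemandResponsive (ρ : PricingRules m) : Prop :=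
  ∃ δ : Fin m → ℝ → ℝ → ℝ, (∀ j a b, 0 < δ j a b) ∧
    ∀ (n : ℕ) (H : FinHistory m n) (j : Fin m), (∃ p : ℝ≥0, 0 < M.indexAfter H j p M.vmax) →
      ∀ᵐ u : I, δ j (beliefMean (M.posteriorFit H j)) (beliefMean (M.posteriorQuality H j)) ≤
        M.indexAfter H j (ρ.price j n H u) M.vmax

/-- The market is learned-symmetric: almost surely all learned businesses have the same type. -/
def LearnedSymmetric (ρ : PricingRules m) : Prop :=
  ∀ᵐ h ∂M.historyLaw ρ, ∀ j ∈ M.learnedSet h, ∀ k ∈ M.learnedSet h,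
    M.fit j = M.fit k ∧ M.quality j = M.quality k

/-! ### Market equilibrium and welfare -/

/-- The indices of a consumer with value `v` at prices `p` and the beliefs of `Φ`. -/
def steadyIndex (Φ : SteadyState m) (p : Fin m → ℝ≥0) (v : ℝ) (j : Fin m) : ℝ :=
  M.index (p j) (beliefMean (Φ.beliefFit j)) (beliefMean (Φ.beliefQuality j)) v

/-- The businesses whose beliefs in `Φ` are point masses at the true parameters. -/
def steadyLearned (Φ : SteadyState m) : Set (Fin m) :=
  {j | (Φ.beliefFit j : Measure I) = Measure.dirac (M.fit j) ∧
    (Φ.beliefQuality j : Measure I) = Measure.dirac (M.quality j)}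

/-- The businesses that are lost under the beliefs of `Φ`: even at price `0`, even the consumer
with the highest value has no positive index for them. -/
def steadyLost (Φ : SteadyState m) : Set (Fin m) :=
  {j | M.index 0 (beliefMean (Φ.beliefFit j)) (beliefMean (Φ.beliefQuality j)) M.vmax ≤ 0}

/-- The joint law of independent prices drawn from `Φ` and of a consumer. -/
def steadyLaw (Φ : SteadyState m) : Measure ((Fin m → ℝ≥0) × Consumer m) :=
  (Measure.pi fun j => (Φ.price j : Measure ℝ≥0)).prod M.consumerLaw

/-- The expected revenue of business `j` if it sets price `p`, the other businesses draw their
prices from their distributions in `Φ`, and the consumer has the beliefs of `Φ`. -/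
def expectedRevenue (Φ : SteadyState m) (j : Fin m) (p : ℝ≥0) : ℝ :=
  ∫ z, z.2.revenue (M.steadyIndex Φ (Function.update z.1 j p) z.2.value)
    (Function.update z.1 j p) j ∂M.steadyLaw Φ

/-- Market equilibrium: each business is learned or lost, and each price in the support of its
price distribution maximizes its expected revenue. -/
def IsEquilibrium (Φ : SteadyState m) : Prop :=
  (∀ j, j ∈ M.steadyLearned Φ ∨ j ∈ M.steadyLost Φ) ∧
  ∀ j, ∀ p ∈ (Φ.price j : Measure ℝ≥0).support, ∀ p' : ℝ≥0,
    M.expectedRevenue Φ j p' ≤ M.expectedRevenue Φ j p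

/-- `Φ` is a symmetric market equilibrium with learned set `S`: all learned businesses use the
same price distribution. -/
def IsSymmetricEquilibrium (S : Set (Fin m)) (Φ : SteadyState m) : Prop :=
  M.IsEquilibrium Φ ∧ M.steadyLearned Φ = S ∧ ∀ j ∈ S, ∀ k ∈ S, Φ.price j = Φ.price k

/-- The expected consumer welfare: the expected total utility of a consumer. -/
def consumerWelfare (Φ : SteadyState m) : ℝ :=
  ∫ z, z.2.utility M.cost (M.steadyIndex Φ z.1 z.2.value) z.1 ∂M.steadyLaw Φ

/-- The expected total welfare: consumer welfare plus the expected revenues of all businesses. -/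
def totalWelfare (Φ : SteadyState m) : ℝ :=
  M.consumerWelfare Φ +
    ∑ j, ∫ z, z.2.revenue (M.steadyIndex Φ z.1 z.2.value) z.1 j ∂M.steadyLaw Φ

end Market

end

/-! The theorem splits into a dynamic claim, that in a suitable coupling a lower search cost can
only enlarge the learned set, and a static claim, that more learned businesses and a lower cost
raise both welfares at symmetric equilibria.

Dynamic claim. Give each business a stack of i.i.d. pairs of fit and quality realization, and let
its inspections reveal the pairs one after the other. This does not change the law of the history
(`map_readTops`, `measurePreserving_stackRun`), and the coupling runs both markets on the same
stacks. The belief about a business then depends only on its stack and on its number `k` of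
inspections (`posterior_stackRun`). If the costlier market inspects it after `k` inspections, then
its index at price `0` is positive under the `k`-th belief. In the cheaper market, as long as the
belief is this one, the posted price leaves the highest value an index bounded away from `0`: by `(c
- c') / π̂` if the pricing rules are the same, by uniform demand-responsiveness otherwise
(`exists_indexBound`). Consumers with almost the highest value and no fit at all recur, and they
inspect every business with positive index, so inspection `k + 1` happens there too. Hence
inspections are at least as numerous in the limit (`ae_inspections_le`), and learning is inherited
(`tendsto_measure_of_counts`).

Static claim. Under an index policy the expected utility is the expected index of the business
transacted with (`consumerWelfare_eq`), which is the largest positive index among the fits. With `n`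
learned businesses of one type and price law `G`, and `κ = c / π`, some fit has index above `y` for
value `v` with probability `1 - (1 - π G{p + κ < v Q - y}) ^ n`. Integrated over `v` and `y > 0`
this is consumer welfare; at `y = 0` and weighted by `v Q - κ` it gives total welfare. So it
suffices that `(1 - π G{p + κ < t}) ^ n` is not smaller than its analogue in the cheaper market, for
all `t` (`IsOptimalPricing.pow_le_pow`).

Let `R p = p D(p + κ)`. Undercutting rules out atoms if `n ≥ 2`, so revenue is proportional to `R p
(1 - π G[0, p]) ^ (n - 1)`, and its equilibrium level is `(1 - π) ^ (n - 1) max R`: the highest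
price sells only if all rivals misfit. Comparing prices with equal totals `p + κ = p' + κ'` in the
two markets, by the revealed-preference argument that makes a monopolist's price increase with
marginal cost, yields the inequality. Equilibria exist because the condition of constant revenue can
be solved for the quantile function of `G` (`exists_atomless_pricing`). -/

/-! ### Comparison of total prices between two search costs -/

/-- The revenue rate of price `p` when total prices above `t` are accepted with probability `D t`
and the expected search cost until a fit is `κ`. -/
def priceRevenue (D : ℝ → ℝ) (κ : ℝ) (p : ℝ≥0) : ℝ := p * D (p + κ)

/-- The optimality conditions for a price law `G` used by `n` identical competitors. -/
structure IsOptimalPricing (D : ℝ → ℝ) (κ π : ℝ) (n : ℕ) (G : Measure ℝ≥0) : Prop where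
  le_max : ∃ u, (∀ p, priceRevenue D κ p ≤ priceRevenue D κ u) ∧
    ∀ p, priceRevenue D κ p * (1 - π * G.real (Set.Iic p)) ^ (n - 1)
      ≤ (1 - π) ^ (n - 1) * priceRevenue D κ u
  support_opt : ∀ s ∈ G.support, ∀ p, (1 - π) ^ (n - 1) * priceRevenue D κ p
      ≤ priceRevenue D κ s * (1 - π * G.real (Set.Iic s)) ^ (n - 1)

/-- After division by `b` the hypothesis reads `x ^ (n' - 1) ≤ y ^ (n - 1)` with `y ≥ 1`. Raising it
to the power `n'` and comparing exponents gives `x ^ n' ≤ y ^ n`, and `b ^ n' ≤ b ^ n` restores the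
scale. It passes from the rivals' exponents in the optimality conditions to the exponents of all
competitors in the welfare formulas. -/
lemma pow_le_pow_of_mul_pow_pred_le {a a' b : ℝ} {n n' : ℕ} (hb : 0 < b) (hb1 : b ≤ 1)
    (hba : b ≤ a) (ha' : 0 ≤ a') (hnn : n ≤ n') (hn' : 2 ≤ n')
    (h : b ^ (n - 1) * a' ^ (n' - 1) ≤ b ^ (n' - 1) * a ^ (n - 1)) : a' ^ n' ≤ a ^ n := by
  obtain ⟨y, rfl⟩ : ∃ y, a = b * y := ⟨a / b, by field_simp⟩
  obtain ⟨x, rfl⟩ : ∃ x, a' = b * x := ⟨a' / b, by field_simp⟩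
  have hy : 1 ≤ y := by nlinarith
  have hx : 0 ≤ x := by by_contra hx; nlinarith
  have h1 : x ^ (n' - 1) ≤ y ^ (n - 1) := by
    have hpos : 0 < b ^ (n - 1) * b ^ (n' - 1) := by positivity
    refine le_of_mul_le_mul_left ?_ hpos
    rw [mul_pow, mul_pow] at h
    nlinarith
  have h2 : x ^ n' ≤ y ^ n := by
    have h3 : (x ^ n') ^ (n' - 1) ≤ (y ^ n) ^ (n' - 1) := by
      calc (x ^ n') ^ (n' - 1) = (x ^ (n' - 1)) ^ n' := by rw [← pow_mul, ← pow_mul, mul_comm]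
        _ ≤ (y ^ (n - 1)) ^ n' := by gcongr
        _ = y ^ ((n - 1) * n') := by rw [pow_mul]
        -- The comparison of the exponents amounts to `n ≤ n'`.
        _ ≤ y ^ (n * (n' - 1)) := by
          refine pow_le_pow_right₀ hy ?_
          rw [Nat.sub_mul, Nat.mul_sub]; omega
        _ = (y ^ n) ^ (n' - 1) := by rw [pow_mul]
    exact le_of_pow_le_pow_left₀ (by omega) (by positivity) h3
  rw [mul_pow, mul_pow]
  have : b ^ n' ≤ b ^ n := pow_le_pow_of_le_one hb.le hb1 hnn
  gcongr

/-- Take the largest support point below the threshold; it exists by compactness, and there is no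
mass between it and the threshold. Optimality is known only at support points, so thresholds have to
be moved there. -/
lemma exists_support_real_Iic_eq {G : Measure ℝ≥0} [IsProbabilityMeasure G] {κ t : ℝ}
    (h : G {p | (p : ℝ) + κ ≤ t} ≠ 0) :
    ∃ s ∈ G.support, (s : ℝ) + κ ≤ t ∧ G.real (Set.Iic s) = G.real {p | (p : ℝ) + κ ≤ t} := by
  have hclosed : IsClosed {p : ℝ≥0 | (p : ℝ) + κ ≤ t} := isClosed_le (by fun_prop) (by fun_prop)
  have hne := Measure.nonempty_inter_support_of_pos (pos_iff_ne_zero.2 h)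
  have hcomp : IsCompact ({p : ℝ≥0 | (p : ℝ) + κ ≤ t} ∩ G.support) := by
    refine IsCompact.of_isClosed_subset (isCompact_Icc (a := (0 : ℝ≥0)) (b := (t - κ).toNNReal))
      (hclosed.inter Measure.isClosed_support) ?_
    rintro p ⟨hp, -⟩
    refine ⟨zero_le, ?_⟩
    rw [← NNReal.coe_le_coe, Real.coe_toNNReal']
    exact le_max_of_le_left (by simp only [Set.mem_ofPred_eq] at hp; linarith)
  obtain ⟨s, ⟨hs1, hs2⟩, hmax⟩ := hcomp.exists_isMaxOn hne continuousOn_id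
  refine ⟨s, hs2, hs1, ?_⟩
  refine measureReal_congr ?_
  filter_upwards [Measure.support_mem_ae (μ := G)] with p hp
  refine propext ⟨fun hps => ?_, fun hpt => hmax ⟨hpt, hp⟩⟩
  have hps : p ≤ s := hps
  have : (p : ℝ) ≤ s := hps
  simp only [Set.mem_ofPred_eq] at hs1
  change (p : ℝ) + κ ≤ t
  linarith

/-- Let `s` be the largest support price of `G` with total at most `t`, and `d = κ - κ'`. The
optimality of `s` is tested against a price `w - d`, and that of `w` in the second market against `s
+ d`; these pairs have equal total prices, hence equal demand. Multiplying the two inequalities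
cancels the demands and leaves a comparison of `(s + d) (w - d)` with `w s`, whose difference is `d
(w - d - s) > 0` when `w` has total price above `t`. -/
theorem IsOptimalPricing.pow_le_pow {D : ℝ → ℝ} {κ κ' π : ℝ} (hκ : κ' < κ) (hπ0 : 0 < π) (hπ1 : π < 1) {n n' : ℕ} (hn : 1 ≤ n) (hnn : n ≤ n')
    {G G' : Measure ℝ≥0} [IsProbabilityMeasure G] [IsProbabilityMeasure G']
    (h : IsOptimalPricing D κ π n G) (h' : IsOptimalPricing D κ' π n' G')
    (hpos : ∃ p, 0 < priceRevenue D κ p) (t : ℝ) :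
    (1 - π * G'.real {p | (p : ℝ) + κ' ≤ t}) ^ n' ≤ (1 - π * G.real {p | (p : ℝ) + κ ≤ t}) ^ n := by
  have hb : 0 < 1 - π := by linarith
  have hb1 : 1 - π ≤ 1 := by linarith
  have low : ∀ (G : Measure ℝ≥0) [IsProbabilityMeasure G] (A : Set ℝ≥0), 1 - π ≤ 1 - π * G.real A :=
    fun G _ A => by nlinarith [measureReal_le_one (μ := G) (s := A)]
  have low0 : ∀ (G : Measure ℝ≥0) [IsProbabilityMeasure G] (A : Set ℝ≥0), 0 ≤ 1 - π * G.real A :=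
    fun G _ A => hb.le.trans (low G A)
  by_cases h0 : G {p | (p : ℝ) + κ ≤ t} = 0
  · have : G.real {p | (p : ℝ) + κ ≤ t} = 0 := by simp [measureReal_def, h0]
    rw [this, mul_zero, sub_zero, one_pow]
    refine pow_le_one₀ (low0 _ _) ?_
    nlinarith [measureReal_nonneg (μ := G') (s := {p | (p : ℝ) + κ' ≤ t})]
  obtain ⟨s, hs, hst, hGs⟩ := exists_support_real_Iic_eq h0
  rw [← hGs]
  set a := 1 - π * G.real (Set.Iic s) with ha
  set a' := 1 - π * G'.real {p | (p : ℝ) + κ' ≤ t} with ha'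
  have hba : 1 - π ≤ a := low G _
  have ha0 : 0 ≤ a' := low0 G' _
  have hsopt := h.support_opt s hs
  have hRs : 0 < priceRevenue D κ s := by
    obtain ⟨p, hp⟩ := hpos
    have h1 := hsopt p
    have h2 : 0 < (1 - π) ^ (n - 1) * priceRevenue D κ p := by positivity
    by_contra hneg
    have h3 : 0 ≤ a ^ (n - 1) := pow_nonneg (hb.le.trans hba) _
    nlinarith
  have hs0 : 0 < (s : ℝ) := by
    rcases s.coe_nonneg.eq_or_lt with h1 | h1
    · simp [priceRevenue, ← h1] at hRs
    · exact h1
  have hDs : 0 < D (s + κ) := by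
    unfold priceRevenue at hRs; exact pos_of_mul_pos_right hRs hs0.le
  have mono_set : ∀ p : ℝ≥0, (p : ℝ) + κ' ≤ t → a' ≤ 1 - π * G'.real (Set.Iic p) := by
    intro p hp
    have : G'.real (Set.Iic p) ≤ G'.real {p | (p : ℝ) + κ' ≤ t} := by
      refine measureReal_mono ?_
      intro q (hq : q ≤ p)
      have : (q : ℝ) ≤ p := hq
      simp only [Set.mem_ofPred_eq]; linarith
    rw [ha']; nlinarith
  -- The extreme case in which all second-market prices have total at most `t`: then `a'` is the
  -- least possible value.
  have finish : a' ≤ 1 - π → a' ^ n' ≤ a ^ n := fun hle =>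
    calc a' ^ n' ≤ (1 - π) ^ n' := by gcongr
      _ ≤ (1 - π) ^ n := pow_le_pow_of_le_one hb.le hb1 hnn
      _ ≤ a ^ n := by gcongr
  obtain ⟨d, hd, rfl⟩ : ∃ d : ℝ≥0, 0 < (d : ℝ) ∧ κ = κ' + d :=
    ⟨(κ - κ').toNNReal, by rw [Real.coe_toNNReal _ (by linarith)]; linarith,
      by rw [Real.coe_toNNReal _ (by linarith)]; ring⟩
  -- the price in the second market that has the same total price as `s`
  have hsd : priceRevenue D κ' (s + d) = (s + d) * D (s + (κ' + d)) := by
    simp only [priceRevenue, NNReal.coe_add]; ring_nf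
  have sup : ∀ w : ℝ≥0, t < (w : ℝ) + κ' → (s : ℝ) < w - d ∧
      (1 - π) ^ (n - 1) * ((w - d) * D (w + κ')) ≤ s * D (s + (κ' + d)) * a ^ (n - 1) := by
    intro w hw
    have hlt : (s : ℝ) < w - d := by linarith
    refine ⟨hlt, ?_⟩
    have := hsopt (w - d)
    have hdw : d ≤ w := by rw [← NNReal.coe_le_coe]; linarith
    simp only [priceRevenue, NNReal.coe_sub hdw] at this
    convert this using 4
    ring
  obtain ⟨u, hu, hu2⟩ := h'.le_max
  have hRu : 0 < priceRevenue D κ' u := lt_of_lt_of_le (by rw [hsd]; positivity) (hu (s + d))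
  -- For `n' = 1` the exponents `n' - 1` vanish and `le_max` says nothing about `G'`. Both markets
  -- are monopolies, and each support price `w` of `G'` is compared directly.
  rcases Nat.lt_or_ge n' 2 with hn' | hn'
  · obtain rfl : n' = 1 := by omega
    obtain rfl : n = 1 := by omega
    apply finish
    have hall : ∀ w ∈ G'.support, (w : ℝ) + κ' ≤ t := by
      intro w hw
      by_contra hwt
      obtain ⟨h1, h2⟩ := sup w (not_le.1 hwt)
      have h3 := h'.support_opt w hw (s + d)
      rw [hsd] at h3
      simp only [Nat.sub_self, pow_zero, one_mul, mul_one, priceRevenue] at h2 h3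
      have h4 : (s + d) * (w - d) * D (s + (κ' + d)) ≤ w * s * D (s + (κ' + d)) := by
        have e1 : (s + d : ℝ) * D (s + (κ' + d)) * (w - d) ≤ w * D (w + κ') * (w - d) := by
          gcongr; linarith
        have e2 : (w : ℝ) * ((w - d) * D (w + κ')) ≤ w * (s * D (s + (κ' + d))) := by gcongr
        nlinarith
      have h5 := le_of_mul_le_mul_right h4 hDs
      nlinarith
    have h1 : G'.real {p | (p : ℝ) + κ' ≤ t} = 1 := by
      have : {p : ℝ≥0 | (p : ℝ) + κ' ≤ t} ∈ ae G' :=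
        Filter.mem_of_superset Measure.support_mem_ae hall
      rw [measureReal_def, (mem_ae_iff_prob_eq_one₀ ?_).1 this, ENNReal.toReal_one]
      exact (isClosed_le (by fun_prop) (by fun_prop)).measurableSet.nullMeasurableSet
    rw [ha', h1, mul_one]
  -- If the monopoly price `u` has total at most `t`, the bound `le_max` at `u` itself shows that
  -- rivals are almost surely no more expensive than `u`. Otherwise `u` plays the role of `w`.
  · by_cases hut : (u : ℝ) + κ' ≤ t
    · apply finish
      refine (mono_set u hut).trans ?_
      have h1 := hu2 u
      rw [mul_comm] at h1
      have h2 := le_of_mul_le_mul_right h1 hRu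
      exact le_of_pow_le_pow_left₀ (by omega) hb.le h2
    · obtain ⟨h1, h2⟩ := sup u (not_le.1 hut)
      refine pow_le_pow_of_mul_pow_pred_le hb hb1 hba ha0 hnn hn' ?_
      have h3 : (s + d) * D (s + (κ' + d)) * a' ^ (n' - 1)
          ≤ (1 - π) ^ (n' - 1) * (u * D (u + κ')) := by
        have h4 := hu2 (s + d)
        rw [hsd] at h4
        refine le_trans ?_ h4
        gcongr
        exact mono_set _ (by push_cast; linarith)
      have hpp : 0 < (s + d) * (u - d) * D (s + (κ' + d)) := by
        have : 0 < (u : ℝ) - d := by linarith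
        positivity
      refine le_of_mul_le_mul_left ?_ hpp
      have hap : 0 ≤ a ^ (n - 1) := pow_nonneg (hb.le.trans hba) _
      have hbn : 0 < (1 - π) ^ (n - 1) := by positivity
      have hbn' : 0 < (1 - π) ^ (n' - 1) := by positivity
      have hud : 0 < (u : ℝ) - d := by linarith
      calc (s + d) * (u - d) * D (s + (κ' + d)) * ((1 - π) ^ (n - 1) * a' ^ (n' - 1))
          = (1 - π) ^ (n - 1) * (u - d) * ((s + d) * D (s + (κ' + d)) * a' ^ (n' - 1)) := by ring
        _ ≤ (1 - π) ^ (n - 1) * (u - d) * ((1 - π) ^ (n' - 1) * (u * D (u + κ'))) := by gcongr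
        _ = (1 - π) ^ (n' - 1) * u * ((1 - π) ^ (n - 1) * ((u - d) * D (u + κ'))) := by ring
        _ ≤ (1 - π) ^ (n' - 1) * u * (s * D (s + (κ' + d)) * a ^ (n - 1)) := by gcongr
        _ = (u * s) * (D (s + (κ' + d)) * ((1 - π) ^ (n' - 1) * a ^ (n - 1))) := by ring
        _ ≤ ((s + d) * (u - d)) * (D (s + (κ' + d)) * ((1 - π) ^ (n' - 1) * a ^ (n - 1))) := by
          gcongr ?_ * _
          -- `(s + d) (u - d) - u s = d (u - d - s)`, which is positive by `h1`.
          nlinarith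
        _ = _ := by ring

/-- Positive indices are strict inequalities, so welfare needs `<` where the pricing comparison has
`≤`; continuity from below bridges the two. -/
lemma tendsto_measureReal_add_le {G : Measure ℝ≥0} [IsProbabilityMeasure G] (κ t : ℝ) :
    Tendsto (fun k : ℕ => G.real {p | (p : ℝ) + κ ≤ t - 1 / ((k : ℝ) + 1)}) atTop
      (𝓝 (G.real {p | (p : ℝ) + κ < t})) := by
  have hU : {p : ℝ≥0 | (p : ℝ) + κ < t} = ⋃ k : ℕ, {p : ℝ≥0 | (p : ℝ) + κ ≤ t - 1 / ((k : ℝ) + 1)} := by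
    ext p
    simp only [Set.mem_ofPred_eq, Set.mem_iUnion]
    constructor
    · intro h
      obtain ⟨k, hk⟩ := exists_nat_one_div_lt (sub_pos.2 h)
      exact ⟨k, by linarith⟩
    · rintro ⟨k, hk⟩
      have : 0 < 1 / ((k : ℝ) + 1) := by positivity
      linarith
  rw [hU]
  refine (ENNReal.tendsto_toReal (measure_ne_top G _)).comp (tendsto_measure_iUnion_atTop ?_)
  intro k l hkl p hp
  simp only [Set.mem_ofPred_eq] at hp ⊢
  have : 1 / ((l : ℝ) + 1) ≤ 1 / ((k : ℝ) + 1) := by gcongr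
  linarith

theorem IsOptimalPricing.pow_le_pow_lt {D : ℝ → ℝ} {κ κ' π : ℝ} (hκ : κ' < κ) (hπ0 : 0 < π)
    (hπ1 : π < 1) {n n' : ℕ} (hn : 1 ≤ n) (hnn : n ≤ n')
    {G G' : Measure ℝ≥0} [IsProbabilityMeasure G] [IsProbabilityMeasure G']
    (h : IsOptimalPricing D κ π n G) (h' : IsOptimalPricing D κ' π n' G')
    (hpos : ∃ p, 0 < priceRevenue D κ p) (t : ℝ) :
    (1 - π * G'.real {p | (p : ℝ) + κ' < t}) ^ n' ≤ (1 - π * G.real {p | (p : ℝ) + κ < t}) ^ n :=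
  le_of_tendsto_of_tendsto'
    ((((tendsto_measureReal_add_le κ' t).const_mul π).const_sub 1).pow n')
    ((((tendsto_measureReal_add_le κ t).const_mul π).const_sub 1).pow n)
    fun _ => h.pow_le_pow hκ hπ0 hπ1 hn hnn h' hpos _

/-! ### Construction of an equilibrium price law -/

lemma continuous_measureReal_Iic {α : Type*} [TopologicalSpace α] [LinearOrder α] [OrderTopology α]
    [SecondCountableTopology α] [MeasurableSpace α] [BorelSpace α]
    {μ : Measure α} [IsFiniteMeasure μ] (h : ∀ x, μ {x} = 0) :
    Continuous fun x => μ.real (Set.Iic x) := by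
  refine continuous_iff_continuousAt.2 fun x => ?_
  refine (ENNReal.tendsto_toReal (measure_ne_top μ _)).comp ?_
  refine tendsto_measure_of_ae_tendsto_indicator_of_isFiniteMeasure (𝓝 x) measurableSet_Iic
    (fun _ => measurableSet_Iic) ?_
  have : ∀ᵐ y ∂μ, y ≠ x := by rw [ae_iff]; simpa using h x
  filter_upwards [this] with y hy
  rcases lt_or_gt_of_ne hy with h1 | h1
  · filter_upwards [lt_mem_nhds h1] with z hz
    simp [h1.le, hz.le]
  · filter_upwards [gt_mem_nhds h1] with z hz
    exact iff_of_false (not_le.2 hz) (not_le.2 h1)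

/-- A price at quantile `u` must satisfy `R p = lev u := C / (1 - π u) ^ k` in order to earn the
constant `C = (1 - π) ^ k R top`. The least price with revenue at least `lev u` does so by the
intermediate value theorem, and it is strictly increasing in `u`; its law under uniform `u` is `G`.
`R` need not be monotone or concave: prices in the gaps of the support earn at most `C`, because
being the least price at a level makes deviations with the same `R` weakly more expensive. -/
theorem exists_atomless_pricing {R : ℝ≥0 → ℝ} (hR : Continuous R) (hR0 : R 0 = 0) {top : ℝ≥0}
    (hmax : ∀ p, R p ≤ R top) (hpos : 0 < R top) {π : ℝ} (hπ0 : 0 < π) (hπ1 : π < 1) {k : ℕ}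
    (hk : k ≠ 0) :
    ∃ G : ProbabilityMeasure ℝ≥0, (∀ p, (G : Measure ℝ≥0) {p} = 0) ∧
      ∀ s ∈ (G : Measure ℝ≥0).support, ∀ p,
        R p * (1 - π * (G : Measure ℝ≥0).real (Set.Iic p)) ^ k
          ≤ R s * (1 - π * (G : Measure ℝ≥0).real (Set.Iic s)) ^ k := by
  set C := (1 - π) ^ k * R top with hC
  have hb : 0 < 1 - π := by linarith
  have hCpos : 0 < C := by positivity
  have hden : ∀ u : I, 0 < 1 - π * u := fun u => by nlinarith [u.2.1, u.2.2]
  set lev : I → ℝ := fun u => C / (1 - π * u) ^ k with hlev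
  have hlev_mono : StrictMono lev := by
    intro u v huv
    have huv : (u : ℝ) < v := huv
    have := hden v
    apply div_lt_div_of_pos_left hCpos (pow_pos (hden v) _)
    apply pow_lt_pow_left₀ _ (hden v).le hk
    nlinarith
  have hlev_pos : ∀ u, 0 < lev u := fun u => div_pos hCpos (pow_pos (hden u) _)
  have hlev_one : lev 1 = R top := by
    simp only [hlev, hC, Set.Icc.coe_one, mul_one]
    field_simp
  have hlev_le : ∀ u, lev u ≤ R top := fun u => hlev_one ▸ hlev_mono.monotone u.2.2
  have hlev_mul : ∀ u : I, lev u * (1 - π * u) ^ k = C := fun u => by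
    have := hden u
    simp only [hlev]; field_simp
  set q : I → ℝ≥0 := fun u => sInf {p | lev u ≤ R p} with hq
  have hne : ∀ u, {p | lev u ≤ R p}.Nonempty := fun u => ⟨top, hlev_le u⟩
  have hge : ∀ u, lev u ≤ R (q u) := fun u =>
    (isClosed_le continuous_const hR).csInf_mem (hne u) (OrderBot.bddBelow _)
  have hqle : ∀ u p, lev u ≤ R p → q u ≤ p := fun u p hp => csInf_le (OrderBot.bddBelow _) hp
  have ivt : ∀ v p, 0 ≤ v → v ≤ R p → ∃ r ≤ p, R r = v := by
    intro v p hv hvp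
    obtain ⟨r, hr, hrv⟩ := intermediate_value_Icc (zero_le : (0 : ℝ≥0) ≤ p) hR.continuousOn
      ⟨by rw [hR0]; exact hv, hvp⟩
    exact ⟨r, hr.2, hrv⟩
  have hRq : ∀ u, R (q u) = lev u := by
    intro u
    obtain ⟨r, hr, hru⟩ := ivt _ _ (hlev_pos u).le (hge u)
    rw [le_antisymm hr (hqle u r hru.ge)] at hru
    exact hru
  have hqmono : StrictMono q := by
    intro u v huv
    refine lt_of_le_of_ne (hqle u _ ((hlev_mono huv).le.trans (hge v))) fun h => ?_
    have := hRq v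
    rw [← h, hRq u] at this
    exact (hlev_mono huv).ne this
  have hqmeas : Measurable q := hqmono.monotone.measurable
  set G : Measure ℝ≥0 := (volume : Measure I).map q with hG
  have hGp : IsProbabilityMeasure G := Measure.isProbabilityMeasure_map hqmeas.aemeasurable
  have hGq : ∀ u : I, G.real (Set.Iic (q u)) = u := by
    intro u
    rw [measureReal_def, hG, Measure.map_apply hqmeas measurableSet_Iic]
    have : q ⁻¹' Set.Iic (q u) = Set.Iic u := by
      ext v; simp [hqmono.le_iff_le]
    rw [this, unitInterval.volume_Iic, ENNReal.toReal_ofReal u.2.1]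
  have hatom : ∀ p, G {p} = 0 := by
    intro p
    rw [hG, Measure.map_apply hqmeas (measurableSet_singleton p)]
    refine Set.Subsingleton.measure_zero ?_ _
    intro u hu v hv
    exact hqmono.injective (Eq.trans hu (Eq.symm hv))
  have hcont : Continuous fun p => R p * (1 - π * G.real (Set.Iic p)) ^ k :=
    hR.mul ((continuous_const.sub (continuous_const.mul
      (continuous_measureReal_Iic hatom))).pow k)
  refine ⟨⟨G, hGp⟩, hatom, fun s hs p => ?_⟩
  -- Revenue equals `C` at the prices `q u`, which carry all the mass; continuity extends this to
  -- the closed support.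
  have hs' : R s * (1 - π * G.real (Set.Iic s)) ^ k = C := by
    have hcl : IsClosed {p | R p * (1 - π * G.real (Set.Iic p)) ^ k = C} :=
      isClosed_eq hcont continuous_const
    refine Measure.support_subset_of_isClosed hcl ?_ hs
    change _ ∈ ae G
    rw [hG, mem_ae_map_iff hqmeas.aemeasurable hcl.measurableSet]
    refine Filter.univ_mem' fun u => ?_
    change R (q u) * (1 - π * G.real (Set.Iic (q u))) ^ k = C
    rw [hGq, hRq, hlev_mul]
  change R p * (1 - π * G.real (Set.Iic p)) ^ k ≤ R s * (1 - π * G.real (Set.Iic s)) ^ k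
  rw [hs']
  have hle1 : G.real (Set.Iic p) ≤ 1 := measureReal_le_one
  -- Since `lev 0 = C`, a price with revenue at most `lev 0` earns at most `C` even without rivals.
  -- Any other revenue is a level `lev u`, and then `q u ≤ p`, so at least a fraction `u` of the
  -- rivals' mass is at or below `p`.
  by_cases hp : R p ≤ lev 0
  · have h0 : lev 0 = C := by simp [hlev]
    by_cases hp0 : 0 ≤ R p
    · calc R p * (1 - π * G.real (Set.Iic p)) ^ k ≤ R p * 1 := by
            gcongr
            refine pow_le_one₀ ?_ ?_ <;> nlinarith [measureReal_nonneg (μ := G) (s := Set.Iic p)]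
        _ ≤ C := by rw [mul_one, ← h0]; exact hp
    · have : 0 ≤ (1 - π * G.real (Set.Iic p)) ^ k := pow_nonneg (by nlinarith) _
      nlinarith
  · have hlevcont : Continuous lev := by
      apply Continuous.div continuous_const (by fun_prop)
      exact fun u => (pow_pos (hden u) _).ne'
    obtain ⟨u, hu⟩ : ∃ u : I, lev u = R p := by
      have := intermediate_value_univ (0 : I) 1 hlevcont
      exact this ⟨(not_le.1 hp).le, hlev_one ▸ hmax p⟩
    rw [← hlev_mul u, ← hu]
    have h1 : (u : ℝ) ≤ G.real (Set.Iic p) := by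
      rw [← hGq u]
      exact measureReal_mono (Set.Iic_subset_Iic.2 (hqle u p hu.le))
    have := hlev_pos u
    gcongr
    nlinarith

/-! ### The index policy of one consumer -/

namespace Consumer

variable {m : ℕ} {a a' : Consumer m} {x : Fin m → ℝ} {i j k : Fin m}

lemma not_before_self : ¬ a.Before x j j := by
  rintro (h | ⟨-, h⟩) <;> exact lt_irrefl _ h

lemma Before.trans (h₁ : a.Before x i j) (h₂ : a.Before x j k) : a.Before x i k := by
  rcases h₁ with h₁ | ⟨h₁, h₁'⟩ <;> rcases h₂ with h₂ | ⟨h₂, h₂'⟩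
  · exact Or.inl (h₂.trans h₁)
  · exact Or.inl (by rwa [← h₂])
  · exact Or.inl (by rwa [h₁])
  · exact Or.inr ⟨h₁.trans h₂, h₁'.trans h₂'⟩

lemma Before.le (h : a.Before x j k) : x k ≤ x j := by
  rcases h with h | ⟨h, -⟩
  · exact h.le
  · exact h.ge

lemma before_or_before (h : j ≠ k) : a.Before x j k ∨ a.Before x k j := by
  have hr : a.rank j ≠ a.rank k := fun h' => h ((a.2.1).injective h')
  rcases lt_trichotomy (x j) (x k) with h1 | h1 | h1
  · exact Or.inr (Or.inl h1)
  · rcases lt_or_gt_of_ne hr with h2 | h2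
    · exact Or.inl (Or.inr ⟨h1, h2⟩)
    · exact Or.inr (Or.inr ⟨h1.symm, h2⟩)
  · exact Or.inl (Or.inl h1)

/-- `Before` is a strict total order on a finite set. Its first element among the fits with positive
index is reached by the search, since nothing before it fits. -/
lemma exists_transacts (h : ∃ k, a.fit k = true ∧ 0 < x k) :
    ∃ j, a.Transacts x j ∧ ∀ k, a.fit k = true → k ≠ j → a.Before x j k := by
  have : IsTrans (Fin m) (a.Before x) := ⟨fun _ _ _ => Before.trans⟩
  have : Std.Irrefl (a.Before x) := ⟨fun _ => not_before_self⟩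
  have wf : WellFounded (a.Before x) := Finite.wellFounded_of_trans_of_irrefl _
  obtain ⟨j, ⟨hj, hxj⟩, hmin⟩ := wf.has_min {k | a.fit k = true ∧ 0 < x k} h
  have hfirst : ∀ k, a.Before x k j → a.fit k = false := by
    intro k hk
    by_contra hf
    exact hmin k ⟨by simpa using hf, hxj.trans_le hk.le⟩ hk
  refine ⟨j, ⟨⟨hxj, hfirst⟩, hj⟩, fun k hk hkj => ?_⟩
  refine (before_or_before hkj).resolve_left fun hb => ?_
  simp [hfirst k hb] at hk

lemma Transacts.eq (hj : a.Transacts x j) (hk : a.Transacts x k) : j = k := by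
  by_contra hne
  rcases before_or_before (a := a) (x := x) hne with h | h
  · have := hk.1.2 j h
    rw [hj.2] at this; exact absurd this (by simp)
  · have := hj.1.2 k h
    rw [hk.2] at this; exact absurd this (by simp)

/-- A search sees only the fits of inspected businesses, so two consumers who agree on those search
identically. This is what allows the fits to be read from stacks on demand. -/
lemma inspects_congr (hrank : a.2.1 = a'.2.1)
    (h : ∀ j, a.Inspects x j → a.fit j = a'.fit j) : a.Inspects x j ↔ a'.Inspects x j := by
  have hB : ∀ i k, a'.Before x i k ↔ a.Before x i k := by
    intro i k; simp [Before, rank, hrank]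
  refine and_congr_right fun hxj => ⟨fun hI k hk => ?_, fun hI k hk => ?_⟩
  · rw [hB] at hk
    rw [← h k ⟨hxj.trans_le hk.le, fun l hl => hI l (hl.trans hk)⟩]
    exact hI k hk
  -- If `k` fits for `a` and comes before `j`, then `a` transacts no later than `k`, with some `t`.
  -- As `t` is inspected by `a`, it fits for `a'` as well, who then stops before `j`.
  · by_contra hf
    obtain ⟨t, ht, ht'⟩ := exists_transacts (a := a) (x := x)
      ⟨k, by simpa using hf, hxj.trans_le hk.le⟩
    have htj : a.Before x t j := by
      by_cases hkt : k = t
      · exact hkt ▸ hk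
      · exact (ht' k (by simpa using hf) hkt).trans hk
    have := hI t ((hB t j).2 htj)
    rw [← h t ht.1, ht.2] at this
    exact absurd this (by simp)

/-- Whether a business is inspected does not depend on its own fit and quality realization. -/
lemma inspects_update {v : ℝ} {r : Equiv.Perm (Fin m)} {b : Fin m → Bool × Bool} {y : Bool × Bool} :
    Inspects (v, r, Function.update b j y) x j ↔ Inspects (v, r, b) x j := by
  refine and_congr_right fun _ => forall_congr' fun k => ?_
  by_cases hk : k = j
  · subst hk
    exact ⟨fun _ h => absurd h not_before_self, fun _ h => absurd h not_before_self⟩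
  · simp [Before, rank, fit, Function.update_of_ne hk]

lemma sum_transacts_eq (hj : a.Transacts x j) (f : Fin m → ℝ) :
    ∑ k, (if a.Transacts x k then f k else 0) = f j := by
  rw [Finset.sum_eq_single j]
  · simp [hj]
  · intro k _ hkj
    rw [if_neg fun hk => hkj (hk.eq hj)]
  · simp

/-- The sum is the index of the business transacted with, the largest positive index among the fits,
or `0` if there is none. Its tail events therefore ignore search order and ties. -/
lemma lt_sum_transacts_iff {y : ℝ} (hy : 0 ≤ y) :
    y < ∑ k, (if a.Transacts x k then x k else 0) ↔ ∃ k, a.fit k = true ∧ y < x k := by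
  by_cases h : ∃ k, a.fit k = true ∧ 0 < x k
  · obtain ⟨j, hj, hj'⟩ := exists_transacts h
    rw [sum_transacts_eq hj]
    refine ⟨fun hlt => ⟨j, hj.2, hlt⟩, ?_⟩
    rintro ⟨k, hk, hlt⟩
    by_cases hkj : k = j
    · rwa [← hkj]
    · exact hlt.trans_le (hj' k hk hkj).le
  · have h0 : ∀ k, ¬ a.Transacts x k := fun k hk => h ⟨k, hk.2, hk.1.1⟩
    simp only [h0, if_false, Finset.sum_const_zero]
    refine iff_of_false hy.not_gt ?_
    rintro ⟨k, hk, hlt⟩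
    exact h ⟨k, hk, hy.trans_lt hlt⟩

lemma sum_transacts_const (w : ℝ) :
    ∑ k, (if a.Transacts x k then w else 0) = if ∃ k, a.fit k = true ∧ 0 < x k then w else 0 := by
  split_ifs with h
  · obtain ⟨j, hj, -⟩ := exists_transacts h
    exact sum_transacts_eq hj fun _ => w
  · have h0 : ∀ k, ¬ a.Transacts x k := fun k hk => h ⟨k, hk.2, hk.1.1⟩
    simp [h0]

end Consumer

/-! ### Product measures and the law of prices, consumers and fits -/

instance (m : ℕ) : DiscreteMeasurableSpace (Equiv.Perm (Fin m)) := ⟨fun _ => trivial⟩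

section Pi

variable {ι : Type*} [Fintype ι] [DecidableEq ι] {X : ι → Type*} [∀ i, MeasurableSpace (X i)]
  {μ : ∀ i, Measure (X i)} [∀ i, IsProbabilityMeasure (μ i)]

/-- Resampling one coordinate preserves a product measure. -/
lemma measurePreserving_update (j : ι) :
    MeasurePreserving (fun q : (∀ i, X i) × X j => Function.update q.1 j q.2)
      ((Measure.pi μ).prod (μ j)) (Measure.pi μ) := by
  have hm : Measurable (fun q : (∀ i, X i) × X j => Function.update q.1 j q.2) := by
    refine measurable_pi_iff.2 fun i => ?_
    by_cases hi : i = j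
    · subst hi; simpa using measurable_snd
    · simp only [Function.update_of_ne hi]; fun_prop
  refine ⟨hm, (Measure.pi_eq fun s hs => ?_).symm⟩
  rw [Measure.map_apply hm (MeasurableSet.univ_pi hs)]
  have : (fun q : (∀ i, X i) × X j => Function.update q.1 j q.2) ⁻¹' Set.univ.pi s
      = (Set.univ.pi (Function.update s j Set.univ)) ×ˢ s j := by
    ext ⟨b, y⟩
    simp only [Set.mem_preimage, Set.mem_pi, Set.mem_univ, true_imp_iff, Set.mem_prod]
    constructor
    · intro h
      refine ⟨fun i => ?_, by simpa using h j⟩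
      by_cases hi : i = j
      · subst hi; simp
      · simpa [Function.update_of_ne hi] using h i
    · rintro ⟨h, hy⟩ i
      by_cases hi : i = j
      · subst hi; simpa using hy
      · simpa [Function.update_of_ne hi] using h i
  rw [this, Measure.prod_prod, Measure.pi_pi, ← Finset.prod_erase_mul _ _ (Finset.mem_univ j),
    ← Finset.prod_erase_mul _ (fun i => μ i (s i)) (Finset.mem_univ j)]
  simp only [Function.update_self, measure_univ, mul_one]
  congr 1
  refine Finset.prod_congr rfl fun i hi => ?_
  rw [Function.update_of_ne (Finset.ne_of_mem_erase hi)]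

/-- Resampling coordinate `j` leaves `f` unchanged and averages `g` to `0`. It is applied with `f`
the indicator that `j` is inspected, which does not depend on the outcome at `j`. -/
lemma integral_mul_eval_eq_zero [∀ i, Finite (X i)] [∀ i, MeasurableSingletonClass (X i)] (j : ι)
    {f : (∀ i, X i) → ℝ} {g : X j → ℝ} (hf : ∀ b y, f (Function.update b j y) = f b)
    (hg : ∫ y, g y ∂μ j = 0) : ∫ b, f b * g (b j) ∂Measure.pi μ = 0 := by
  rw [← (measurePreserving_update (μ := μ) j).map_eq, integral_map, integral_prod]
  · simp [hf, integral_const_mul, hg]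
  · exact Integrable.of_finite
  · exact (measurePreserving_update (μ := μ) j).measurable.aemeasurable
  · exact (Integrable.of_finite (μ := Measure.map _ _)).aestronglyMeasurable

end Pi

lemma measurePreserving_prod_left_comm {α β γ : Type*} [MeasurableSpace α] [MeasurableSpace β]
    [MeasurableSpace γ] (μ : Measure α) (ν : Measure β) (ξ : Measure γ) [IsProbabilityMeasure μ]
    [IsProbabilityMeasure ν] [IsProbabilityMeasure ξ] :
    MeasurePreserving (fun q : α × β × γ => (q.2.1, q.1, q.2.2)) (μ.prod (ν.prod ξ))
      (ν.prod (μ.prod ξ)) := by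
  have h1 := (measurePreserving_prodAssoc μ ν ξ).symm
  have h2 := (Measure.measurePreserving_swap (μ := μ) (ν := ν)).prod (MeasurePreserving.id ξ)
  have h3 := measurePreserving_prodAssoc ν μ ξ
  exact h3.comp (h2.comp h1)

/-- The joint law of fits and quality realizations. -/
noncomputable def fitLaw {m : ℕ} (M : Market m) : Measure (Fin m → Bool × Bool) :=
  Measure.pi fun j =>
    (bernoulliMeasure true false (M.fit j)).prod (bernoulliMeasure true false (M.quality j))

instance {m : ℕ} (M : Market m) : IsProbabilityMeasure (fitLaw M) := by
  unfold fitLaw; infer_instance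

instance {m : ℕ} (M : Market m) : IsProbabilityMeasure M.consumerLaw := by
  unfold Market.consumerLaw; infer_instance

instance {m : ℕ} (M : Market m) (Φ : SteadyState m) : IsProbabilityMeasure (M.steadyLaw Φ) := by
  unfold Market.steadyLaw; infer_instance

namespace Market

variable {m : ℕ} (M : Market m)

lemma fit_pos' (j : Fin m) : 0 < (M.fit j : ℝ) := M.fit_pos j

lemma fit_lt_one' (j : Fin m) : (M.fit j : ℝ) < 1 := M.fit_lt_one j

lemma integral_bernoulli_prod (j : Fin m) (g : Bool × Bool → ℝ) :
    ∫ y, g y ∂(bernoulliMeasure true false (M.fit j)).prod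
        (bernoulliMeasure true false (M.quality j))
      = M.fit j * (M.quality j * g (true, true) + (1 - M.quality j) * g (true, false))
        + (1 - M.fit j) * (M.quality j * g (false, true) + (1 - M.quality j) * g (false, false)) := by
  rw [integral_prod _ Integrable.of_finite]
  simp [integral_bernoulliMeasure]

end Market

namespace Consumer

variable {m : ℕ} {Ω : Type*} [MeasurableSpace Ω]

lemma measurable_fit {A : Ω → Consumer m} (hA : Measurable A) (j : Fin m) :
    Measurable fun ω => (A ω).fit j := by unfold fit; fun_prop

lemma measurable_quality {A : Ω → Consumer m} (hA : Measurable A) (j : Fin m) :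
    Measurable fun ω => (A ω).quality j := by unfold quality; fun_prop

lemma measurableSet_before {A : Ω → Consumer m} (hA : Measurable A) {x : Ω → Fin m → ℝ}
    (hx : ∀ j, Measurable fun ω => x ω j) (k j : Fin m) :
    MeasurableSet {ω | (A ω).Before (x ω) k j} :=
  (measurableSet_lt (hx j) (hx k)).union ((measurableSet_eq_fun (hx k) (hx j)).inter
    (hA.snd.fst (MeasurableSet.of_discrete (s := {e : Equiv.Perm (Fin m) | e k < e j}))))

lemma measurableSet_inspects {A : Ω → Consumer m} (hA : Measurable A) {x : Ω → Fin m → ℝ}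
    (hx : ∀ j, Measurable fun ω => x ω j) (j : Fin m) :
    MeasurableSet {ω | (A ω).Inspects (x ω) j} := by
  refine (measurableSet_lt measurable_const (hx j)).inter ?_
  have : {ω | ∀ k, (A ω).Before (x ω) k j → (A ω).fit k = false}
      = ⋂ k, ({ω | (A ω).Before (x ω) k j}ᶜ ∪ {ω | (A ω).fit k = false}) := by
    ext ω; simp [imp_iff_not_or]
  change MeasurableSet {ω | ∀ k, (A ω).Before (x ω) k j → (A ω).fit k = false}
  rw [this]
  exact MeasurableSet.iInter fun k => (measurableSet_before hA hx k j).compl.union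
    (measurable_fit hA k (measurableSet_singleton false))

lemma measurableSet_transacts {A : Ω → Consumer m} (hA : Measurable A) {x : Ω → Fin m → ℝ}
    (hx : ∀ j, Measurable fun ω => x ω j) (j : Fin m) :
    MeasurableSet {ω | (A ω).Transacts (x ω) j} :=
  (measurableSet_inspects hA hx j).inter (measurable_fit hA j (measurableSet_singleton true))

end Consumer

namespace Market

variable {m : ℕ} (M : Market m)

/-- The joint law of the prices of `Φ` and of the fits and quality realizations. -/
noncomputable def pairLaw (Φ : SteadyState m) : Measure ((Fin m → ℝ≥0) × (Fin m → Bool × Bool)) :=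
  (Measure.pi fun j => (Φ.price j : Measure ℝ≥0)).prod (fitLaw M)

instance (Φ : SteadyState m) : IsProbabilityMeasure (M.pairLaw Φ) := by
  unfold pairLaw; infer_instance

lemma integral_steadyLaw (Φ : SteadyState m) {F : (Fin m → ℝ≥0) × Consumer m → ℝ}
    (hF : Integrable F (M.steadyLaw Φ)) :
    ∫ z, F z ∂M.steadyLaw Φ = ∫ v, ∑ r, (M.tieLaw r).toReal *
      ∫ q, F (q.1, v, r, q.2) ∂M.pairLaw Φ ∂(M.valueLaw : Measure ℝ) := by
  have e1 := measurePreserving_prod_left_comm (M.valueLaw : Measure ℝ)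
    (Measure.pi fun j => (Φ.price j : Measure ℝ≥0)) (M.tieLaw.toMeasure.prod (fitLaw M))
  have e2 := (MeasurePreserving.id (M.valueLaw : Measure ℝ)).prod
    (measurePreserving_prod_left_comm M.tieLaw.toMeasure
    (Measure.pi fun j => (Φ.price j : Measure ℝ≥0)) (fitLaw M))
  have e := e1.comp e2
  have hlaw : M.steadyLaw Φ = (Measure.pi fun j => (Φ.price j : Measure ℝ≥0)).prod
    ((M.valueLaw : Measure ℝ).prod (M.tieLaw.toMeasure.prod (fitLaw M))) := rfl
  rw [hlaw] at hF ⊢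
  have hF' := (e.integrable_comp hF.aestronglyMeasurable).2 hF
  rw [← e.map_eq] at hF
  rw [← e.map_eq, integral_map e.measurable.aemeasurable hF.aestronglyMeasurable]
  change ∫ x, (F ∘ _) x ∂_ = _
  rw [integral_prod (F ∘ _) hF']
  refine integral_congr_ae ?_
  filter_upwards [hF'.prod_right_ae] with v hv
  rw [integral_prod _ hv, PMF.integral_eq_sum]
  rfl

lemma integral_eq_zero_of_fitLaw (Φ : SteadyState m) {F : (Fin m → ℝ≥0) × Consumer m → ℝ}
    (hF : Integrable F (M.steadyLaw Φ))
    (h : ∀ z r, ∀ᵐ v ∂(M.valueLaw : Measure ℝ), ∫ b, F (z, v, r, b) ∂fitLaw M = 0) :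
    ∫ z, F z ∂M.steadyLaw Φ = 0 := by
  have hlaw : M.steadyLaw Φ = (Measure.pi fun j => (Φ.price j : Measure ℝ≥0)).prod
    ((M.valueLaw : Measure ℝ).prod (M.tieLaw.toMeasure.prod (fitLaw M))) := rfl
  rw [hlaw] at hF ⊢
  rw [integral_prod _ hF]
  refine integral_eq_zero_of_ae ?_
  filter_upwards [hF.prod_right_ae] with z hz
  rw [integral_prod _ hz]
  refine integral_eq_zero_of_ae ?_
  have hall := ae_all_iff.2 fun r => h z r
  filter_upwards [hz.prod_right_ae, hall] with v hv hvr
  rw [integral_prod _ hv]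
  exact integral_eq_zero_of_ae (ae_of_all _ hvr)

/-- The indicator of the event is a product over businesses, and prices and fits are independent
across businesses. -/
lemma real_pairLaw_forall_not (Φ : SteadyState m) {A : Fin m → Set ℝ≥0}
    (hA : ∀ i, MeasurableSet (A i)) :
    (M.pairLaw Φ).real {q | ∀ i, ¬ (q.1 i ∈ A i ∧ (q.2 i).1 = true)}
      = ∏ i, (1 - M.fit i * (Φ.price i : Measure ℝ≥0).real (A i)) := by
  have hs : MeasurableSet {q : (Fin m → ℝ≥0) × (Fin m → Bool × Bool) |
      ∀ i, ¬ (q.1 i ∈ A i ∧ (q.2 i).1 = true)} := by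
    simp only [Set.ofPred_forall]
    refine MeasurableSet.iInter fun i => MeasurableSet.compl (MeasurableSet.inter ?_ ?_)
    · exact (by fun_prop : Measurable fun q : (Fin m → ℝ≥0) × (Fin m → Bool × Bool) => q.1 i) (hA i)
    · exact (by fun_prop : Measurable fun q : (Fin m → ℝ≥0) × (Fin m → Bool × Bool) => (q.2 i).1)
        (measurableSet_singleton true)
  have hfac : ∀ q : (Fin m → ℝ≥0) × (Fin m → Bool × Bool),
      Set.indicator {q | ∀ i, ¬ (q.1 i ∈ A i ∧ (q.2 i).1 = true)} (1 : (Fin m → ℝ≥0) × (Fin m → Bool × Bool) → ℝ) q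
        = ∏ i, (1 - (A i).indicator 1 (q.1 i) * (if (q.2 i).1 = true then 1 else 0)) := by
    intro q
    by_cases h : ∀ i, ¬ (q.1 i ∈ A i ∧ (q.2 i).1 = true)
    · rw [Set.indicator_of_mem (by exact h), Pi.one_apply, Finset.prod_eq_one]
      intro i _
      by_cases hi : q.1 i ∈ A i
      · simp [hi, show (q.2 i).1 = false by simpa using fun h' => h i ⟨hi, h'⟩]
      · simp [hi]
    · rw [Set.indicator_of_notMem (by exact h)]
      push Not at h
      obtain ⟨i, hi, hi'⟩ := h
      exact (Finset.prod_eq_zero (Finset.mem_univ i) (by simp [hi, hi'])).symm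
  rw [← integral_indicator_one hs, pairLaw, integral_prod]
  · simp only [hfac, fitLaw]
    have hin : ∀ z : Fin m → ℝ≥0, ∫ b : Fin m → Bool × Bool,
        ∏ i, ((1 : ℝ) - (A i).indicator 1 (z i) * (if (b i).1 = true then (1 : ℝ) else 0))
          ∂(Measure.pi fun j => (bernoulliMeasure true false (M.fit j)).prod
            (bernoulliMeasure true false (M.quality j)))
        = ∏ i, (1 - (M.fit i : ℝ) * (A i).indicator 1 (z i)) := by
      intro z
      rw [integral_fintype_prod_eq_prod (f := fun i (y : Bool × Bool) =>
        ((1 : ℝ) - (A i).indicator 1 (z i) * (if y.1 = true then (1 : ℝ) else 0)))]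
      refine Finset.prod_congr rfl fun i _ => ?_
      rw [integral_bernoulli_prod]
      simp
      ring
    simp only [hin]
    rw [integral_fintype_prod_eq_prod (f := fun i (y : ℝ≥0) =>
        (1 - (M.fit i : ℝ) * (A i).indicator 1 y))]
    refine Finset.prod_congr rfl fun i _ => ?_
    rw [integral_sub (integrable_const _), integral_const_mul, integral_indicator_one (hA i)]
    · simp
    · exact ((integrable_const 1).indicator (hA i)).const_mul _
  · exact (integrable_const 1).indicator hs

end Market

/-! ### Welfare at a steady state -/

lemma integrable_coe_unitInterval (μ : Measure I) [IsFiniteMeasure μ] :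
    Integrable (fun x : I => (x : ℝ)) μ :=
  Integrable.of_bound (by fun_prop) 1 (ae_of_all _ fun x => by
    rw [Real.norm_eq_abs, abs_of_nonneg x.2.1]; exact x.2.2)

lemma beliefMean_nonneg (μ : Measure I) : 0 ≤ beliefMean μ :=
  integral_nonneg fun x => x.2.1

lemma beliefMean_le_one (μ : Measure I) [IsProbabilityMeasure μ] : beliefMean μ ≤ 1 := by
  calc beliefMean μ ≤ ∫ _ : I, (1 : ℝ) ∂μ :=
        integral_mono (integrable_coe_unitInterval μ) (integrable_const _) fun x => x.2.2
    _ = 1 := by simp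

lemma beliefMean_dirac (x : I) : beliefMean (Measure.dirac x) = x := by
  simp [beliefMean]

namespace Market

variable {m : ℕ} (M : Market m)

/-- The expected search cost until a fit. -/
noncomputable def searchCost (j : Fin m) : ℝ := M.cost / M.fit j

/-- The probability that the expected value of business `j` to a consumer exceeds `t`. -/
noncomputable def demand (j : Fin m) (t : ℝ) : ℝ :=
  (M.valueLaw : Measure ℝ).real {v | t < v * M.quality j}

variable {M} {Φ : SteadyState m} {j : Fin m}

lemma searchCost_nonneg : 0 ≤ M.searchCost j := by
  have := M.fit_pos' j
  unfold searchCost; positivity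

lemma steadyIndex_eq_of_learned (hj : j ∈ M.steadyLearned Φ) (p : Fin m → ℝ≥0) (v : ℝ) :
    M.steadyIndex Φ p v j = v * M.quality j - p j - M.searchCost j := by
  simp [steadyIndex, index, hj.1, hj.2, beliefMean_dirac, searchCost]

lemma index_le_of_mem_Icc {v : ℝ} (hv : v ∈ Set.Icc 0 M.vmax) (p : ℝ≥0) (π : ℝ) {q : ℝ}
    (hq : 0 ≤ q) : M.index p π q v ≤ M.index 0 π q M.vmax := by
  have := mul_le_mul_of_nonneg_right hv.2 hq
  have := p.coe_nonneg
  simp only [index, NNReal.coe_zero]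
  linarith

lemma steadyIndex_nonpos_of_lost (hj : j ∈ M.steadyLost Φ) {v : ℝ} (hv : v ∈ Set.Icc 0 M.vmax)
    (p : Fin m → ℝ≥0) : M.steadyIndex Φ p v j ≤ 0 :=
  (index_le_of_mem_Icc hv _ _ (beliefMean_nonneg _)).trans hj

/-- A price at which a transaction can occur is at most `vmax`. This makes revenues and utilities
integrable, although price laws may have unbounded support. -/
lemma steadyIndex_le {v : ℝ} (hv : v ∈ Set.Icc 0 M.vmax) (p : Fin m → ℝ≥0) :
    M.steadyIndex Φ p v j + p j ≤ M.vmax := by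
  have h1 : 0 ≤ (M.cost : ℝ) / beliefMean (Φ.beliefFit j : Measure I) :=
    div_nonneg M.cost.2 (beliefMean_nonneg _)
  have h2 := beliefMean_le_one (Φ.beliefQuality j : Measure I)
  have h3 := beliefMean_nonneg (Φ.beliefQuality j : Measure I)
  have : v * beliefMean (Φ.beliefQuality j : Measure I) ≤ v := by nlinarith [hv.1]
  simp only [steadyIndex, index]
  linarith [hv.2]

lemma measurable_steadyIndex {Ω : Type*} [MeasurableSpace Ω] {p : Ω → Fin m → ℝ≥0} {v : Ω → ℝ}
    (hp : ∀ j, Measurable fun ω => p ω j) (hv : Measurable v) (j : Fin m) :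
    Measurable fun ω => M.steadyIndex Φ (p ω) (v ω) j := by
  have := hp j
  unfold steadyIndex index
  fun_prop

variable (M Φ) in
lemma ae_steadyLaw_value_mem : ∀ᵐ z ∂M.steadyLaw Φ, z.2.value ∈ Set.Icc 0 M.vmax := by
  have h1 : MeasurePreserving (fun z : (Fin m → ℝ≥0) × Consumer m => z.2.1) (M.steadyLaw Φ)
      (M.valueLaw : Measure ℝ) := measurePreserving_fst.comp measurePreserving_snd
  exact h1.quasiMeasurePreserving.ae M.value_mem

lemma measurable_value : Measurable fun z : (Fin m → ℝ≥0) × Consumer m => z.2.value :=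
  measurable_snd.fst

lemma measurableSet_steady_inspects (j : Fin m) : MeasurableSet
    {z : (Fin m → ℝ≥0) × Consumer m | z.2.Inspects (M.steadyIndex Φ z.1 z.2.value) j} :=
  Consumer.measurableSet_inspects measurable_snd
    (measurable_steadyIndex (fun _ => by fun_prop) measurable_value) j

lemma measurableSet_steady_transacts (j : Fin m) : MeasurableSet
    {z : (Fin m → ℝ≥0) × Consumer m | z.2.Transacts (M.steadyIndex Φ z.1 z.2.value) j} :=
  Consumer.measurableSet_transacts measurable_snd
    (measurable_steadyIndex (fun _ => by fun_prop) measurable_value) j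

variable (M Φ) in
lemma vmax_nonneg : 0 ≤ M.vmax := by
  obtain ⟨v, hv⟩ := M.value_mem.exists
  exact hv.1.trans hv.2

lemma integrable_ite_transacts {f : (Fin m → ℝ≥0) × Consumer m → ℝ} (hf : Measurable f) {C : ℝ}
    (hC : ∀ z : (Fin m → ℝ≥0) × Consumer m, z.2.value ∈ Set.Icc 0 M.vmax →
      z.2.Transacts (M.steadyIndex Φ z.1 z.2.value) j → |f z| ≤ C) :
    Integrable (fun z => if z.2.Transacts (M.steadyIndex Φ z.1 z.2.value) j then f z else 0)
      (M.steadyLaw Φ) := by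
  refine Integrable.of_bound
    (hf.ite (measurableSet_steady_transacts j) measurable_const).aestronglyMeasurable (max C 0) ?_
  filter_upwards [ae_steadyLaw_value_mem M Φ] with z hz
  split_ifs with h
  · exact (hC z hz h).trans (le_max_left _ _)
  · simp

lemma integrable_transacts_price : Integrable (fun z : (Fin m → ℝ≥0) × Consumer m =>
    if z.2.Transacts (M.steadyIndex Φ z.1 z.2.value) j then (z.1 j : ℝ) else 0)
    (M.steadyLaw Φ) := by
  refine integrable_ite_transacts (by fun_prop) (C := M.vmax) fun z hz h => ?_
  have := steadyIndex_le (Φ := Φ) (j := j) hz z.1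
  rw [abs_of_nonneg (NNReal.coe_nonneg _)]
  linarith [h.1.1]

lemma integrable_transacts_index : Integrable (fun z : (Fin m → ℝ≥0) × Consumer m =>
    if z.2.Transacts (M.steadyIndex Φ z.1 z.2.value) j then M.steadyIndex Φ z.1 z.2.value j else 0)
    (M.steadyLaw Φ) := by
  refine integrable_ite_transacts
    (measurable_steadyIndex (fun _ => by fun_prop) measurable_value j) (C := M.vmax)
    fun z hz h => ?_
  have := steadyIndex_le (Φ := Φ) (j := j) hz z.1
  rw [abs_of_pos h.1.1]
  linarith [(z.1 j).coe_nonneg]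

lemma integrable_transacts_utility : Integrable (fun z : (Fin m → ℝ≥0) × Consumer m =>
    if z.2.Transacts (M.steadyIndex Φ z.1 z.2.value) j then
      (if z.2.quality j then z.2.value else 0) - (z.1 j : ℝ) else 0) (M.steadyLaw Φ) := by
  refine integrable_ite_transacts ?_ (C := M.vmax) fun z hz h => ?_
  · refine Measurable.sub (measurable_value.ite ?_ measurable_const) (by fun_prop)
    exact Consumer.measurable_quality measurable_snd j (measurableSet_singleton true)
  · have := steadyIndex_le (Φ := Φ) (j := j) hz z.1
    have h1 := h.1.1
    have h2 := (z.1 j).coe_nonneg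
    rw [abs_le]
    split_ifs <;> constructor <;> linarith [hz.1, hz.2]

lemma integrable_inspects (c : ℝ) : Integrable (fun z : (Fin m → ℝ≥0) × Consumer m =>
    if z.2.Inspects (M.steadyIndex Φ z.1 z.2.value) j then c else 0) (M.steadyLaw Φ) := by
  refine Integrable.of_bound (Measurable.ite (measurableSet_steady_inspects j) measurable_const
    measurable_const).aestronglyMeasurable |c| (ae_of_all _ fun z => ?_)
  split_ifs <;> simp

/-- The utility from the visit of one business can be replaced by the index, which is a sure
payoff, at the time of a transaction. -/
lemma integral_utility_sub_index (hΦ : j ∈ M.steadyLearned Φ ∨ j ∈ M.steadyLost Φ) :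
    ∫ z, ((if z.2.Transacts (M.steadyIndex Φ z.1 z.2.value) j then
      (if z.2.quality j then z.2.value else 0) - (z.1 j : ℝ) else 0)
      - (if z.2.Inspects (M.steadyIndex Φ z.1 z.2.value) j then (M.cost : ℝ) else 0)
      - (if z.2.Transacts (M.steadyIndex Φ z.1 z.2.value) j then
        M.steadyIndex Φ z.1 z.2.value j else 0)) ∂M.steadyLaw Φ = 0 := by
  refine M.integral_eq_zero_of_fitLaw Φ ((integrable_transacts_utility.sub
    (integrable_inspects _)).sub integrable_transacts_index) fun z r => ?_
  filter_upwards [M.value_mem] with v hv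
  rcases hΦ with hj | hj
  · have hx := steadyIndex_eq_of_learned hj z v
    set x := M.steadyIndex Φ z v with hxdef
    have key := integral_mul_eval_eq_zero (μ := fun j => (bernoulliMeasure true false (M.fit j)).prod
      (bernoulliMeasure true false (M.quality j))) j
      (f := fun b => if Consumer.Inspects (v, r, b) x j then (1 : ℝ) else 0)
      -- Given an inspection, the expected gain from `j` beyond its index is `π (v Q - p - x j) -
      -- c`, which vanishes because `v Q - p - x j = c / π`.
      (g := fun y => (if y.1 then (if y.2 then v else 0) - z j - x j else 0) - M.cost)
      (fun b y => if_congr Consumer.inspects_update rfl rfl) (by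
        rw [integral_bernoulli_prod, hx, searchCost]
        have := (M.fit_pos' j).ne'
        simp
        field_simp
        ring)
    refine Eq.trans ?_ key
    refine integral_congr_ae (ae_of_all _ fun b => ?_)
    have hT : Consumer.Transacts (v, r, b) x j ↔
      Consumer.Inspects (v, r, b) x j ∧ (b j).1 = true := Iff.rfl
    change (if Consumer.Transacts (v, r, b) x j then
        (if (b j).2 = true then v else 0) - (z j : ℝ) else 0) -
      (if Consumer.Inspects (v, r, b) x j then (M.cost : ℝ) else 0) -
      (if Consumer.Transacts (v, r, b) x j then x j else 0) = _
    by_cases hI : Consumer.Inspects (v, r, b) x j <;> by_cases hf : (b j).1 = true <;>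
      simp [hT, hI, hf]
    ring
  -- A lost business is never inspected, so its belief being wrong has no effect on utility.
  · have hx := steadyIndex_nonpos_of_lost hj hv z
    have hI : ∀ b, ¬ Consumer.Inspects (v, r, b) (M.steadyIndex Φ z v) j := fun b h =>
      absurd h.1 hx.not_gt
    have hT : ∀ b, ¬ Consumer.Transacts (v, r, b) (M.steadyIndex Φ z v) j := fun b h => hI b h.1
    simp [hI, hT, Consumer.value]

theorem consumerWelfare_eq (hΦ : ∀ j, j ∈ M.steadyLearned Φ ∨ j ∈ M.steadyLost Φ) :
    M.consumerWelfare Φ = ∫ z, ∑ j, (if z.2.Transacts (M.steadyIndex Φ z.1 z.2.value) j then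
        M.steadyIndex Φ z.1 z.2.value j else 0) ∂M.steadyLaw Φ := by
  unfold consumerWelfare Consumer.utility
  refine (integral_finsetSum _ fun j _ => integrable_transacts_utility.sub
    (integrable_inspects _)).trans ?_
  rw [integral_finsetSum _ fun j _ => integrable_transacts_index]
  refine Finset.sum_congr rfl fun j _ => ?_
  exact sub_eq_zero.1 ((integral_sub (integrable_transacts_utility.sub (integrable_inspects _))
    integrable_transacts_index).symm.trans (integral_utility_sub_index (hΦ j)))

end Market

namespace Market

variable {m : ℕ} {M : Market m} {Φ : SteadyState m} {j : Fin m}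

variable (M Φ) in
/-- The probability that no business is both a fit and has index above `y`, for a consumer with
value `v`. -/
noncomputable def noFitAbove (v y : ℝ) : ℝ :=
  ∏ k, (1 - M.fit k * (Φ.price k : Measure ℝ≥0).real
    {q | y < M.index q (beliefMean (Φ.beliefFit k)) (beliefMean (Φ.beliefQuality k)) v})

lemma measurable_index (π q v : ℝ) : Measurable fun p : ℝ≥0 => M.index p π q v := by
  unfold index; fun_prop

/-- The complement is an intersection of independent events over the businesses. -/
lemma real_pairLaw_exists (v y : ℝ) :
    (M.pairLaw Φ).real {q | ∃ k, (q.2 k).1 = true ∧ y < M.steadyIndex Φ q.1 v k}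
      = 1 - M.noFitAbove Φ v y := by
  have h := M.real_pairLaw_forall_not Φ (A := fun k => {q | y < M.index q
    (beliefMean (Φ.beliefFit k)) (beliefMean (Φ.beliefQuality k)) v})
    fun k => measurableSet_lt measurable_const (measurable_index _ _ _)
  rw [noFitAbove, ← h, ← probReal_compl_eq_one_sub]
  · congr 1
    ext q
    simp [steadyIndex, and_comm]
  · have : {q : (Fin m → ℝ≥0) × (Fin m → Bool × Bool) | ∀ i, ¬ (q.1 i ∈ {q | y < M.index q
        (beliefMean (Φ.beliefFit i)) (beliefMean (Φ.beliefQuality i)) v} ∧ (q.2 i).1 = true)}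
        = ⋂ i, ({q | y < M.steadyIndex Φ q.1 v i} ∩ {q | (q.2 i).1 = true})ᶜ := by
      ext q; simp [steadyIndex]
    rw [this]
    refine MeasurableSet.iInter fun i => MeasurableSet.compl (MeasurableSet.inter ?_ ?_)
    · exact measurableSet_lt measurable_const
        (measurable_steadyIndex (fun _ => by fun_prop) measurable_const i)
    · exact (by fun_prop : Measurable fun q : (Fin m → ℝ≥0) × (Fin m → Bool × Bool) => (q.2 i).1)
        (measurableSet_singleton true)

lemma sum_tieLaw : ∑ r, (M.tieLaw r).toReal = 1 := by
  have h := M.tieLaw.tsum_coe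
  rw [tsum_fintype] at h
  rw [← ENNReal.toReal_sum fun r _ => M.tieLaw.apply_ne_top r, h, ENNReal.toReal_one]

variable (M Φ) in
/-- The event that some business is a fit and has index above `y`. -/
def fitAbove (y : ℝ) : Set ((Fin m → ℝ≥0) × Consumer m) :=
  {z | ∃ k, z.2.fit k = true ∧ y < M.steadyIndex Φ z.1 z.2.value k}

lemma measurableSet_fitAbove (y : ℝ) : MeasurableSet (M.fitAbove Φ y) := by
  simp only [fitAbove, Set.ofPred_exists]
  refine MeasurableSet.iUnion fun k => MeasurableSet.inter ?_ ?_
  · exact Consumer.measurable_fit measurable_snd k (measurableSet_singleton true)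
  · exact measurableSet_lt measurable_const
      (measurable_steadyIndex (fun _ => by fun_prop) measurable_value k)

lemma integral_fitAbove {f : ℝ → ℝ} (hf : Measurable f) {C : ℝ}
    (hC : ∀ v ∈ Set.Icc 0 M.vmax, |f v| ≤ C) (y : ℝ) :
    ∫ z, (if z ∈ M.fitAbove Φ y then f z.2.value else 0) ∂M.steadyLaw Φ
      = ∫ v, f v * (1 - M.noFitAbove Φ v y) ∂(M.valueLaw : Measure ℝ) := by
  rw [integral_steadyLaw]
  · refine integral_congr_ae (ae_of_all _ fun v => ?_)
    have h : ∀ r : Equiv.Perm (Fin m), ∫ q : (Fin m → ℝ≥0) × (Fin m → Bool × Bool),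
        (if (q.1, v, r, q.2) ∈ M.fitAbove Φ y then f v else 0) ∂M.pairLaw Φ
        = f v * (1 - M.noFitAbove Φ v y) := by
      intro r
      have hs : MeasurableSet {q : (Fin m → ℝ≥0) × (Fin m → Bool × Bool) |
          (q.1, v, r, q.2) ∈ M.fitAbove Φ y} :=
        (measurableSet_fitAbove y).preimage (by fun_prop)
      rw [← real_pairLaw_exists, mul_comm]
      have := integral_indicator_const (μ := M.pairLaw Φ) (f v) hs
      rw [smul_eq_mul] at this
      exact this
    change ∑ r, _ * ∫ q : (Fin m → ℝ≥0) × (Fin m → Bool × Bool),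
        (if (q.1, v, r, q.2) ∈ M.fitAbove Φ y then f v else 0) ∂M.pairLaw Φ = _
    simp only [h]
    rw [← Finset.sum_mul, sum_tieLaw, one_mul]
  · refine Integrable.of_bound (Measurable.ite (measurableSet_fitAbove y)
      (hf.comp measurable_value) measurable_const).aestronglyMeasurable C ?_
    filter_upwards [ae_steadyLaw_value_mem M Φ] with z hz
    split_ifs
    · exact hC _ hz
    · simpa using (abs_nonneg _).trans (hC _ hz)

lemma real_fitAbove (y : ℝ) : (M.steadyLaw Φ).real (M.fitAbove Φ y)
      = ∫ v, (1 - M.noFitAbove Φ v y) ∂(M.valueLaw : Measure ℝ) := by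
  have h := integral_fitAbove (M := M) (Φ := Φ) (f := fun _ => 1) measurable_const (C := 1)
    (by simp) y
  simp only [one_mul] at h
  rw [← h, ← integral_indicator_one (measurableSet_fitAbove y)]
  rfl

/-- Layer-cake formula for the index of the transaction, whose tails are the events `fitAbove`. -/
lemma ofReal_consumerWelfare (hΦ : ∀ j, j ∈ M.steadyLearned Φ ∨ j ∈ M.steadyLost Φ) :
    ENNReal.ofReal (M.consumerWelfare Φ)
      = ∫⁻ y in Set.Ioi 0, M.steadyLaw Φ (M.fitAbove Φ y) := by
  have hnn : ∀ z : (Fin m → ℝ≥0) × Consumer m,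
      0 ≤ ∑ j, (if z.2.Transacts (M.steadyIndex Φ z.1 z.2.value) j then
        M.steadyIndex Φ z.1 z.2.value j else 0) := fun z =>
    Finset.sum_nonneg fun j _ => by split_ifs with h; exacts [h.1.1.le, le_rfl]
  have hint := integrable_finsetSum Finset.univ
    fun j _ => integrable_transacts_index (M := M) (Φ := Φ) (j := j)
  rw [consumerWelfare_eq hΦ, ofReal_integral_eq_lintegral_ofReal hint (ae_of_all _ hnn),
    lintegral_eq_lintegral_meas_lt _ (ae_of_all _ hnn) hint.aestronglyMeasurable.aemeasurable]
  refine setLIntegral_congr_fun measurableSet_Ioi fun y hy => ?_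
  change M.steadyLaw Φ {z | _} = _
  congr 1
  ext z
  exact Consumer.lt_sum_transacts_iff (le_of_lt hy)

lemma consumerWelfare_nonneg (hΦ : ∀ j, j ∈ M.steadyLearned Φ ∨ j ∈ M.steadyLost Φ) :
    0 ≤ M.consumerWelfare Φ := by
  rw [consumerWelfare_eq hΦ]
  exact integral_nonneg fun z => Finset.sum_nonneg fun j _ => by
    split_ifs with h; exacts [h.1.1.le, le_rfl]

lemma totalWelfare_nonneg (hΦ : ∀ j, j ∈ M.steadyLearned Φ ∨ j ∈ M.steadyLost Φ) :
    0 ≤ M.totalWelfare Φ := by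
  refine add_nonneg (consumerWelfare_nonneg hΦ) (Finset.sum_nonneg fun j _ =>
    integral_nonneg fun z => ?_)
  unfold Consumer.revenue
  change 0 ≤ ite _ _ _
  split_ifs
  exacts [NNReal.coe_nonneg _, le_rfl]

lemma totalWelfare_eq (hΦ : ∀ j, j ∈ M.steadyLearned Φ ∨ j ∈ M.steadyLost Φ) :
    M.totalWelfare Φ = ∫ z, ∑ j, (if z.2.Transacts (M.steadyIndex Φ z.1 z.2.value) j then
        M.steadyIndex Φ z.1 z.2.value j + z.1 j else 0) ∂M.steadyLaw Φ := by
  unfold totalWelfare Consumer.revenue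
  rw [consumerWelfare_eq hΦ, ← integral_finsetSum _ fun j _ => integrable_transacts_price,
    ← integral_add (integrable_finsetSum _ fun j _ => integrable_transacts_index)
    (integrable_finsetSum _ fun j _ => integrable_transacts_price)]
  refine integral_congr_ae (ae_of_all _ fun z => ?_)
  simp only [← Finset.sum_add_distrib]
  refine Finset.sum_congr rfl fun j _ => ?_
  split_ifs <;> simp

lemma consumerWelfare_eq_zero (hΦ : ∀ j, j ∈ M.steadyLost Φ) : M.consumerWelfare Φ = 0 := by
  rw [consumerWelfare_eq fun j => Or.inr (hΦ j)]
  refine integral_eq_zero_of_ae ?_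
  filter_upwards [ae_steadyLaw_value_mem M Φ] with z hz
  exact Finset.sum_eq_zero fun j _ => if_neg fun h =>
    h.1.1.not_ge (steadyIndex_nonpos_of_lost (hΦ j) hz _)

lemma totalWelfare_eq_zero (hΦ : ∀ j, j ∈ M.steadyLost Φ) : M.totalWelfare Φ = 0 := by
  rw [totalWelfare_eq fun j => Or.inr (hΦ j)]
  refine integral_eq_zero_of_ae ?_
  filter_upwards [ae_steadyLaw_value_mem M Φ] with z hz
  exact Finset.sum_eq_zero fun j _ => if_neg fun h =>
    h.1.1.not_ge (steadyIndex_nonpos_of_lost (hΦ j) hz _)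

variable (M Φ) in
/-- The businesses in `S` are learned and share type and price law with `j₀ ∈ S`, all others
are lost. -/
structure IsSymmetricState (S : Finset (Fin m)) (j₀ : Fin m) : Prop where
  mem : j₀ ∈ S
  learned : ∀ j ∈ S, j ∈ M.steadyLearned Φ
  fit_eq : ∀ j ∈ S, M.fit j = M.fit j₀
  quality_eq : ∀ j ∈ S, M.quality j = M.quality j₀
  price_eq : ∀ j ∈ S, Φ.price j = Φ.price j₀
  lost : ∀ j ∉ S, j ∈ M.steadyLost Φ

namespace IsSymmetricState

variable {S : Finset (Fin m)} {j₀ : Fin m} (h : M.IsSymmetricState Φ S j₀)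
include h

lemma learned_or_lost (j : Fin m) : j ∈ M.steadyLearned Φ ∨ j ∈ M.steadyLost Φ :=
  if hj : j ∈ S then Or.inl (h.learned j hj) else Or.inr (h.lost j hj)

lemma searchCost_eq (hj : j ∈ S) : M.searchCost j = M.searchCost j₀ := by
  rw [searchCost, h.fit_eq j hj, searchCost]

lemma index_eq (hj : j ∈ S) (q : ℝ≥0) (v : ℝ) :
    M.index q (beliefMean (Φ.beliefFit j)) (beliefMean (Φ.beliefQuality j)) v
      = v * M.quality j₀ - q - M.searchCost j₀ := by
  have := steadyIndex_eq_of_learned (h.learned j hj) (fun _ => q) v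
  rw [h.quality_eq j hj, h.searchCost_eq hj] at this
  exact this

/-- Learned businesses contribute equal factors, lost ones the factor `1`. -/
lemma noFitAbove_eq {v y : ℝ} (hv : v ∈ Set.Icc 0 M.vmax) (hy : 0 ≤ y) :
    M.noFitAbove Φ v y = (1 - M.fit j₀ * (Φ.price j₀ : Measure ℝ≥0).real
      {q | (q : ℝ) + M.searchCost j₀ < v * M.quality j₀ - y}) ^ S.card := by
  have h1 : ∀ k ∈ S, (1 - M.fit k * (Φ.price k : Measure ℝ≥0).real
      {q | y < M.index q (beliefMean (Φ.beliefFit k)) (beliefMean (Φ.beliefQuality k)) v})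
      = (1 - M.fit j₀ * (Φ.price j₀ : Measure ℝ≥0).real
      {q | (q : ℝ) + M.searchCost j₀ < v * M.quality j₀ - y}) := by
    intro k hk
    have hset : {q | y < M.index q (beliefMean (Φ.beliefFit k))
        (beliefMean (Φ.beliefQuality k)) v}
        = {q : ℝ≥0 | (q : ℝ) + M.searchCost j₀ < v * M.quality j₀ - y} := by
      ext q
      simp only [Set.mem_ofPred_eq]
      rw [h.index_eq hk]
      constructor <;> intro <;> linarith
    rw [hset, h.fit_eq k hk, h.price_eq k hk]
  rw [← Finset.prod_const, ← Finset.prod_congr rfl h1, noFitAbove]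
  refine (Finset.prod_subset (Finset.subset_univ S) fun k _ hk => ?_).symm
  have : {q | y < M.index q (beliefMean (Φ.beliefFit k)) (beliefMean (Φ.beliefQuality k)) v}
      = ∅ := by
    ext q
    simp only [Set.mem_ofPred_eq, Set.mem_empty_iff_false, iff_false, not_lt]
    exact (steadyIndex_nonpos_of_lost (h.lost k hk) hv fun _ => q).trans hy
  rw [this]; simp

/-- Price is a transfer: index plus price is `v Q - κ` at every learned business, so only the
probability of a transaction matters. -/
lemma totalWelfare_eq : M.totalWelfare Φ = ∫ v, (v * M.quality j₀ - M.searchCost j₀) *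
    (1 - M.noFitAbove Φ v 0) ∂(M.valueLaw : Measure ℝ) := by
  rw [Market.totalWelfare_eq h.learned_or_lost, ← integral_fitAbove (by fun_prop)
    (C := M.vmax + M.searchCost j₀)]
  · refine integral_congr_ae ?_
    filter_upwards [ae_steadyLaw_value_mem M Φ] with z hz
    refine Eq.trans ?_ ((Consumer.sum_transacts_const (a := z.2)
      (x := M.steadyIndex Φ z.1 z.2.value) (z.2.value * M.quality j₀ - M.searchCost j₀)).trans
      (if_congr Iff.rfl rfl rfl))
    refine Finset.sum_congr rfl fun j _ => ?_
    split_ifs with hT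
    · have hj : j ∈ S := by
        by_contra hj
        exact hT.1.1.not_ge (steadyIndex_nonpos_of_lost (h.lost j hj) hz _)
      have := h.index_eq hj (z.1 j) z.2.value
      rw [steadyIndex, this]; ring
    · rfl
  · intro v hv
    have := (M.quality j₀).2
    have h0 := searchCost_nonneg (M := M) (j := j₀)
    rw [abs_le]
    constructor <;> nlinarith [hv.1, hv.2, this.1, this.2]

end IsSymmetricState

end Market

/-! ### Welfare comparison at given learned sets -/

namespace Market

variable {m : ℕ} {M : Market m} {Φ Φ' : SteadyState m} {S S' : Finset (Fin m)} {j₀ : Fin m}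

lemma noFitAbove_factor_mem (k : Fin m) (A : Set ℝ≥0) :
    1 - (M.fit k : ℝ) * (Φ.price k : Measure ℝ≥0).real A ∈ Set.Icc (0 : ℝ) 1 := by
  have h1 := M.fit_pos' k
  have h2 := M.fit_lt_one' k
  have h3 : (Φ.price k : Measure ℝ≥0).real A ≤ 1 := measureReal_le_one
  have h4 : 0 ≤ (Φ.price k : Measure ℝ≥0).real A := measureReal_nonneg
  constructor <;> nlinarith

lemma noFitAbove_nonneg (v y : ℝ) : 0 ≤ M.noFitAbove Φ v y :=
  Finset.prod_nonneg fun _ _ => (noFitAbove_factor_mem _ _).1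

lemma noFitAbove_le_one (v y : ℝ) : M.noFitAbove Φ v y ≤ 1 :=
  Finset.prod_le_one (fun _ _ => (noFitAbove_factor_mem _ _).1)
    fun _ _ => (noFitAbove_factor_mem _ _).2

lemma measurable_noFitAbove (y : ℝ) : Measurable fun v => M.noFitAbove Φ v y := by
  unfold noFitAbove
  refine Finset.measurable_prod _ fun k _ => Measurable.const_sub (Measurable.const_mul ?_ _) _
  have hs : MeasurableSet {q : ℝ × ℝ≥0 | y < M.index q.2 (beliefMean (Φ.beliefFit k))
      (beliefMean (Φ.beliefQuality k)) q.1} := by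
    refine measurableSet_lt measurable_const ?_
    unfold index; fun_prop
  exact (measurable_measure_prodMk_left (ν := (Φ.price k : Measure ℝ≥0)) hs).ennreal_toReal

lemma integrable_one_sub_noFitAbove (y : ℝ) :
    Integrable (fun v => 1 - M.noFitAbove Φ v y) (M.valueLaw : Measure ℝ) :=
  Integrable.of_bound ((measurable_noFitAbove y).const_sub 1).aestronglyMeasurable 1
    (ae_of_all _ fun v => by
      rw [Real.norm_eq_abs, abs_le]
      constructor <;> linarith [noFitAbove_nonneg (M := M) (Φ := Φ) v y,
        noFitAbove_le_one (M := M) (Φ := Φ) v y])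

lemma integrable_surplus (y : ℝ) :
    Integrable (fun v => (v * M.quality j₀ - M.searchCost j₀) * (1 - M.noFitAbove Φ v y))
      (M.valueLaw : Measure ℝ) := by
  refine (integrable_one_sub_noFitAbove y).bdd_mul (c := M.vmax + M.searchCost j₀)
    (by fun_prop) ?_
  filter_upwards [M.value_mem] with v hv
  have := (M.quality j₀).2
  have h0 := searchCost_nonneg (M := M) (j := j₀)
  rw [Real.norm_eq_abs, abs_le]
  constructor <;> nlinarith [hv.1, hv.2, this.1, this.2]

lemma searchCost_withCost_lt {c' : ℝ≥0} (hc : c' < M.cost) :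
    (M.withCost c').searchCost j₀ < M.searchCost j₀ :=
  div_lt_div_of_pos_right (NNReal.coe_lt_coe.2 hc) (M.fit_pos' j₀)

/-- Both welfares are monotone in the probabilities of a fit with index above `y`, which are ordered
by the pricing comparison at the threshold `t = v Q - y`. -/
theorem welfare_le_of_isOptimalPricing {c' : ℝ≥0} (hc : c' < M.cost) (hS : S ⊆ S')
    (h : M.IsSymmetricState Φ S j₀) (h' : (M.withCost c').IsSymmetricState Φ' S' j₀)
    (hopt : IsOptimalPricing (M.demand j₀) (M.searchCost j₀) (M.fit j₀) S.card (Φ.price j₀))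
    (hopt' : IsOptimalPricing (M.demand j₀) ((M.withCost c').searchCost j₀) (M.fit j₀) S'.card
      (Φ'.price j₀))
    (hpos : ∃ p, 0 < priceRevenue (M.demand j₀) (M.searchCost j₀) p) :
    M.consumerWelfare Φ ≤ (M.withCost c').consumerWelfare Φ' ∧
      M.totalWelfare Φ ≤ (M.withCost c').totalWelfare Φ' := by
  have hκ := searchCost_withCost_lt (j₀ := j₀) hc
  have key : ∀ v ∈ Set.Icc 0 M.vmax, ∀ y, 0 ≤ y →
      (M.withCost c').noFitAbove Φ' v y ≤ M.noFitAbove Φ v y := by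
    intro v hv y hy
    rw [h.noFitAbove_eq hv hy, h'.noFitAbove_eq hv hy]
    exact hopt.pow_le_pow_lt hκ (M.fit_pos' _) (M.fit_lt_one' _)
      (Finset.card_pos.2 ⟨j₀, h.mem⟩) (Finset.card_le_card hS) hopt' hpos _
  constructor
  · rw [← ENNReal.ofReal_le_ofReal_iff (consumerWelfare_nonneg h'.learned_or_lost),
      ofReal_consumerWelfare h.learned_or_lost, ofReal_consumerWelfare h'.learned_or_lost]
    refine setLIntegral_mono' measurableSet_Ioi fun y hy => ?_
    rw [← ENNReal.toReal_le_toReal (measure_ne_top _ _) (measure_ne_top _ _)]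
    change (M.steadyLaw Φ).real _ ≤ ((M.withCost c').steadyLaw Φ').real _
    rw [real_fitAbove, real_fitAbove]
    refine integral_mono_ae (integrable_one_sub_noFitAbove y)
      (integrable_one_sub_noFitAbove (M := M.withCost c') y) ?_
    filter_upwards [M.value_mem] with v hv
    linarith [key v hv y (le_of_lt hy)]
  · rw [h.totalWelfare_eq, h'.totalWelfare_eq]
    refine integral_mono_ae (integrable_surplus 0) (integrable_surplus (M := M.withCost c') 0) ?_
    filter_upwards [M.value_mem] with v hv
    change (v * (M.quality j₀ : ℝ) - _) * _ ≤ (v * (M.quality j₀ : ℝ) - _) * _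
    have h1 := noFitAbove_le_one (M := M) (Φ := Φ) v 0
    have h2 := noFitAbove_le_one (M := M.withCost c') (Φ := Φ') v 0
    -- The integrand is a product, monotone only while the surplus is nonnegative. Where the surplus
    -- is negative, no price gives a positive index and the trade probability is `0`.
    by_cases hw : 0 ≤ v * (M.quality j₀ : ℝ) - M.searchCost j₀
    · have h3 := key v hv 0 le_rfl
      exact mul_le_mul (by linarith) (by linarith) (by linarith) (by linarith)
    · have h3 : M.noFitAbove Φ v 0 = 1 := by
        rw [h.noFitAbove_eq hv le_rfl]
        have : {q : ℝ≥0 | (q : ℝ) + M.searchCost j₀ < v * M.quality j₀ - 0} = ∅ := by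
          ext q
          simp only [Set.mem_ofPred_eq, Set.mem_empty_iff_false, iff_false, not_lt]
          linarith [q.coe_nonneg]
        rw [this]; simp
      rw [h3, sub_self, mul_zero]
      by_cases hw' : 0 ≤ v * (M.quality j₀ : ℝ) - (M.withCost c').searchCost j₀
      · exact mul_nonneg hw' (by linarith)
      · have h4 : (M.withCost c').noFitAbove Φ' v 0 = 1 := by
          rw [h'.noFitAbove_eq hv le_rfl]
          have : {q : ℝ≥0 | (q : ℝ) + (M.withCost c').searchCost j₀
              < v * (M.withCost c').quality j₀ - 0} = ∅ := by
            ext q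
            simp only [Set.mem_ofPred_eq, Set.mem_empty_iff_false, iff_false, not_lt]
            change v * (M.quality j₀ : ℝ) - 0 ≤ _
            linarith [q.coe_nonneg]
          rw [this]; simp
        rw [h4, sub_self, mul_zero]

end Market

/-! ### Expected revenue against rivals -/

namespace Market

variable {m : ℕ} {M : Market m} {Φ : SteadyState m} {S : Finset (Fin m)} {j j₀ : Fin m}

lemma measurable_update_price (j : Fin m) (p : ℝ≥0) (i : Fin m) :
    Measurable fun z : (Fin m → ℝ≥0) × Consumer m => Function.update z.1 j p i := by
  by_cases hi : i = j
  · subst hi; simp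
  · simp only [Function.update_of_ne hi]; fun_prop

lemma measurableSet_inspects_update (j : Fin m) (p : ℝ≥0) : MeasurableSet
    {z : (Fin m → ℝ≥0) × Consumer m |
      z.2.Inspects (M.steadyIndex Φ (Function.update z.1 j p) z.2.value) j} :=
  Consumer.measurableSet_inspects measurable_snd
    (measurable_steadyIndex (measurable_update_price j p) measurable_value) j

lemma integrable_ite_inspects_update (p : ℝ≥0) (c : ℝ) :
    Integrable (fun z : (Fin m → ℝ≥0) × Consumer m =>
      if z.2.Inspects (M.steadyIndex Φ (Function.update z.1 j p) z.2.value) j then c else 0)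
      (M.steadyLaw Φ) := by
  refine Integrable.of_bound (Measurable.ite (measurableSet_inspects_update j p) measurable_const
    measurable_const).aestronglyMeasurable |c| (ae_of_all _ fun z => ?_)
  split_ifs <;> simp

/-- The inspection of `j` is independent of the fit of `j`, so a sale has probability `π` times that
of an inspection. -/
lemma expectedRevenue_eq_integral_inspects (p : ℝ≥0) : M.expectedRevenue Φ j p =
    M.fit j * p * ∫ z, (if z.2.Inspects (M.steadyIndex Φ (Function.update z.1 j p) z.2.value) j
      then (1 : ℝ) else 0) ∂M.steadyLaw Φ := by
  have hrev : Integrable (fun z : (Fin m → ℝ≥0) × Consumer m =>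
      z.2.revenue (M.steadyIndex Φ (Function.update z.1 j p) z.2.value)
      (Function.update z.1 j p) j) (M.steadyLaw Φ) := by
    refine Integrable.of_bound (Measurable.ite (Consumer.measurableSet_transacts measurable_snd
      (measurable_steadyIndex (measurable_update_price j p) measurable_value) j)
      (measurable_update_price j p j).coe_nnreal_real
      measurable_const).aestronglyMeasurable p (ae_of_all _ fun z => ?_)
    unfold Consumer.revenue
    split_ifs <;> simp
  unfold expectedRevenue
  rw [← integral_const_mul, ← sub_eq_zero, ← integral_sub hrev
    ((integrable_ite_inspects_update p 1).const_mul _)]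
  refine M.integral_eq_zero_of_fitLaw Φ (hrev.sub
    ((integrable_ite_inspects_update p 1).const_mul _)) fun z r => ae_of_all _ fun v => ?_
  set x := M.steadyIndex Φ (Function.update z j p) v with hx
  refine Eq.trans ?_ (integral_mul_eval_eq_zero
    (μ := fun j => (bernoulliMeasure true false (M.fit j)).prod
      (bernoulliMeasure true false (M.quality j))) j
    (f := fun b => if Consumer.Inspects (v, r, b) x j then (1 : ℝ) else 0)
    (g := fun y => (if y.1 then (p : ℝ) else 0) - M.fit j * p)
    (fun b y => if_congr Consumer.inspects_update rfl rfl) (by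
      rw [integral_bernoulli_prod]; simp; ring))
  refine integral_congr_ae (ae_of_all _ fun b => ?_)
  have hT : Consumer.Transacts (v, r, b) x j ↔
    Consumer.Inspects (v, r, b) x j ∧ (b j).1 = true := Iff.rfl
  change (if Consumer.Transacts (v, r, b) x j then (Function.update z j p j : ℝ) else 0) -
    M.fit j * p * (if Consumer.Inspects (v, r, b) x j then (1 : ℝ) else 0) = _
  by_cases hI : Consumer.Inspects (v, r, b) x j <;> by_cases hf : (b j).1 = true <;>
    simp [hT, hI, hf]

lemma expectedRevenue_eq_zero_of_lost (hj : j ∈ M.steadyLost Φ) (p : ℝ≥0) :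
    M.expectedRevenue Φ j p = 0 := by
  rw [expectedRevenue_eq_integral_inspects, integral_eq_zero_of_ae, mul_zero]
  filter_upwards [ae_steadyLaw_value_mem M Φ] with z hz
  exact if_neg fun h => h.1.not_ge (steadyIndex_nonpos_of_lost hj hz _)

variable (M) in
/-- The probability that no competitor with a better rank (that is, with a smaller price or, at
ties, a better priority) is a fit, when the `S` competitors draw prices from `G`. -/
noncomputable def rankFactor (S : Finset (Fin m)) (π : ℝ) (G : Measure ℝ≥0) (j : Fin m)
    (p : ℝ≥0) : ℝ :=
  ∑ r : Equiv.Perm (Fin m), (M.tieLaw r).toReal *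
    ∏ i ∈ S.erase j, (1 - π * G.real (if r i < r j then Set.Iic p else Set.Iio p))

/-- Learned businesses differ only in price, so a rival comes before `j` iff it is cheaper, or
equally cheap with better priority, whatever the value `v`. Hence the probability of inspection
factors into demand and `rankFactor`. -/
lemma IsSymmetricState.expectedRevenue_eq (h : M.IsSymmetricState Φ S j₀) (hj : j ∈ S)
    (p : ℝ≥0) : M.expectedRevenue Φ j p = M.fit j₀ *
      priceRevenue (M.demand j₀) (M.searchCost j₀) p *
        M.rankFactor S (M.fit j₀) (Φ.price j₀) j p := by
  rw [expectedRevenue_eq_integral_inspects, integral_steadyLaw M Φ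
    (integrable_ite_inspects_update p 1), h.fit_eq j hj, priceRevenue]
  have hmain : ∀ v ∈ Set.Icc 0 M.vmax, (∑ r, (M.tieLaw r).toReal *
      ∫ q : (Fin m → ℝ≥0) × (Fin m → Bool × Bool), (if Consumer.Inspects (v, r, q.2)
        (M.steadyIndex Φ (Function.update q.1 j p) v) j then (1 : ℝ) else 0) ∂M.pairLaw Φ)
      = {v | (p : ℝ) + M.searchCost j₀ < v * M.quality j₀}.indicator
        (fun _ => M.rankFactor S (M.fit j₀) (Φ.price j₀) j p) v := by
    intro v hv
    have hxj : ∀ z : Fin m → ℝ≥0, M.steadyIndex Φ (Function.update z j p) v j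
        = v * M.quality j₀ - p - M.searchCost j₀ := by
      intro z
      have := h.index_eq hj p v
      rwa [steadyIndex, Function.update_self]
    by_cases hpos : (p : ℝ) + M.searchCost j₀ < v * M.quality j₀
    · rw [Set.indicator_of_mem (by exact hpos), rankFactor]
      refine Finset.sum_congr rfl fun r _ => ?_
      congr 1
      -- `A i` collects the prices at which `i` is searched before `j`; it is empty for lost
      -- businesses, whose index is not positive.
      set A : Fin m → Set ℝ≥0 := fun i => if i ∈ S.erase j then
        (if r i < r j then Set.Iic p else Set.Iio p) else ∅ with hA
      have hAm : ∀ i, MeasurableSet (A i) := by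
        intro i
        simp only [hA]
        split_ifs
        exacts [measurableSet_Iic, measurableSet_Iio, MeasurableSet.empty]
      have hset : ∀ q : (Fin m → ℝ≥0) × (Fin m → Bool × Bool), Consumer.Inspects (v, r, q.2)
          (M.steadyIndex Φ (Function.update q.1 j p) v) j ↔
          ∀ i, ¬ (q.1 i ∈ A i ∧ (q.2 i).1 = true) := by
        intro q
        have hx0 : 0 < M.steadyIndex Φ (Function.update q.1 j p) v j := by
          rw [hxj]; linarith
        have hB : ∀ i, Consumer.Before (v, r, q.2) (M.steadyIndex Φ (Function.update q.1 j p) v) i j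
            ↔ q.1 i ∈ A i := by
          intro i
          by_cases hij : i = j
          · subst hij
            simp [hA, Consumer.not_before_self]
          by_cases hiS : i ∈ S
          · have hxi : M.steadyIndex Φ (Function.update q.1 j p) v i
                = v * M.quality j₀ - q.1 i - M.searchCost j₀ := by
              rw [steadyIndex, Function.update_of_ne hij, h.index_eq hiS]
            simp only [Consumer.Before, hxj, hxi, hA, Finset.mem_erase, hij, hiS, ne_eq,
              not_false_eq_true, and_self, if_true]
            change _ ∨ (_ ∧ r i < r j) ↔ _
            by_cases hr : r i < r j
            · simp only [hr, and_true, if_true, Set.mem_Iic]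
              rw [← NNReal.coe_le_coe, le_iff_lt_or_eq]
              refine or_congr ?_ ?_ <;> constructor <;> intro <;> linarith
            · simp only [hr, and_false, or_false, if_false, Set.mem_Iio]
              rw [← NNReal.coe_lt_coe]
              constructor <;> intro <;> linarith
          · have hle := steadyIndex_nonpos_of_lost (h.lost i hiS) hv (Function.update q.1 j p)
            simp only [hA, Finset.mem_erase, hiS, and_false, if_false, Set.mem_empty_iff_false,
              iff_false]
            exact fun hb => (hx0.trans_le hb.le).not_ge hle
        simp only [Consumer.Inspects, hx0, true_and, hB, not_and]
        refine forall_congr' fun i => imp_congr_right fun _ => ?_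
        simp [Consumer.fit]
      have hmeas : MeasurableSet {q : (Fin m → ℝ≥0) × (Fin m → Bool × Bool) |
          ∀ i, ¬ (q.1 i ∈ A i ∧ (q.2 i).1 = true)} := by
        simp only [Set.ofPred_forall]
        refine MeasurableSet.iInter fun i => MeasurableSet.compl (MeasurableSet.inter ?_ ?_)
        · exact (by fun_prop :
            Measurable fun q : (Fin m → ℝ≥0) × (Fin m → Bool × Bool) => q.1 i) (hAm i)
        · exact (by fun_prop : Measurable fun q : (Fin m → ℝ≥0) × (Fin m → Bool × Bool) =>
            (q.2 i).1) (measurableSet_singleton true)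
      have hreal := M.real_pairLaw_forall_not Φ hAm
      rw [← integral_indicator_one hmeas] at hreal
      simp only [hset]
      refine (Eq.trans ?_ hreal).trans ?_
      · refine integral_congr_ae (ae_of_all _ fun q => ?_)
        simp only [Set.indicator_apply, Pi.one_apply]
        exact if_congr Iff.rfl rfl rfl
      · rw [← Finset.prod_subset (Finset.subset_univ (S.erase j))]
        · refine Finset.prod_congr rfl fun i hi => ?_
          have hiS := Finset.mem_of_mem_erase hi
          simp only [hA, hi, if_true, h.fit_eq i hiS, h.price_eq i hiS]
        · intro i _ hi
          have : A i = ∅ := if_neg hi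
          rw [this]; simp
    · rw [Set.indicator_of_notMem (by exact hpos)]
      refine Finset.sum_eq_zero fun r _ => ?_
      rw [integral_eq_zero_of_ae, mul_zero]
      refine ae_of_all _ fun q => if_neg fun hI => ?_
      have := hI.1
      rw [hxj] at this
      exact hpos (by linarith)
  have hD : MeasurableSet {v : ℝ | (p : ℝ) + M.searchCost j₀ < v * M.quality j₀} :=
    measurableSet_lt measurable_const (by fun_prop)
  have hae : (fun v => ∑ r, (M.tieLaw r).toReal *
      ∫ q : (Fin m → ℝ≥0) × (Fin m → Bool × Bool), (if Consumer.Inspects (v, r, q.2)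
        (M.steadyIndex Φ (Function.update q.1 j p) v) j then (1 : ℝ) else 0) ∂M.pairLaw Φ)
      =ᵐ[(M.valueLaw : Measure ℝ)] {v | (p : ℝ) + M.searchCost j₀ < v * M.quality j₀}.indicator
        (fun _ => M.rankFactor S (M.fit j₀) (Φ.price j₀) j p) := by
    filter_upwards [M.value_mem] with v hv using hmain v hv
  refine (congrArg _ ((integral_congr_ae hae).trans (integral_indicator_const _ hD))).trans ?_
  rw [smul_eq_mul, demand]
  ring

end Market

/-! ### Demand and the optimality conditions of equilibrium prices -/

namespace Market

variable {m : ℕ} {M : Market m} {Φ : SteadyState m} {S : Finset (Fin m)} {j j₀ : Fin m}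

variable (M) in
lemma sum_tieLaw_mul (x : ℝ) : ∑ r, (M.tieLaw r).toReal * x = x := by
  rw [← Finset.sum_mul, sum_tieLaw, one_mul]

lemma demand_nonneg (t : ℝ) : 0 ≤ M.demand j t := measureReal_nonneg

lemma priceRevenue_nonneg (κ : ℝ) (p : ℝ≥0) : 0 ≤ priceRevenue (M.demand j) κ p :=
  mul_nonneg p.coe_nonneg (demand_nonneg _)

lemma demand_eq_zero {t : ℝ} (ht : M.vmax * M.quality j ≤ t) : M.demand j t = 0 := by
  rw [demand, measureReal_eq_zero_iff]
  refine measure_mono_null (fun v hv => ?_) M.value_mem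
  intro hv'
  have := mul_le_mul_of_nonneg_right hv'.2 (M.quality j).2.1
  exact absurd hv (not_lt.2 (this.trans ht))

lemma demand_pos (hQ : 0 < (M.quality j : ℝ)) {t : ℝ} (ht : t < M.vmax * M.quality j) :
    0 < M.demand j t := by
  have h := M.value_near_vmax (t / M.quality j) ((div_lt_iff₀ hQ).2 ht)
  refine ENNReal.toReal_pos (h.trans_le (measure_mono fun v hv => ?_)).ne' (measure_ne_top _ _)
  exact (div_lt_iff₀ hQ).1 hv

/-- Values have a density, so their distribution has no atoms. -/
lemma continuous_demand (hQ : 0 < (M.quality j : ℝ)) : Continuous (M.demand j) := by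
  have hat : ∀ x, (M.valueLaw : Measure ℝ) {x} = 0 := by
    intro x
    rw [M.valueLaw_eq]
    exact withDensity_absolutelyContinuous _ _ (by simp)
  have : M.demand j = fun t => 1 - (M.valueLaw : Measure ℝ).real (Set.Iic (t / M.quality j)) := by
    ext t
    rw [← probReal_compl_eq_one_sub measurableSet_Iic, demand]
    congr 1
    ext v
    simp [div_lt_iff₀ hQ]
  rw [this]
  exact continuous_const.sub ((continuous_measureReal_Iic hat).comp (continuous_id.div_const _))

lemma continuous_priceRevenue (hQ : 0 < (M.quality j : ℝ)) (κ : ℝ) :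
    Continuous (priceRevenue (M.demand j) κ) := by
  have := continuous_demand hQ
  unfold priceRevenue
  fun_prop

lemma le_vmax_of_priceRevenue_pos {κ : ℝ} (hκ : 0 ≤ κ) {p : ℝ≥0}
    (h : 0 < priceRevenue (M.demand j) κ p) : (p : ℝ) ≤ M.vmax := by
  by_contra hp
  have hv := M.vmax_nonneg
  have hq := (M.quality j).2
  rw [priceRevenue, demand_eq_zero, mul_zero] at h
  · exact lt_irrefl _ h
  · nlinarith [hq.1, hq.2]

lemma exists_priceRevenue_pos (hQ : 0 < (M.quality j : ℝ)) {κ : ℝ}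
    (h : κ < M.vmax * M.quality j) : ∃ p, 0 < priceRevenue (M.demand j) κ p := by
  refine ⟨((M.vmax * M.quality j - κ) / 2).toNNReal, ?_⟩
  have h1 : 0 < (M.vmax * M.quality j - κ) / 2 := by linarith
  rw [priceRevenue, Real.coe_toNNReal _ h1.le]
  exact mul_pos h1 (demand_pos hQ (by linarith))

lemma quality_pos_of_priceRevenue_pos
    (hpos : ∃ p, 0 < priceRevenue (M.demand j₀) (M.searchCost j₀) p) : 0 < (M.quality j₀ : ℝ) := by
  obtain ⟨p, hp⟩ := hpos
  refine lt_of_le_of_ne (M.quality j₀).2.1 fun hQ => ?_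
  rw [priceRevenue, demand_eq_zero, mul_zero] at hp
  · exact lt_irrefl _ hp
  · rw [← hQ, mul_zero]
    exact add_nonneg p.coe_nonneg searchCost_nonneg

/-- Prices above `vmax` earn nothing, so the maximum over a compact interval is global. -/
lemma exists_max_priceRevenue (hQ : 0 < (M.quality j : ℝ)) {κ : ℝ} (hκ : 0 ≤ κ) :
    ∃ u, ∀ p, priceRevenue (M.demand j) κ p ≤ priceRevenue (M.demand j) κ u := by
  obtain ⟨u, -, hu⟩ := (isCompact_Icc (a := (0 : ℝ≥0)) (b := M.vmax.toNNReal)).exists_isMaxOn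
    ⟨0, Set.left_mem_Icc.2 zero_le⟩ (continuous_priceRevenue hQ κ).continuousOn
  refine ⟨u, fun p => ?_⟩
  rcases (priceRevenue_nonneg (M := M) (j := j) κ p).eq_or_lt with h | h
  · rw [← h]; exact priceRevenue_nonneg _ _
  · refine hu ⟨zero_le, ?_⟩
    rw [← NNReal.coe_le_coe, Real.coe_toNNReal _ M.vmax_nonneg]
    exact le_vmax_of_priceRevenue_pos hκ h

lemma rankFactor_eq_of_atomless {π : ℝ} {G : Measure ℝ≥0} (hj : j ∈ S) {p : ℝ≥0} (hp : 2 ≤ S.card → G {p} = 0) :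
    M.rankFactor S π G j p = (1 - π * G.real (Set.Iic p)) ^ (S.card - 1) := by
  rw [← M.sum_tieLaw_mul ((1 - π * G.real (Set.Iic p)) ^ (S.card - 1)),
    ← Finset.card_erase_of_mem hj, ← Finset.prod_const]
  refine Finset.sum_congr rfl fun r _ => ?_
  congr 1
  refine Finset.prod_congr rfl fun i hi => ?_
  have hcard : 2 ≤ S.card := Finset.one_lt_card.2
    ⟨i, Finset.mem_of_mem_erase hi, j, hj, Finset.ne_of_mem_erase hi⟩
  have : G.real (Set.Iio p) = G.real (Set.Iic p) := by
    rw [← Set.Iic_sdiff_right, measureReal_def, measure_sdiff_null (hp hcard), measureReal_def]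
  split_ifs
  · rfl
  · rw [this]

section rankFactor

variable {π : ℝ} (hπ0 : 0 < π) (hπ1 : π < 1) {G : Measure ℝ≥0} [IsProbabilityMeasure G]
include hπ0 hπ1

lemma one_sub_mul_real_pos (A : Set ℝ≥0) : 0 < 1 - π * G.real A := by
  have : G.real A ≤ 1 := measureReal_le_one
  have : 0 ≤ G.real A := measureReal_nonneg
  nlinarith

lemma pow_le_rankFactor (hj : j ∈ S) (p : ℝ≥0) :
    (1 - π * G.real (Set.Iic p)) ^ (S.card - 1) ≤ M.rankFactor S π G j p := by
  rw [← M.sum_tieLaw_mul ((1 - π * G.real (Set.Iic p)) ^ (S.card - 1)),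
    ← Finset.card_erase_of_mem hj, ← Finset.prod_const]
  refine Finset.sum_le_sum fun r _ => mul_le_mul_of_nonneg_left ?_ ENNReal.toReal_nonneg
  refine Finset.prod_le_prod (fun _ _ => (one_sub_mul_real_pos hπ0 hπ1 _).le) fun i _ => ?_
  split_ifs
  · exact le_rfl
  · have : G.real (Set.Iio p) ≤ G.real (Set.Iic p) := measureReal_mono Set.Iio_subset_Iic_self
    gcongr

lemma rankFactor_nonneg (p : ℝ≥0) : 0 ≤ M.rankFactor S π G j p :=
  Finset.sum_nonneg fun _ _ => mul_nonneg ENNReal.toReal_nonneg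
    (Finset.prod_nonneg fun _ _ => (one_sub_mul_real_pos hπ0 hπ1 _).le)

/-- At an atom, `j` loses the tie against `k` with positive probability, whereas the right side
treats all ties as won. -/
lemma rankFactor_lt_of_atom {k : Fin m} (hj : j ∈ S) (hk : k ∈ S) {r : Equiv.Perm (Fin m)}
    (hr : M.tieLaw r ≠ 0) (hkj : r k < r j) {p : ℝ≥0} (hp : G {p} ≠ 0) :
    M.rankFactor S π G j p < (1 - π * G.real (Set.Iio p)) ^ (S.card - 1) := by
  rw [← M.sum_tieLaw_mul ((1 - π * G.real (Set.Iio p)) ^ (S.card - 1)),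
    ← Finset.card_erase_of_mem hj, ← Finset.prod_const]
  have hle : G.real (Set.Iio p) ≤ G.real (Set.Iic p) := measureReal_mono Set.Iio_subset_Iic_self
  have hfac : ∀ (r : Equiv.Perm (Fin m)) (i : Fin m),
      1 - π * G.real (if r i < r j then Set.Iic p else Set.Iio p)
        ≤ 1 - π * G.real (Set.Iio p) := by
    intro r i
    split_ifs
    · gcongr
    · exact le_rfl
  refine Finset.sum_lt_sum (fun r _ => mul_le_mul_of_nonneg_left (Finset.prod_le_prod
    (fun _ _ => (one_sub_mul_real_pos hπ0 hπ1 _).le) fun i _ => hfac r i) ENNReal.toReal_nonneg)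
    ⟨r, Finset.mem_univ r, mul_lt_mul_of_pos_left ?_
      (ENNReal.toReal_pos hr (M.tieLaw.apply_ne_top r))⟩
  refine Finset.prod_lt_prod (fun _ _ => one_sub_mul_real_pos hπ0 hπ1 _) (fun i _ => hfac r i)
    ⟨k, Finset.mem_erase.2 ⟨fun h => (h ▸ hkj).ne rfl, hk⟩, ?_⟩
  rw [if_pos hkj]
  have hlt : G.real (Set.Iio p) < G.real (Set.Iic p) := by
    have h1 : G.real (Set.Iic p) = G.real (Set.Iio p) + G.real {p} := by
      rw [← measureReal_union (by simp) (measurableSet_singleton p), Set.Iio_union_right]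
    have h2 : 0 < G.real {p} := ENNReal.toReal_pos hp (measure_ne_top _ _)
    linarith
  gcongr

end rankFactor

namespace IsSymmetricState

variable (h : M.IsSymmetricState Φ S j₀) (heq : M.IsEquilibrium Φ)
  (hpos : ∃ p, 0 < priceRevenue (M.demand j₀) (M.searchCost j₀) p)
include h heq hpos

/-- All rivals misfit with positive probability, so a price with positive `priceRevenue` has
positive expected revenue, and an optimal price cannot earn zero. -/
lemma priceRevenue_pos_of_mem_support {s : ℝ≥0} (hs : s ∈ (Φ.price j₀ : Measure ℝ≥0).support) :
    0 < priceRevenue (M.demand j₀) (M.searchCost j₀) s := by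
  obtain ⟨p, hp⟩ := hpos
  have h1 := heq.2 j₀ s hs p
  rw [h.expectedRevenue_eq h.mem, h.expectedRevenue_eq h.mem] at h1
  have h2 : 0 < M.rankFactor S (M.fit j₀) (Φ.price j₀) j₀ p :=
    (pow_pos (one_sub_mul_real_pos (M.fit_pos' _) (M.fit_lt_one' _) _) _).trans_le
      (pow_le_rankFactor (M.fit_pos' _) (M.fit_lt_one' _) h.mem p)
  have h3 := rankFactor_nonneg (M := M) (S := S) (j := j₀) (M.fit_pos' j₀) (M.fit_lt_one' j₀)
    (G := (Φ.price j₀ : Measure ℝ≥0)) s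
  have h4 := M.fit_pos' j₀
  have h5 := (mul_pos (mul_pos h4 hp) h2).trans_le h1
  exact pos_of_mul_pos_right (pos_of_mul_pos_left h5 h3) h4.le

/-- In a symmetric equilibrium between at least two businesses no price is an atom: undercutting
would be profitable. -/
lemma atomless (hcard : 2 ≤ S.card) (s : ℝ≥0) : (Φ.price j₀ : Measure ℝ≥0) {s} = 0 := by
  by_contra hs
  set G := (Φ.price j₀ : Measure ℝ≥0) with hG
  have hsupp : s ∈ G.support := by
    obtain ⟨t, ht, ht'⟩ := Measure.nonempty_inter_support_of_pos (pos_iff_ne_zero.2 hs)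
    rwa [← Set.mem_singleton_iff.1 ht]
  have hRs := h.priceRevenue_pos_of_mem_support heq hpos hsupp
  have hQ := quality_pos_of_priceRevenue_pos hpos
  have hs0 : 0 < s := by
    rcases eq_zero_or_pos s with h0 | h0
    · simp [priceRevenue, h0] at hRs
    · exact h0
  obtain ⟨r, hr⟩ := M.tieLaw.support_nonempty
  rw [PMF.mem_support_iff] at hr
  -- Some priority order has positive probability; the argument is made for a business `j` that it
  -- ranks behind another one. This need not be `j₀`.
  obtain ⟨j, hj, k, hk, hkj⟩ : ∃ j ∈ S, ∃ k ∈ S, r k < r j := by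
    obtain ⟨j, hj, k, hk, hne⟩ := Finset.one_lt_card.1 hcard
    rcases lt_or_gt_of_ne (r.injective.ne hne) with h1 | h1
    · exact ⟨k, hk, j, hj, h1⟩
    · exact ⟨j, hj, k, hk, h1⟩
  have hlt := rankFactor_lt_of_atom (M.fit_pos' j₀) (M.fit_lt_one' j₀) hj hk hr hkj hs
  have hopt : ∀ p, M.expectedRevenue Φ j p ≤ M.expectedRevenue Φ j s := by
    refine heq.2 j s ?_
    rw [h.price_eq j hj]; exact hsupp
  -- Prices just below `s` win all ties at `s` and lose almost nothing in revenue per sale.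
  have hlim : Tendsto (fun p => M.fit j₀ * priceRevenue (M.demand j₀) (M.searchCost j₀) p *
      (1 - M.fit j₀ * G.real (Set.Iio s)) ^ (S.card - 1)) (𝓝[<] s)
      (𝓝 (M.fit j₀ * priceRevenue (M.demand j₀) (M.searchCost j₀) s *
      (1 - M.fit j₀ * G.real (Set.Iio s)) ^ (S.card - 1))) := by
    have := continuous_priceRevenue hQ (M.searchCost j₀)
    exact ((continuous_const.mul this).mul continuous_const).continuousAt.mono_left
      nhdsWithin_le_nhds
  have hne : (𝓝[<] s).NeBot := nhdsLT_neBot_of_exists_lt ⟨0, hs0⟩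
  have hle := le_of_tendsto hlim (b := M.expectedRevenue Φ j s) (by
    filter_upwards [self_mem_nhdsWithin] with p hp
    refine le_trans ?_ (hopt p)
    rw [h.expectedRevenue_eq hj]
    have h1 := pow_le_rankFactor (M := M) (M.fit_pos' j₀) (M.fit_lt_one' j₀) (G := G) hj p
    have h2 : G.real (Set.Iic p) ≤ G.real (Set.Iio s) :=
      measureReal_mono (Set.Iic_subset_Iio.2 hp)
    have h3 := (one_sub_mul_real_pos (M.fit_pos' j₀) (M.fit_lt_one' j₀) (G := G) (Set.Iio s)).le
    have h4 := (M.fit_pos' j₀).le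
    have h5 := priceRevenue_nonneg (M := M) (j := j₀) (M.searchCost j₀) p
    refine mul_le_mul_of_nonneg_left (le_trans ?_ h1) (mul_nonneg h4 h5)
    gcongr)
  rw [h.expectedRevenue_eq hj] at hle
  exact absurd hle (not_le.2 (mul_lt_mul_of_pos_left hlt (mul_pos (M.fit_pos' j₀) hRs)))

/-- Without atoms, all support prices maximize `R p (1 - π G[0, p]) ^ (n - 1)`. For `le_max`,
evaluate at the largest support price, where `G[0, s] = 1`; for `support_opt`, bound the deviation's
factor below by `(1 - π) ^ (n - 1)`. -/
theorem isOptimalPricing : IsOptimalPricing (M.demand j₀) (M.searchCost j₀) (M.fit j₀) S.card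
    (Φ.price j₀) := by
  have hQ := quality_pos_of_priceRevenue_pos hpos
  set G := (Φ.price j₀ : Measure ℝ≥0) with hG
  set R := priceRevenue (M.demand j₀) (M.searchCost j₀) with hR
  have hπ := M.fit_pos' j₀
  have hπ1 := M.fit_lt_one' j₀
  have hRnn : ∀ p, 0 ≤ R p := priceRevenue_nonneg _
  have hrev : ∀ s ∈ G.support, ∀ p, R p * (1 - M.fit j₀ * G.real (Set.Iic p)) ^ (S.card - 1)
      ≤ R s * (1 - M.fit j₀ * G.real (Set.Iic s)) ^ (S.card - 1) := by
    intro s hs p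
    have h1 := heq.2 j₀ s hs p
    rw [h.expectedRevenue_eq h.mem, h.expectedRevenue_eq h.mem,
      rankFactor_eq_of_atomless h.mem fun hc => h.atomless heq hpos hc _,
      rankFactor_eq_of_atomless h.mem fun hc => h.atomless heq hpos hc _, mul_assoc,
      mul_assoc] at h1
    exact le_of_mul_le_mul_left h1 hπ
  have hone : ∀ A : Set ℝ≥0, 1 - (M.fit j₀ : ℝ) ≤ 1 - M.fit j₀ * G.real A := fun A => by
    have : G.real A ≤ 1 := measureReal_le_one
    nlinarith
  refine ⟨?_, fun s hs p => ?_⟩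
  · obtain ⟨u, hu⟩ := exists_max_priceRevenue hQ (κ := M.searchCost j₀) searchCost_nonneg
    refine ⟨u, hu, fun p => ?_⟩
    have hcomp : IsCompact G.support := by
      refine IsCompact.of_isClosed_subset (isCompact_Icc (a := (0 : ℝ≥0)) (b := M.vmax.toNNReal))
        Measure.isClosed_support fun s hs => ⟨zero_le, ?_⟩
      rw [← NNReal.coe_le_coe, Real.coe_toNNReal _ M.vmax_nonneg]
      exact le_vmax_of_priceRevenue_pos searchCost_nonneg
        (h.priceRevenue_pos_of_mem_support heq hpos hs)
    obtain ⟨s, hs, hmax⟩ := hcomp.exists_isMaxOn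
      (Measure.nonempty_support (IsProbabilityMeasure.ne_zero G)) continuousOn_id
    have hGs : G.real (Set.Iic s) = 1 := by
      have : Set.Iic s ∈ ae G := Filter.mem_of_superset Measure.support_mem_ae fun p hp => hmax hp
      rw [measureReal_def, (mem_ae_iff_prob_eq_one measurableSet_Iic).1 this, ENNReal.toReal_one]
    refine (hrev s hs p).trans ?_
    rw [hGs, mul_one, mul_comm]
    have := hu s
    have h0 : 0 ≤ 1 - (M.fit j₀ : ℝ) := by linarith
    exact mul_le_mul_of_nonneg_left this (pow_nonneg h0 _)
  · refine le_trans ?_ (hrev s hs p)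
    rw [mul_comm]
    have h0 : 0 ≤ 1 - (M.fit j₀ : ℝ) := by linarith
    have := hone (Set.Iic p)
    exact mul_le_mul_of_nonneg_left (pow_le_pow_left₀ h0 this _) (hRnn p)

end IsSymmetricState

end Market

/-! ### Existence of symmetric equilibria and the static comparison -/

namespace Market

variable {m : ℕ} {M : Market m} {Φ : SteadyState m} {S : Finset (Fin m)} {j j₀ : Fin m}

variable (M) in
/-- The state in which the businesses in `S` are learned, the others are believed to have
quality `0`, and all use the price law `G`. -/
noncomputable def learnedState (S : Finset (Fin m)) (G : ProbabilityMeasure ℝ≥0) :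
    SteadyState m where
  beliefFit j := ⟨Measure.dirac (if j ∈ S then M.fit j else 1), inferInstance⟩
  beliefQuality j := ⟨Measure.dirac (if j ∈ S then M.quality j else 0), inferInstance⟩
  price _ := G

lemma mem_steadyLearned_learnedState {G : ProbabilityMeasure ℝ≥0} :
    j ∈ M.steadyLearned (M.learnedState S G) ↔ j ∈ S := by
  constructor
  · rintro ⟨h, -⟩
    by_contra hj
    change Measure.dirac (if j ∈ S then M.fit j else 1) = _ at h
    rw [if_neg hj] at h
    -- The belief that an unlearned business fits for sure is never correct, because true fit
    -- probabilities are below `1`; so no business outside `S` counts as learned by accident.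
    have := dirac_eq_dirac_iff.1 h
    exact (M.fit_lt_one j).ne this.symm
  · intro hj
    constructor
    · change Measure.dirac (if j ∈ S then M.fit j else 1) = _
      rw [if_pos hj]
    · change Measure.dirac (if j ∈ S then M.quality j else 0) = _
      rw [if_pos hj]

lemma mem_steadyLost_learnedState {G : ProbabilityMeasure ℝ≥0} (hj : j ∉ S) :
    j ∈ M.steadyLost (M.learnedState S G) := by
  change M.index 0 (beliefMean (Measure.dirac _)) (beliefMean (Measure.dirac _)) M.vmax ≤ 0
  rw [if_neg hj, if_neg hj]
  simp [beliefMean_dirac, index]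

lemma isSymmetricState_learnedState (hS : ∀ j ∈ S, M.fit j = M.fit j₀ ∧ M.quality j = M.quality j₀)
    (hj₀ : j₀ ∈ S) (G : ProbabilityMeasure ℝ≥0) :
    M.IsSymmetricState (M.learnedState S G) S j₀ where
  mem := hj₀
  learned _ hj := mem_steadyLearned_learnedState.2 hj
  fit_eq j hj := (hS j hj).1
  quality_eq j hj := (hS j hj).2
  price_eq _ _ := rfl
  lost _ hj := mem_steadyLost_learnedState hj

lemma isSymmetricEquilibrium_learnedState {G : ProbabilityMeasure ℝ≥0}
    (h : ∀ j ∈ S, ∀ p ∈ (G : Measure ℝ≥0).support, ∀ p', M.expectedRevenue (M.learnedState S G) j p'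
      ≤ M.expectedRevenue (M.learnedState S G) j p) :
    M.IsSymmetricEquilibrium S (M.learnedState S G) := by
  refine ⟨⟨fun j => ?_, fun j p hp p' => ?_⟩, ?_, fun _ _ _ _ => rfl⟩
  · by_cases hj : j ∈ S
    · exact Or.inl (mem_steadyLearned_learnedState.2 hj)
    · exact Or.inr (mem_steadyLost_learnedState hj)
  · by_cases hj : j ∈ S
    · exact h j hj p hp p'
    · rw [expectedRevenue_eq_zero_of_lost (mem_steadyLost_learnedState hj),
        expectedRevenue_eq_zero_of_lost (mem_steadyLost_learnedState hj)]
  · ext j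
    exact mem_steadyLearned_learnedState

lemma steadyLost_of_learned (hj : j ∈ M.steadyLearned Φ)
    (h : M.vmax * M.quality j ≤ M.searchCost j) : j ∈ M.steadyLost Φ := by
  have := steadyIndex_eq_of_learned hj (fun _ => 0) M.vmax
  change M.steadyIndex Φ (fun _ => 0) M.vmax j ≤ 0
  rw [this, NNReal.coe_zero]
  linarith

lemma quality_pos_of_searchCost_lt (h : M.searchCost j < M.vmax * M.quality j) :
    0 < (M.quality j : ℝ) := by
  refine lt_of_le_of_ne (M.quality j).2.1 fun hQ => ?_
  rw [← hQ, mul_zero] at h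
  exact absurd h (not_lt.2 searchCost_nonneg)

/-- If even price `0` attracts nobody, revenues vanish and any price law will do. Otherwise a single
learned business charges the monopoly price, and several use the atomless law. -/
theorem exists_isSymmetricEquilibrium
    (hS : ∀ j ∈ S, ∀ k ∈ S, M.fit j = M.fit k ∧ M.quality j = M.quality k) :
    ∃ Φ, M.IsSymmetricEquilibrium S Φ := by
  rcases S.eq_empty_or_nonempty with rfl | ⟨j₀, hj₀⟩
  · exact ⟨_, isSymmetricEquilibrium_learnedState (G := ⟨Measure.dirac 0, inferInstance⟩)
      fun j hj => absurd hj (Finset.notMem_empty j)⟩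
  have hsym := isSymmetricState_learnedState (fun j hj => hS j hj j₀ hj₀) hj₀
  by_cases hv : M.vmax * M.quality j₀ ≤ M.searchCost j₀
  · refine ⟨_, isSymmetricEquilibrium_learnedState (G := ⟨Measure.dirac 0, inferInstance⟩)
      fun j hj p _ p' => ?_⟩
    have hlost : j ∈ M.steadyLost (M.learnedState S ⟨Measure.dirac 0, inferInstance⟩) := by
      refine steadyLost_of_learned (mem_steadyLearned_learnedState.2 hj) ?_
      rw [(hS j hj j₀ hj₀).2, (hsym ⟨Measure.dirac 0, inferInstance⟩).searchCost_eq hj]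
      exact hv
    rw [expectedRevenue_eq_zero_of_lost hlost, expectedRevenue_eq_zero_of_lost hlost]
  rw [not_le] at hv
  have hQ := quality_pos_of_searchCost_lt hv
  have hπ := M.fit_pos' j₀
  have hπ1 := M.fit_lt_one' j₀
  obtain ⟨u, hu⟩ := exists_max_priceRevenue hQ (κ := M.searchCost j₀) searchCost_nonneg
  obtain ⟨p₀, hp₀⟩ := exists_priceRevenue_pos hQ hv
  obtain ⟨G, hG, hG'⟩ : ∃ G : ProbabilityMeasure ℝ≥0, (2 ≤ S.card → ∀ p, (G : Measure ℝ≥0) {p} = 0) ∧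
      ∀ s ∈ (G : Measure ℝ≥0).support, ∀ p, priceRevenue (M.demand j₀) (M.searchCost j₀) p *
        (1 - M.fit j₀ * (G : Measure ℝ≥0).real (Set.Iic p)) ^ (S.card - 1)
          ≤ priceRevenue (M.demand j₀) (M.searchCost j₀) s *
            (1 - M.fit j₀ * (G : Measure ℝ≥0).real (Set.Iic s)) ^ (S.card - 1) := by
    by_cases hc : 2 ≤ S.card
    · obtain ⟨G, hG, hG'⟩ := exists_atomless_pricing (continuous_priceRevenue hQ (M.searchCost j₀))
        (by simp [priceRevenue]) hu (hp₀.trans_le (hu p₀)) hπ hπ1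
        (show S.card - 1 ≠ 0 by omega)
      exact ⟨G, fun _ => hG, hG'⟩
    · refine ⟨⟨Measure.dirac u, inferInstance⟩, fun h => absurd h hc, fun s hs p => ?_⟩
      have hsu : s = u := by
        have : (Measure.dirac u).support ⊆ {u} := Measure.support_subset_of_isClosed
          isClosed_singleton (by rw [mem_ae_dirac_iff (measurableSet_singleton u)]; rfl)
        exact this hs
      rw [show S.card - 1 = 0 by omega, pow_zero, pow_zero, mul_one, mul_one, hsu]
      exact hu p
  refine ⟨_, isSymmetricEquilibrium_learnedState (G := G) fun j hj s hs p => ?_⟩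
  have hprice : (M.learnedState S G).price j₀ = G := rfl
  rw [(hsym G).expectedRevenue_eq hj, (hsym G).expectedRevenue_eq hj, hprice,
    rankFactor_eq_of_atomless hj fun hc => hG hc p,
    rankFactor_eq_of_atomless hj fun hc => hG hc s, mul_assoc, mul_assoc]
  exact mul_le_mul_of_nonneg_left (hG' s hs p) hπ.le

/-- With a lower search cost and more learned businesses, both welfares are weakly higher. -/
theorem welfare_le_of_subset {Φ' : SteadyState m} {c' : ℝ≥0} (hc : c' < M.cost) {A A' : Set (Fin m)}
    (hAA' : A ⊆ A') (hA' : ∀ j ∈ A', ∀ k ∈ A', M.fit j = M.fit k ∧ M.quality j = M.quality k)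
    (h : M.IsSymmetricEquilibrium A Φ) (h' : (M.withCost c').IsSymmetricEquilibrium A' Φ') :
    M.consumerWelfare Φ ≤ (M.withCost c').consumerWelfare Φ' ∧
      M.totalWelfare Φ ≤ (M.withCost c').totalWelfare Φ' := by
  -- Welfare in the costlier market is `0` if nothing is sold there. This covers the empty learned
  -- set and learned businesses that are too costly to search, so that afterwards some price has
  -- positive revenue.
  have hzero : (∀ j, j ∈ M.steadyLost Φ) → M.consumerWelfare Φ ≤ (M.withCost c').consumerWelfare Φ' ∧
      M.totalWelfare Φ ≤ (M.withCost c').totalWelfare Φ' := fun hl => by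
    rw [consumerWelfare_eq_zero hl, totalWelfare_eq_zero hl]
    exact ⟨consumerWelfare_nonneg h'.1.1, totalWelfare_nonneg h'.1.1⟩
  have hlost : ∀ {j}, j ∉ A → j ∈ M.steadyLost Φ := fun {j} hj =>
    (h.1.1 j).resolve_left (h.2.1 ▸ hj)
  rcases A.eq_empty_or_nonempty with rfl | ⟨j₀, hj₀⟩
  · exact hzero fun j => hlost (Set.notMem_empty j)
  by_cases hv : M.vmax * M.quality j₀ ≤ M.searchCost j₀
  · refine hzero fun j => ?_
    by_cases hj : j ∈ A
    · refine steadyLost_of_learned (h.2.1.symm ▸ hj) ?_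
      have := hA' j (hAA' hj) j₀ (hAA' hj₀)
      rw [this.2, searchCost, this.1]
      exact hv
    · exact hlost hj
  rw [not_le] at hv
  have hQ := quality_pos_of_searchCost_lt hv
  have hpos := exists_priceRevenue_pos hQ hv
  have hs : M.IsSymmetricState Φ (Finset.univ.filter (· ∈ A)) j₀ :=
    { mem := by simpa using hj₀
      learned := fun j hj => h.2.1.symm ▸ (by simpa using hj)
      fit_eq := fun j hj => (hA' j (hAA' (by simpa using hj)) j₀ (hAA' hj₀)).1
      quality_eq := fun j hj => (hA' j (hAA' (by simpa using hj)) j₀ (hAA' hj₀)).2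
      price_eq := fun j hj => h.2.2 j (by simpa using hj) j₀ hj₀
      lost := fun j hj => hlost (by simpa using hj) }
  have hs' : (M.withCost c').IsSymmetricState Φ' (Finset.univ.filter (· ∈ A')) j₀ :=
    { mem := by simpa using hAA' hj₀
      learned := fun j hj => h'.2.1.symm ▸ (by simpa using hj)
      fit_eq := fun j hj => (hA' j (by simpa using hj) j₀ (hAA' hj₀)).1
      quality_eq := fun j hj => (hA' j (by simpa using hj) j₀ (hAA' hj₀)).2
      price_eq := fun j hj => h'.2.2 j (by simpa using hj) j₀ (hAA' hj₀)
      lost := fun j hj => (h'.1.1 j).resolve_left (h'.2.1 ▸ (by simpa using hj)) }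
  have hv' : (M.withCost c').searchCost j₀ < (M.withCost c').vmax * (M.withCost c').quality j₀ :=
    (searchCost_withCost_lt hc).trans hv
  refine welfare_le_of_isOptimalPricing hc ?_ hs hs' (hs.isOptimalPricing h.1 hpos)
    (hs'.isOptimalPricing h'.1 (exists_priceRevenue_pos hQ hv')) hpos
  intro j hj
  simp only [Finset.mem_filter, Finset.mem_univ, true_and] at hj ⊢
  exact hAA' hj

end Market

/-! ### Product densities and i.i.d. sequences -/

section PiDensity

variable {ι : Type*} [Fintype ι] {X : ι → Type*} [∀ i, MeasurableSpace (X i)]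
  {μ : ∀ i, Measure (X i)} [∀ i, IsProbabilityMeasure (μ i)]

lemma lintegral_pi_prod {f : ∀ i, X i → ℝ≥0∞} (hf : ∀ i, Measurable (f i)) :
    ∫⁻ x, ∏ i, f i (x i) ∂Measure.pi μ = ∏ i, ∫⁻ y, f i y ∂μ i := by
  have hind : iIndepFun (fun i (x : ∀ i, X i) => f i (x i)) (Measure.pi μ) :=
    iIndepFun_pi fun i => (hf i).aemeasurable
  have h := lintegral_prod_eq_prod_lintegral_of_indepFun Finset.univ
    (fun i (x : ∀ i, X i) => f i (x i)) hind fun i => (hf i).comp (measurable_pi_apply i)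
  rw [h]
  refine Finset.prod_congr rfl fun i _ => ?_
  rw [← (measurePreserving_eval μ i).map_eq, lintegral_map (hf i) (measurable_pi_apply i)]

lemma pi_withDensity {f : ∀ i, X i → ℝ≥0∞} (hf : ∀ i, Measurable (f i)) (hf1 : ∀ i y, f i y ≤ 1) :
    (Measure.pi μ).withDensity (fun x => ∏ i, f i (x i))
      = Measure.pi fun i => (μ i).withDensity (f i) := by
  have hfin : ∀ i, IsFiniteMeasure ((μ i).withDensity (f i)) := fun i =>
    isFiniteMeasure_withDensity <| ne_of_lt <|
      (lintegral_mono (hf1 i)).trans_lt (by simp)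
  refine (Measure.pi_eq fun s hs => ?_).symm
  rw [withDensity_apply _ (MeasurableSet.univ_pi hs), ← lintegral_indicator (MeasurableSet.univ_pi hs)]
  have : ∀ x, (Set.univ.pi s).indicator (fun x => ∏ i, f i (x i)) x
      = ∏ i, (s i).indicator (f i) (x i) := by
    intro x
    by_cases hx : x ∈ Set.univ.pi s
    · rw [Set.indicator_of_mem hx]
      exact Finset.prod_congr rfl fun i _ => (Set.indicator_of_mem (hx i (Set.mem_univ i)) _).symm
    · rw [Set.indicator_of_notMem hx]
      simp only [Set.mem_pi, Set.mem_univ, true_imp_iff, not_forall] at hx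
      obtain ⟨i, hi⟩ := hx
      exact (Finset.prod_eq_zero (Finset.mem_univ i) (Set.indicator_of_notMem hi _)).symm
  simp only [this]
  rw [lintegral_pi_prod fun i => (hf i).indicator (hs i)]
  exact Finset.prod_congr rfl fun i _ => by
    rw [lintegral_indicator (hs i), withDensity_apply _ (hs i)]

end PiDensity

section Sequences

variable {N : Type*} [MeasurableSpace N] (ν : Measure N) [IsProbabilityMeasure ν]

/-- The law of an i.i.d. sequence. -/
noncomputable abbrev seqLaw : Measure (ℕ → N) := Measure.infinitePi fun _ => ν

lemma measurePreserving_cons :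
    MeasurePreserving (fun q : N × (ℕ → N) => fun n => Nat.casesOn (motive := fun _ => N) n q.1 q.2)
      (ν.prod (seqLaw ν)) (seqLaw ν) := by
  have hm : Measurable
      (fun q : N × (ℕ → N) => fun n => Nat.casesOn (motive := fun _ => N) n q.1 q.2) := by
    refine measurable_pi_iff.2 fun n => ?_
    cases n <;> dsimp only <;> fun_prop
  refine ⟨hm, Measure.eq_infinitePi _ fun s t ht => ?_⟩
  rw [Measure.map_apply hm (MeasurableSet.pi s.countable_toSet fun i _ => ht i)]
  obtain ⟨n, hn⟩ := s.exists_nat_subset_range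
  set t' : ℕ → Set N := fun i => if i ∈ s then t i else Set.univ with ht'
  have htm : ∀ i, MeasurableSet (t' i) := fun i => by
    simp only [ht']; split_ifs; exacts [ht i, MeasurableSet.univ]
  have hprod : ∏ i ∈ s, ν (t i) = (∏ i ∈ Finset.range n, ν (t' (i + 1))) * ν (t' 0) := by
    rw [← Finset.prod_range_succ' (fun i => ν (t' i)), ← Finset.prod_subset
      (hn.trans (Finset.range_mono (Nat.le_succ n)))]
    · exact Finset.prod_congr rfl fun i hi => by simp only [ht', hi, if_true]
    · intro i _ hi
      simp [ht', hi]
  have hset : (fun q : N × (ℕ → N) => fun n => Nat.casesOn (motive := fun _ => N) n q.1 q.2) ⁻¹'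
      (s : Set ℕ).pi t = t' 0 ×ˢ (Finset.range n : Set ℕ).pi fun i => t' (i + 1) := by
    ext q
    simp only [Set.mem_preimage, Set.mem_pi, Finset.mem_coe, Set.mem_prod, Finset.mem_range]
    constructor
    · intro h
      constructor
      · by_cases h0 : 0 ∈ s
        · simpa [ht', h0] using h 0 h0
        · simp [ht', h0]
      · intro i _
        by_cases hi : i + 1 ∈ s
        · simpa [ht', hi] using h (i + 1) hi
        · simp [ht', hi]
    · rintro ⟨h0, h⟩ i hi
      cases i with
      | zero => simpa [ht', hi] using h0
      | succ i =>
        have := h i ((Nat.lt_succ_self i).trans (Finset.mem_range.1 (hn hi)))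
        simpa [ht', hi] using this
  rw [hset, Measure.prod_prod, hprod, Measure.infinitePi_pi _ fun i _ => htm (i + 1), mul_comm]

/-- The map is the inverse of the one that prepends a sample. -/
lemma measurePreserving_head_tail :
    MeasurePreserving (fun ω : ℕ → N => (ω 0, fun n => ω (n + 1))) (seqLaw ν)
      (ν.prod (seqLaw ν)) := by
  have hm : Measurable (fun ω : ℕ → N => (ω 0, fun n => ω (n + 1))) := by fun_prop
  refine ⟨hm, ?_⟩
  conv_lhs => rw [← (measurePreserving_cons ν).map_eq]
  rw [Measure.map_map hm (measurePreserving_cons ν).measurable]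
  exact Measure.map_id

variable {ν} {St : ℕ → Type*} [∀ n, MeasurableSpace (St n)]

/-- A Markov chain driven by the noise `ω`. -/
def chain (F : ∀ n, St n × N → St (n + 1)) (z : St 0) (ω : ℕ → N) : ∀ n, St n
  | 0 => z
  | n + 1 => F n (chain F z ω n, ω n)

variable (ν) in
/-- The marginal laws of a Markov chain. -/
noncomputable def chainLaw (F : ∀ n, St n × N → St (n + 1)) (μ : Measure (St 0)) :
    ∀ n, Measure (St n)
  | 0 => μ
  | n + 1 => ((chainLaw F μ n).prod ν).map (F n)

lemma isProbabilityMeasure_chainLaw {F : ∀ n, St n × N → St (n + 1)} (hF : ∀ n, Measurable (F n))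
    (μ : Measure (St 0)) [IsProbabilityMeasure μ] (n : ℕ) :
    IsProbabilityMeasure (chainLaw ν F μ n) := by
  induction n with
  | zero => assumption
  | succ n ih => exact Measure.isProbabilityMeasure_map (hF n).aemeasurable

/-- The state after `n` steps uses only the first `n` noise terms, so it is independent of the
remaining ones, which are again i.i.d. -/
lemma measurePreserving_chain {F : ∀ n, St n × N → St (n + 1)} (hF : ∀ n, Measurable (F n))
    (μ : Measure (St 0)) [IsProbabilityMeasure μ] (n : ℕ) :
    MeasurePreserving (fun q : St 0 × (ℕ → N) => (chain F q.1 q.2 n, fun k => q.2 (n + k)))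
      (μ.prod (seqLaw ν)) ((chainLaw ν F μ n).prod (seqLaw ν)) := by
  induction n with
  | zero =>
    simp only [zero_add]
    exact MeasurePreserving.id _
  | succ n ih =>
    have := isProbabilityMeasure_chainLaw (ν := ν) hF μ n
    have h1 := (MeasurePreserving.id (chainLaw ν F μ n)).prod (measurePreserving_head_tail ν)
    have h2 := (measurePreserving_prodAssoc (chainLaw ν F μ n) ν (seqLaw ν)).symm
    have h3 : MeasurePreserving (F n) ((chainLaw ν F μ n).prod ν) (chainLaw ν F μ (n + 1)) :=
      ⟨hF n, rfl⟩
    have := isProbabilityMeasure_chainLaw (ν := ν) hF μ (n + 1)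
    have h4 := h3.prod (MeasurePreserving.id (seqLaw ν))
    convert! h4.comp (h2.comp (h1.comp ih)) using 1
    ext q : 1
    refine Prod.ext rfl ?_
    funext k
    change q.2 (n + 1 + k) = q.2 (n + (k + 1))
    exact congrArg q.2 (by omega)

lemma measurePreserving_chain_noise {F : ∀ n, St n × N → St (n + 1)} (hF : ∀ n, Measurable (F n))
    (μ : Measure (St 0)) [IsProbabilityMeasure μ] (n : ℕ) :
    MeasurePreserving (fun q : St 0 × (ℕ → N) => (chain F q.1 q.2 n, q.2 n))
      (μ.prod (seqLaw ν)) ((chainLaw ν F μ n).prod ν) := by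
  have := isProbabilityMeasure_chainLaw (ν := ν) hF μ n
  have h1 := (MeasurePreserving.id (chainLaw ν F μ n)).prod
    (measurePreserving_eval_infinitePi (fun _ : ℕ => ν) 0)
  exact h1.comp (measurePreserving_chain hF μ n)

/-- Laws of sequences are equal if the laws of all their finite prefixes are. -/
lemma measure_ext_of_prefix {μ μ' : Measure (ℕ → N)} [IsFiniteMeasure μ]
    (h : ∀ n, μ.map (fun (ω : ℕ → N) (i : Fin n) => ω i)
      = μ'.map fun (ω : ℕ → N) (i : Fin n) => ω i) : μ = μ' := by
  have key : ∀ J : Finset ℕ, μ.map J.restrict = μ'.map J.restrict := by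
    intro J
    obtain ⟨n, hn⟩ := J.exists_nat_subset_range
    have hg : J.restrict (π := fun _ => N) = (fun (H : Fin n → N) (i : J) =>
      H ⟨i, Finset.mem_range.1 (hn i.2)⟩) ∘ fun (ω : ℕ → N) (i : Fin n) => ω i := rfl
    rw [hg, ← Measure.map_map (by fun_prop) (by fun_prop), h n,
      Measure.map_map (by fun_prop) (by fun_prop)]
  exact IsProjectiveLimit.unique (P := fun J => μ.map J.restrict) (fun _ => rfl)
    fun J => (key J).symm

end Sequences

/-! ### Bayesian beliefs about one business -/

/-- The likelihood of an observation (if any) of a Bernoulli variable with mean `x`. -/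
def obsLikelihood : Option Bool → I → ℝ≥0∞
  | none, _ => 1
  | some true, x => ENNReal.ofReal x
  | some false, x => ENNReal.ofReal (1 - x)

lemma measurable_obsLikelihood (o : Option Bool) : Measurable (obsLikelihood o) := by
  rcases o with _ | _ | _ <;> unfold obsLikelihood <;> fun_prop

lemma obsLikelihood_le_one (o : Option Bool) (x : I) : obsLikelihood o x ≤ 1 := by
  rcases o with _ | _ | _
  · exact le_rfl
  · exact ENNReal.ofReal_le_one.2 (by linarith [x.2.1])
  · exact ENNReal.ofReal_le_one.2 x.2.2

/-- Openness turns a nonzero likelihood at the true parameter, which is only a support point of the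
prior, into positive prior mass, so that Bayes' rule is not degenerate. -/
lemma isOpen_obsLikelihood_ne_zero (o : Option Bool) : IsOpen {x | obsLikelihood o x ≠ 0} := by
  rcases o with _ | _ | _
  · simp [obsLikelihood]
  · simp only [obsLikelihood, ne_eq, ENNReal.ofReal_eq_zero, not_le]
    exact isOpen_lt (by fun_prop) (by fun_prop)
  · simp only [obsLikelihood, ne_eq, ENNReal.ofReal_eq_zero, not_le]
    exact isOpen_lt (by fun_prop) (by fun_prop)

lemma obsLikelihood_ne_zero_of_mem_Ioo (o : Option Bool) {x : I} (h0 : 0 < (x : ℝ))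
    (h1 : (x : ℝ) < 1) : obsLikelihood o x ≠ 0 := by
  rcases o with _ | _ | _ <;> simp [obsLikelihood, h0, h1]

/-- The likelihood of a list of observations. -/
noncomputable def seqLikelihood (o : ℕ → Option Bool) (k : ℕ) (x : I) : ℝ≥0∞ :=
  ∏ i ∈ Finset.range k, obsLikelihood (o i) x

lemma measurable_seqLikelihood (o : ℕ → Option Bool) (k : ℕ) : Measurable (seqLikelihood o k) :=
  Finset.measurable_prod _ fun _ _ => measurable_obsLikelihood _

lemma seqLikelihood_le_one (o : ℕ → Option Bool) (k : ℕ) (x : I) : seqLikelihood o k x ≤ 1 :=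
  Finset.prod_le_one' fun _ _ => obsLikelihood_le_one _ _

lemma isOpen_seqLikelihood_ne_zero (o : ℕ → Option Bool) (k : ℕ) :
    IsOpen {x | seqLikelihood o k x ≠ 0} := by
  have : {x | seqLikelihood o k x ≠ 0} = ⋂ i ∈ Finset.range k, {x | obsLikelihood (o i) x ≠ 0} := by
    ext x; simp [seqLikelihood, Finset.prod_ne_zero_iff]
  rw [this]
  exact isOpen_biInter_finset fun i _ => isOpen_obsLikelihood_ne_zero _

/-- The posterior of a parameter with prior `μ`, given the likelihood `f`. -/
noncomputable def bayes (μ : Measure I) (f : I → ℝ≥0∞) : Measure I :=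
  (∫⁻ x, f x ∂μ)⁻¹ • μ.withDensity f

section bayes

variable {μ : Measure I} {f : I → ℝ≥0∞}

lemma lintegral_pos_of_mem_support (hf : Measurable f) (ho : IsOpen {x | f x ≠ 0}) {x : I}
    (hx : x ∈ μ.support) (hfx : f x ≠ 0) {U : Set I} (hU : IsOpen U) (hxU : x ∈ U) :
    ∫⁻ y in U, f y ∂μ ≠ 0 := by
  intro h
  rw [lintegral_eq_zero_iff hf, Filter.EventuallyEq, ae_restrict_iff' hU.measurableSet, ae_iff] at h
  have hmem : {y | f y ≠ 0} ∩ U ∈ 𝓝 x := (ho.inter hU).mem_nhds ⟨hfx, hxU⟩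
  refine ((Measure.mem_support_iff_forall x).1 hx _ hmem).ne' (measure_mono_null ?_ h)
  rintro y ⟨hy, hyU⟩ hcon
  exact hy (hcon hyU)

variable [IsProbabilityMeasure μ] (hf1 : ∀ x, f x ≤ 1)
include hf1

lemma lintegral_ne_top_of_le_one : ∫⁻ x, f x ∂μ ≠ ∞ :=
  ne_of_lt ((lintegral_mono hf1).trans_lt (by simp))

lemma isProbabilityMeasure_bayes (h0 : ∫⁻ x, f x ∂μ ≠ 0) : IsProbabilityMeasure (bayes μ f) := by
  constructor
  rw [bayes, Measure.smul_apply, withDensity_apply _ MeasurableSet.univ, setLIntegral_univ,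
    smul_eq_mul, ENNReal.inv_mul_cancel h0 (lintegral_ne_top_of_le_one hf1)]

lemma bayes_pos (hf : Measurable f) (ho : IsOpen {x | f x ≠ 0}) {x : I}
    (hx : x ∈ μ.support) (hfx : f x ≠ 0) {U : Set I} (hU : IsOpen U) (hxU : x ∈ U) :
    bayes μ f U ≠ 0 := by
  rw [bayes, Measure.smul_apply, withDensity_apply _ hU.measurableSet, smul_eq_mul]
  exact mul_ne_zero (ENNReal.inv_ne_zero.2 (lintegral_ne_top_of_le_one hf1))
    (lintegral_pos_of_mem_support hf ho hx hfx hU hxU)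

lemma beliefMean_bayes_pos (h0 : ∫⁻ x, f x ∂μ ≠ 0) (hf : Measurable f) (ho : IsOpen {x | f x ≠ 0}) {x : I}
    (hx : x ∈ μ.support) (hfx : f x ≠ 0) (hx0 : 0 < (x : ℝ)) : 0 < beliefMean (bayes μ f) := by
  have := isProbabilityMeasure_bayes hf1 h0
  rw [beliefMean, integral_pos_iff_support_of_nonneg (fun y => y.2.1)
    (integrable_coe_unitInterval _)]
  refine pos_iff_ne_zero.2 fun h => bayes_pos hf1 hf ho hx hfx
    (isOpen_lt (f := fun _ : I => (0 : ℝ)) (g := fun y : I => (y : ℝ)) (by fun_prop) (by fun_prop)) hx0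
    (measure_mono_null ?_ h)
  intro y (hy : 0 < (y : ℝ))
  exact hy.ne'

end bayes

/-- Each further observation multiplies the likelihood by a factor at most `1`, so null sets of a
belief stay null. -/
lemma bayes_absolutelyContinuous {μ : Measure I} [IsProbabilityMeasure μ] {o : ℕ → Option Bool}
    {k l : ℕ} (hkl : k ≤ l) :
    bayes μ (seqLikelihood o l) ≪ bayes μ (seqLikelihood o k) := by
  have hle : seqLikelihood o l ≤ seqLikelihood o k := fun x =>
    Finset.prod_le_prod_of_subset_of_le_one' (Finset.range_mono hkl)
      fun _ _ _ => obsLikelihood_le_one _ _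
  refine Measure.AbsolutelyContinuous.mk fun A hA h => ?_
  rw [bayes, Measure.smul_apply, smul_eq_mul, mul_eq_zero] at h ⊢
  refine Or.inr (le_antisymm ?_ zero_le)
  have h' := h.resolve_left (ENNReal.inv_ne_zero.2
    (lintegral_ne_top_of_le_one (seqLikelihood_le_one o k)))
  rw [← h', withDensity_apply _ hA, withDensity_apply _ hA]
  exact lintegral_mono hle

namespace Market

variable {m : ℕ} (M : Market m)

/-- Prior and likelihood are products over businesses and over fit and quality; the normalizing
constants of the other businesses cancel. -/
lemma posterior_map_eval {n : ℕ} {H : FinHistory m n} {f g : Fin m → I → ℝ≥0∞}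
    (hf : ∀ j, Measurable (f j)) (hg : ∀ j, Measurable (g j)) (hf1 : ∀ j x, f j x ≤ 1)
    (hg1 : ∀ j x, g j x ≤ 1) (hfg : ∀ θ, likelihood H θ = ∏ j, f j (θ j).1 * g j (θ j).2)
    (hf0 : ∀ j, ∫⁻ x, f j x ∂(M.priorFit j : Measure I) ≠ 0)
    (hg0 : ∀ j, ∫⁻ x, g j x ∂(M.priorQuality j : Measure I) ≠ 0) (j : Fin m) :
    (M.posterior H).map (Function.eval j)
      = (bayes (M.priorFit j) (f j)).prod (bayes (M.priorQuality j) (g j)) := by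
  have hF : ∀ j, Measurable fun y : I × I => f j y.1 * g j y.2 := fun j =>
    ((hf j).comp measurable_fst).mul ((hg j).comp measurable_snd)
  have hF1 : ∀ j (y : I × I), f j y.1 * g j y.2 ≤ 1 := fun j y => mul_le_one' (hf1 j _) (hg1 j _)
  have hint : ∀ j, ∫⁻ y, f j y.1 * g j y.2
      ∂((M.priorFit j : Measure I).prod (M.priorQuality j : Measure I))
      = (∫⁻ x, f j x ∂(M.priorFit j : Measure I)) * ∫⁻ x, g j x ∂(M.priorQuality j : Measure I) :=
    fun j => lintegral_prod_mul (hf j).aemeasurable (hg j).aemeasurable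
  have htop : ∀ j, ∫⁻ x, f j x ∂(M.priorFit j : Measure I) ≠ ∞ := fun j =>
    lintegral_ne_top_of_le_one (hf1 j)
  have htop' : ∀ j, ∫⁻ x, g j x ∂(M.priorQuality j : Measure I) ≠ ∞ := fun j =>
    lintegral_ne_top_of_le_one (hg1 j)
  have hlik : likelihood H = fun θ => ∏ j, f j (θ j).1 * g j (θ j).2 := funext hfg
  have hfin : ∀ j, IsFiniteMeasure (((M.priorFit j : Measure I).prod
      (M.priorQuality j : Measure I)).withDensity fun y => f j y.1 * g j y.2) := fun j =>
    isFiniteMeasure_withDensity (by rw [hint]; exact ENNReal.mul_ne_top (htop j) (htop' j))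
  rw [posterior, prior, hlik, pi_withDensity hF hF1,
    lintegral_pi_prod (f := fun j (y : I × I) => f j y.1 * g j y.2) hF, Measure.map_smul,
    Measure.pi_map_eval, smul_smul]
  simp only [hint, withDensity_apply _ MeasurableSet.univ, setLIntegral_univ]
  set c := fun j => (∫⁻ x, f j x ∂(M.priorFit j : Measure I)) *
    ∫⁻ x, g j x ∂(M.priorQuality j : Measure I) with hc
  have hc0 : ∀ j, c j ≠ 0 := fun j => mul_ne_zero (hf0 j) (hg0 j)
  have hctop : ∀ j, c j ≠ ∞ := fun j => ENNReal.mul_ne_top (htop j) (htop' j)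
  have hscal : (∏ j, c j)⁻¹ * ∏ i ∈ Finset.univ.erase j, c i = (c j)⁻¹ := by
    rw [← Finset.mul_prod_erase _ _ (Finset.mem_univ j), ENNReal.mul_inv (Or.inl (hc0 j))
      (Or.inl (hctop j)), mul_assoc, ENNReal.inv_mul_cancel, mul_one]
    · exact Finset.prod_ne_zero_iff.2 fun i _ => hc0 i
    · exact ENNReal.prod_ne_top fun i _ => hctop i
  change ((∏ j, c j)⁻¹ * ∏ i ∈ Finset.univ.erase j, c i) • _ = _
  rw [hscal, bayes, bayes, Measure.prod_smul_left, Measure.prod_smul_right, smul_smul,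
    prod_withDensity (hf j) (hg j)]
  congr 1
  exact ENNReal.mul_inv (Or.inl (hf0 j)) (Or.inl (htop j))

lemma posteriorFit_eq {n : ℕ} {H : FinHistory m n} {f g : Fin m → I → ℝ≥0∞}
    (hf : ∀ j, Measurable (f j)) (hg : ∀ j, Measurable (g j)) (hf1 : ∀ j x, f j x ≤ 1)
    (hg1 : ∀ j x, g j x ≤ 1) (hfg : ∀ θ, likelihood H θ = ∏ j, f j (θ j).1 * g j (θ j).2)
    (hf0 : ∀ j, ∫⁻ x, f j x ∂(M.priorFit j : Measure I) ≠ 0)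
    (hg0 : ∀ j, ∫⁻ x, g j x ∂(M.priorQuality j : Measure I) ≠ 0) (j : Fin m) :
    M.posteriorFit H j = bayes (M.priorFit j) (f j) ∧
      M.posteriorQuality H j = bayes (M.priorQuality j) (g j) := by
  have h := M.posterior_map_eval hf hg hf1 hg1 hfg hf0 hg0 j
  have := isProbabilityMeasure_bayes (hf1 j) (hf0 j)
  have := isProbabilityMeasure_bayes (hg1 j) (hg0 j)
  have h1 : M.posteriorFit H j = ((M.posterior H).map (Function.eval j)).map Prod.fst := by
    rw [Measure.map_map measurable_fst (measurable_pi_apply j)]; rfl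
  have h2 : M.posteriorQuality H j = ((M.posterior H).map (Function.eval j)).map Prod.snd := by
    rw [Measure.map_map measurable_snd (measurable_pi_apply j)]; rfl
  rw [h1, h2, h, Measure.map_fst_prod, Measure.map_snd_prod]
  simp

end Market

/-! ### Measurability and the law of histories -/

instance (m : ℕ) : DiscreteMeasurableSpace (Feedback m) := ⟨fun _ => trivial⟩

instance (m : ℕ) : Finite (Feedback m) :=
  Finite.of_injective (fun f : Feedback m => (f.fit, f.sale)) fun f g h => by
    cases f; cases g; simpa using h

section History

variable {m : ℕ}

/-- Feedback has finitely many values, so every function of it is measurable. Beliefs depend on the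
history only through feedback, the likelihood being free of prices. -/
lemma measurable_of_feedback {n : ℕ} {α : Type*} [MeasurableSpace α] (φ : (Fin n → Feedback m) → α) :
    Measurable fun H : FinHistory m n => φ fun i => (H i).2 :=
  (Measurable.of_discrete (f := φ)).comp (by fun_prop)

lemma measurable_take (n : ℕ) : Measurable fun h : History m => h.take n := by
  unfold History.take; fun_prop

lemma measurable_snoc (n : ℕ) : Measurable fun q : FinHistory m n × Round m =>
    (Fin.snoc (α := fun _ => Round m) q.1 q.2 : FinHistory m (n + 1)) := by
  refine measurable_pi_iff.2 fun i => ?_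
  refine Fin.lastCases ?_ (fun i => ?_) i
  · simpa using measurable_snd
  · simp only [Fin.snoc_castSucc]; fun_prop

end History

namespace Market

variable {m : ℕ} (M : Market m)

/-- The law of the randomness in one round. -/
noncomputable def roundLaw : Measure (Consumer m × (Fin m → I)) :=
  M.consumerLaw.prod (Measure.pi fun _ => (volume : Measure I))

instance : IsProbabilityMeasure M.roundLaw := by unfold roundLaw; infer_instance

lemma noiseLaw_eq (ρ : PricingRules m) : M.noiseLaw ρ = seqLaw M.roundLaw := rfl

lemma posterior_univ_le_one {n : ℕ} (H : FinHistory m n) : M.posterior H Set.univ ≤ 1 := by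
  rw [posterior, Measure.smul_apply, withDensity_apply _ MeasurableSet.univ, setLIntegral_univ,
    smul_eq_mul]
  exact ENNReal.inv_mul_le_one _

/-- At histories of likelihood zero the posterior is not a probability measure, but its mass never
exceeds `1`. -/
lemma beliefMean_posteriorQuality_le_one {n : ℕ} (H : FinHistory m n) (j : Fin m) :
    beliefMean (M.posteriorQuality H j) ≤ 1 := by
  have hle : M.posteriorQuality H j Set.univ ≤ 1 := by
    rw [posteriorQuality, Measure.map_apply (by fun_prop) MeasurableSet.univ]
    exact M.posterior_univ_le_one H
  have : IsFiniteMeasure (M.posteriorQuality H j) := ⟨hle.trans_lt ENNReal.one_lt_top⟩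
  calc beliefMean (M.posteriorQuality H j) ≤ ∫ _ : I, (1 : ℝ) ∂(M.posteriorQuality H j) :=
        integral_mono (integrable_coe_unitInterval _) (integrable_const _) fun x => x.2.2
    _ ≤ 1 := by
      rw [integral_const, smul_eq_mul, mul_one]
      exact ENNReal.toReal_le_of_le_ofReal zero_le_one (by simpa using hle)

lemma measurable_meanFit (n : ℕ) (j : Fin m) :
    Measurable fun H : FinHistory m n => beliefMean (M.posteriorFit H j) :=
  measurable_of_feedback fun F => beliefMean (M.posteriorFit (fun i => ((0 : Fin m → ℝ≥0), F i)) j)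

lemma measurable_meanQuality (n : ℕ) (j : Fin m) :
    Measurable fun H : FinHistory m n => beliefMean (M.posteriorQuality H j) :=
  measurable_of_feedback fun F =>
    beliefMean (M.posteriorQuality (fun i => ((0 : Fin m → ℝ≥0), F i)) j)

lemma measurable_indexAfter {Ω : Type*} [MeasurableSpace Ω] {n : ℕ} {H : Ω → FinHistory m n}
    {p : Ω → ℝ≥0} {v : Ω → ℝ} (hH : Measurable H) (hp : Measurable p) (hv : Measurable v)
    (j : Fin m) : Measurable fun ω => M.indexAfter (H ω) j (p ω) (v ω) := by
  have h1 := (M.measurable_meanFit n j).comp hH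
  have h2 := (M.measurable_meanQuality n j).comp hH
  simp only [Function.comp_def] at h1 h2
  unfold indexAfter index
  fun_prop

/-- The feedback, given which businesses are inspected. -/
def feedbackOf (q : (Fin m → Bool) × (Fin m → Bool × Bool)) : Feedback m where
  fit j := if q.1 j then some (q.2 j).1 else none
  sale j := if q.1 j && (q.2 j).1 then some (q.2 j).2 else none

variable (ρ : PricingRules m)

/-- The prices posted after history `H`. -/
def postedPrice {n : ℕ} (H : FinHistory m n) (u : Fin m → I) (j : Fin m) : ℝ≥0 :=
  ρ.price j n H (u j)

/-- The indices of a consumer after history `H`. -/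
noncomputable def roundIndex {n : ℕ} (H : FinHistory m n) (u : Fin m → I) (v : ℝ) (j : Fin m) : ℝ :=
  M.indexAfter H j (postedPrice ρ H u j) v

lemma measurable_postedPrice (n : ℕ) (j : Fin m) :
    Measurable fun q : FinHistory m n × (Fin m → I) => postedPrice ρ q.1 q.2 j :=
  (ρ.measurable_price j n).comp (by fun_prop : Measurable fun q : FinHistory m n × (Fin m → I) =>
    (q.1, q.2 j))

lemma measurable_roundIndex (n : ℕ) (j : Fin m) :
    Measurable fun q : FinHistory m n × ((Fin m → I) × ℝ) => M.roundIndex ρ q.1 q.2.1 q.2.2 j :=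
  M.measurable_indexAfter measurable_fst
    ((measurable_postedPrice ρ n j).comp (by fun_prop :
      Measurable fun q : FinHistory m n × ((Fin m → I) × ℝ) => (q.1, q.2.1))) (by fun_prop) j

lemma nextRound_eq {n : ℕ} (H : FinHistory m n) (s : Consumer m × (Fin m → I)) :
    M.nextRound ρ H s = (postedPrice ρ H s.2, feedbackOf (fun j =>
      if s.1.Inspects (M.roundIndex ρ H s.2 s.1.value) j then true else false, s.1.2.2)) := by
  refine Prod.ext rfl ?_
  simp only [nextRound, feedbackOf, Feedback.mk.injEq]
  constructor <;> funext j
  · change (if s.1.Inspects (M.roundIndex ρ H s.2 s.1.value) j then _ else _) = _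
    split_ifs <;> simp_all [Consumer.fit]
  · have hT : s.1.Transacts (M.roundIndex ρ H s.2 s.1.value) j ↔
      s.1.Inspects (M.roundIndex ρ H s.2 s.1.value) j ∧ (s.1.2.2 j).1 = true := Iff.rfl
    change (if s.1.Transacts (M.roundIndex ρ H s.2 s.1.value) j then _ else _) = _
    by_cases h1 : s.1.Inspects (M.roundIndex ρ H s.2 s.1.value) j <;>
      by_cases h2 : (s.1.2.2 j).1 = true <;> simp [hT, h1, h2, Consumer.quality]

lemma measurable_nextRound (n : ℕ) :
    Measurable fun q : FinHistory m n × (Consumer m × (Fin m → I)) => M.nextRound ρ q.1 q.2 := by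
  simp only [nextRound_eq]
  refine Measurable.prodMk ?_ ((Measurable.of_discrete (f := feedbackOf)).comp
    (Measurable.prodMk ?_ (by fun_prop)))
  · exact measurable_pi_iff.2 fun j => (measurable_postedPrice ρ n j).comp
      (by fun_prop : Measurable fun q : FinHistory m n × (Consumer m × (Fin m → I)) => (q.1, q.2.2))
  · refine measurable_pi_iff.2 fun j => Measurable.ite
      (Consumer.measurableSet_inspects (by fun_prop) (fun k => ?_) j) measurable_const
      measurable_const
    have hv : Measurable fun q : FinHistory m n × (Consumer m × (Fin m → I)) => q.2.1.value :=
      measurable_snd.fst.fst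
    exact (M.measurable_roundIndex ρ n k).comp
      (Measurable.prodMk measurable_fst (Measurable.prodMk (by fun_prop) hv))

/-- The transition of the history. -/
noncomputable def step (n : ℕ) (q : FinHistory m n × (Consumer m × (Fin m → I))) :
    FinHistory m (n + 1) :=
  Fin.snoc (α := fun _ => Round m) q.1 (M.nextRound ρ q.1 q.2)

lemma measurable_step (n : ℕ) : Measurable (M.step ρ n) :=
  (measurable_snoc n).comp (measurable_fst.prodMk (M.measurable_nextRound ρ n))

lemma runFor_eq_chain (ω : ℕ → Consumer m × (Fin m → I)) (n : ℕ) :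
    M.runFor ρ ω n = chain (St := FinHistory m) (M.step ρ) Fin.elim0 ω n := by
  induction n with
  | zero => rfl
  | succ n ih => rw [runFor, chain, ih, step]

/-- The law of the first `n` rounds. -/
noncomputable def prefixLaw (n : ℕ) : Measure (FinHistory m n) :=
  chainLaw (St := FinHistory m) M.roundLaw (M.step ρ) (Measure.dirac Fin.elim0) n

instance (n : ℕ) : IsProbabilityMeasure (M.prefixLaw ρ n) :=
  isProbabilityMeasure_chainLaw (M.measurable_step ρ) _ n

lemma measurePreserving_runFor_noise (n : ℕ) :
    MeasurePreserving (fun ω : ℕ → Consumer m × (Fin m → I) => (M.runFor ρ ω n, ω n))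
      (M.noiseLaw ρ) ((M.prefixLaw ρ n).prod M.roundLaw) := by
  have h1 := measurePreserving_chain_noise (St := FinHistory m) (ν := M.roundLaw)
    (M.measurable_step ρ) (Measure.dirac Fin.elim0) n
  have h2 : MeasurePreserving (fun ω : ℕ → Consumer m × (Fin m → I) =>
      ((Fin.elim0 : FinHistory m 0), ω)) (M.noiseLaw ρ)
      ((Measure.dirac Fin.elim0).prod (seqLaw M.roundLaw)) := by
    refine ⟨by fun_prop, ?_⟩
    rw [Measure.dirac_prod, noiseLaw_eq]
  have h3 := h1.comp h2
  simp only [Function.comp_def, ← runFor_eq_chain] at h3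
  exact h3

lemma measurePreserving_runFor (n : ℕ) :
    MeasurePreserving (fun ω => M.runFor ρ ω n) (M.noiseLaw ρ) (M.prefixLaw ρ n) :=
  measurePreserving_fst.comp (M.measurePreserving_runFor_noise ρ n)

lemma take_run (ω : ℕ → Consumer m × (Fin m → I)) (n : ℕ) :
    (M.run ρ ω).take n = M.runFor ρ ω n := by
  induction n with
  | zero => funext i; exact i.elim0
  | succ n ih =>
    funext i
    refine Fin.lastCases ?_ (fun i => ?_) i
    · simp [runFor, History.take, run]
    · rw [runFor, Fin.snoc_castSucc, ← ih]; rfl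

lemma measurable_run : Measurable (M.run ρ) :=
  measurable_pi_iff.2 fun n =>
    (M.measurable_nextRound ρ n).comp (M.measurePreserving_runFor_noise ρ n).measurable

lemma historyLaw_map_take (n : ℕ) :
    (M.historyLaw ρ).map (fun h => h.take n) = M.prefixLaw ρ n := by
  rw [historyLaw, Measure.map_map (measurable_take n) (M.measurable_run ρ),
    ← (M.measurePreserving_runFor ρ n).map_eq]
  congr 1
  funext ω
  exact M.take_run ρ ω n

/-- A property that all posted prices have almost surely after every given history holds along
almost every infinite history. -/
lemma ae_historyLaw_price {Q : ∀ n, Fin m → Set (FinHistory m n × ℝ≥0)}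
    (hQ : ∀ n j, MeasurableSet (Q n j))
    (h : ∀ n j (H : FinHistory m n), ∀ᵐ u : I, (H, ρ.price j n H u) ∈ Q n j) :
    ∀ᵐ h ∂M.historyLaw ρ, ∀ n j, (h.take n, (h n).1 j) ∈ Q n j := by
  refine ae_all_iff.2 fun n => ae_all_iff.2 fun j => ?_
  have hm : MeasurableSet {h : History m | (h.take n, (h n).1 j) ∈ Q n j} :=
    (hQ n j).preimage ((measurable_take n).prodMk (by fun_prop))
  rw [historyLaw, ae_map_iff (M.measurable_run ρ).aemeasurable hm]
  have hprod : ∀ᵐ q ∂(M.prefixLaw ρ n).prod M.roundLaw,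
      (q.1, postedPrice ρ q.1 q.2.2 j) ∈ Q n j := by
    have hm' : MeasurableSet {q : FinHistory m n × (Consumer m × (Fin m → I)) |
        (q.1, postedPrice ρ q.1 q.2.2 j) ∈ Q n j} :=
      (hQ n j).preimage (measurable_fst.prodMk ((measurable_postedPrice ρ n j).comp
        (by fun_prop : Measurable fun q : FinHistory m n × (Consumer m × (Fin m → I)) =>
          (q.1, q.2.2))))
    rw [Measure.ae_prod_iff_ae_ae hm']
    -- The random number for the price in round `n` is independent of the first `n` rounds, so
    -- Fubini reduces to a fixed history.
    refine ae_of_all _ fun H => ?_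
    have hmp : MeasurePreserving (fun s : Consumer m × (Fin m → I) => s.2 j) M.roundLaw volume :=
      (measurePreserving_eval (fun _ : Fin m => (volume : Measure I)) j).comp measurePreserving_snd
    exact hmp.quasiMeasurePreserving.ae (h n j H)
  filter_upwards [(M.measurePreserving_runFor_noise ρ n).quasiMeasurePreserving.ae hprod] with ω hω
  rw [take_run]
  exact hω

end Market

lemma bernoulliMeasure_singleton (p : I) (b : Bool) :
    bernoulliMeasure true false p {b} = obsLikelihood (some b) p := by
  cases b
  · rw [bernoulliMeasure_apply_of_notMem_of_mem _ (measurableSet_singleton _) (by simp) (by simp),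
      obsLikelihood, ← unitInterval.coe_symm_eq, ENNReal.ofReal_eq_coe_nnreal (unitInterval.nonneg _)]
    rfl
  · rw [bernoulliMeasure_apply_of_mem_of_notMem _ (measurableSet_singleton _) (by simp) (by simp),
      obsLikelihood, ENNReal.ofReal_eq_coe_nnreal (unitInterval.nonneg _)]
    rfl

/-! ### Recurrence of keen consumers -/

section Recurrence

variable {N : Type*} [MeasurableSpace N] {ν : Measure N} [IsProbabilityMeasure ν]

/-- An event of positive probability recurs in an i.i.d. sequence. -/
lemma ae_seqLaw_frequently {A : Set N} (hA : MeasurableSet A) (h0 : ν A ≠ 0) :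
    ∀ᵐ ω ∂seqLaw ν, ∃ᶠ n in atTop, ω n ∈ A := by
  have hm : ∀ n, MeasurableSet ((fun ω : ℕ → N => ω n) ⁻¹' A) := fun n =>
    hA.preimage (measurable_pi_apply n)
  have hmeas : ∀ n, seqLaw ν ((fun ω : ℕ → N => ω n) ⁻¹' A) = ν A := fun n =>
    (measurePreserving_eval_infinitePi (fun _ : ℕ => ν) n).measure_preimage hA.nullMeasurableSet
  have hind : iIndepSet (fun n => (fun ω : ℕ → N => ω n) ⁻¹' A) (seqLaw ν) := by
    rw [iIndepSet_iff_meas_biInter hm]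
    intro s
    have : (⋂ i ∈ s, (fun ω : ℕ → N => ω i) ⁻¹' A) = (s : Set ℕ).pi fun _ => A := by
      ext ω; simp [Set.mem_pi]
    rw [this, Measure.infinitePi_pi _ fun i _ => hA]
    exact Finset.prod_congr rfl fun i _ => (hmeas i).symm
  -- Second Borel–Cantelli lemma.
  have h1 := measure_limsup_eq_one hm hind (by simp [hmeas, ENNReal.tsum_const_eq_top_of_ne_zero h0])
  have h2 := (prob_compl_eq_zero_iff (MeasurableSet.measurableSet_limsup hm)).2 h1
  filter_upwards [show ∀ᵐ ω ∂seqLaw ν, ω ∈ limsup (fun n => (fun ω : ℕ → N => ω n) ⁻¹' A) atTop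
    from h2] with ω hω
  rwa [mem_limsup_iff_frequently_mem] at hω

end Recurrence

namespace Market

variable {m : ℕ} (M : Market m)

/-- Consumers with a value close to the maximum and without any fit. -/
def keenUnfit (ε : ℝ) : Set (Consumer m × (Fin m → I)) :=
  {s | M.vmax - ε < s.1.value ∧ ∀ j, s.1.fit j = false}

lemma measurableSet_keenUnfit (ε : ℝ) : MeasurableSet (M.keenUnfit ε) := by
  refine (measurableSet_lt measurable_const measurable_fst.fst).inter ?_
  change MeasurableSet {s : Consumer m × (Fin m → I) | ∀ j, s.1.fit j = false}
  simp only [Set.ofPred_forall]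
  exact MeasurableSet.iInter fun j => Consumer.measurable_fit measurable_fst j
    (measurableSet_singleton false)

lemma roundLaw_keenUnfit_ne_zero {ε : ℝ} (hε : 0 < ε) : M.roundLaw (M.keenUnfit ε) ≠ 0 := by
  have hset : M.keenUnfit ε = (Set.Ioi (M.vmax - ε) ×ˢ (Set.univ ×ˢ
      Set.univ.pi fun _ : Fin m => ({false} ×ˢ Set.univ : Set (Bool × Bool)))) ×ˢ Set.univ := by
    ext s
    simp [keenUnfit, Consumer.value, Consumer.fit, Set.mem_pi, Set.mem_prod]
  rw [hset, roundLaw, Measure.prod_prod, consumerLaw, Measure.prod_prod, Measure.prod_prod,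
    Measure.pi_pi]
  simp only [measure_univ, mul_one, one_mul]
  refine mul_ne_zero (M.value_near_vmax _ (by linarith)).ne' (Finset.prod_ne_zero_iff.2 fun j _ => ?_)
  rw [Measure.prod_prod, measure_univ, mul_one]
  rw [bernoulliMeasure_singleton]
  exact obsLikelihood_ne_zero_of_mem_Ioo _ (M.fit_pos' j) (M.fit_lt_one' j)

variable (ρ : PricingRules m)

lemma indexAfter_sub {n : ℕ} (H : FinHistory m n) (j : Fin m) (p : ℝ≥0) (v v' : ℝ) :
    M.indexAfter H j p v - M.indexAfter H j p v'
      = (v - v') * beliefMean (M.posteriorQuality H j) := by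
  unfold indexAfter index; ring

/-- A business whose index for the consumer with the highest value stays bounded away from `0` is
inspected again. -/
lemma ae_exists_inspection {ε : ℝ} (hε : 0 < ε) (j : Fin m) (n₀ : ℕ) :
    ∀ᵐ h ∂M.historyLaw ρ, (∀ n ≥ n₀, ε ≤ M.indexAfter (h.take n) j ((h n).1 j) M.vmax) →
      ∃ n ≥ n₀, (h n).2.fit j ≠ none := by
  have hmi : ∀ n, Measurable fun h : History m => M.indexAfter (h.take n) j ((h n).1 j) M.vmax :=
    fun n => M.measurable_indexAfter (measurable_take n) (by fun_prop) measurable_const j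
  have hmf : ∀ n, MeasurableSet {h : History m | (h n).2.fit j ≠ none} := fun n =>
    (by fun_prop : Measurable fun h : History m => (h n).2)
      (MeasurableSet.of_discrete (s := {f : Feedback m | f.fit j ≠ none}))
  have hm : MeasurableSet {h : History m |
      (∀ n ≥ n₀, ε ≤ M.indexAfter (h.take n) j ((h n).1 j) M.vmax) →
        ∃ n ≥ n₀, (h n).2.fit j ≠ none} := by
    refine MeasurableSet.imp ?_ ?_
    · simp only [Set.ofPred_forall]
      exact MeasurableSet.iInter fun n => MeasurableSet.iInter fun _ =>
        measurableSet_le measurable_const (hmi n)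
    · simp only [Set.ofPred_exists, Set.ofPred_and]
      exact MeasurableSet.iUnion fun n => (MeasurableSet.const _).inter (hmf n)
  rw [historyLaw, ae_map_iff (M.measurable_run ρ).aemeasurable hm, noiseLaw_eq]
  filter_upwards [ae_seqLaw_frequently (M.measurableSet_keenUnfit (ε / 2))
    (M.roundLaw_keenUnfit_ne_zero (half_pos hε))] with ω hω hidx
  obtain ⟨n, hn, hv, hf⟩ := frequently_atTop.1 hω n₀
  refine ⟨n, hn, ?_⟩
  have hidx := hidx n hn
  rw [take_run] at hidx
  -- A value above `vmax - ε / 2` lowers the index by less than `ε / 2`, because the mean quality is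
  -- at most `1`.
  have hpos : 0 < M.roundIndex ρ (M.runFor ρ ω n) (ω n).2 (ω n).1.value j := by
    have hsub := M.indexAfter_sub (M.runFor ρ ω n) j ((M.run ρ ω n).1 j) (ω n).1.value M.vmax
    have hQ0 : 0 ≤ beliefMean (M.posteriorQuality (M.runFor ρ ω n) j) := beliefMean_nonneg _
    have hQ1 := M.beliefMean_posteriorQuality_le_one (M.runFor ρ ω n) j
    change 0 < M.indexAfter (M.runFor ρ ω n) j ((M.run ρ ω n).1 j) (ω n).1.value
    nlinarith
  have hins : (ω n).1.Inspects (M.roundIndex ρ (M.runFor ρ ω n) (ω n).2 (ω n).1.value) j :=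
    ⟨hpos, fun k _ => hf k⟩
  rw [run, nextRound_eq]
  simp [feedbackOf, hins]

end Market

/-! ### Reading i.i.d. stacks adaptively -/

section Resample

variable {ι : Type*} [Fintype ι] {B : Type*} [MeasurableSpace B] [Finite B]
  [MeasurableSingletonClass B]

/-- The values seen by an observer who reads the tops of the stacks `s` where `A` holds, and `e`
elsewhere. -/
noncomputable def mergeTops (A : ι → Prop) (s : ι → ℕ → B) (e : ι → B) (j : ι) : B :=
  if A j then s j 0 else e j

/-- The stacks that are left when the tops are removed where `A` holds. -/
noncomputable def popTops (A : ι → Prop) (s : ι → ℕ → B) (j : ι) : ℕ → B :=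
  if A j then fun k => s j (k + 1) else s j

/-- Reading policies: whether the policy reads `j` is determined by the values it reads. -/
def IsReadingPolicy (A : (ι → B) → ι → Prop) : Prop :=
  ∀ b b', (∀ j, A b j → b j = b' j) → ∀ j, A b j ↔ A b' j

/-- One observation from the tops of the stacks. -/
noncomputable def readTops (A : (ι → B) → ι → Prop) (q : (ι → ℕ → B) × (ι → B)) :
    (ι → B) × (ι → ℕ → B) :=
  (mergeTops (A fun j => q.1 j 0) q.1 q.2, popTops (A fun j => q.1 j 0) q.1)

omit [Fintype ι] [MeasurableSpace B] [Finite B] [MeasurableSingletonClass B] in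
-- Once the observed values `b` are fixed, so is the set of stacks that were read; the preimage is
-- therefore a box, to which independence applies.
lemma readTops_preimage {A : (ι → B) → ι → Prop} (hA : IsReadingPolicy A) (b : ι → B)
    (C : ι → Set (ℕ → B)) :
    readTops A ⁻¹' ({b} ×ˢ Set.univ.pi C) =
      (Set.univ.pi fun j => {x | if A b j then x 0 ∈ ({b j} : Set B) ∧ (fun k => x (k + 1)) ∈ C j
        else x ∈ C j}) ×ˢ (Set.univ.pi fun j => if A b j then Set.univ else {b j}) := by
  ext ⟨s, e⟩
  simp only [Set.mem_preimage, readTops, Set.mem_prod, Set.mem_singleton_iff, Set.mem_pi,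
    Set.mem_univ, true_imp_iff, Set.mem_ofPred_eq, funext_iff, mergeTops, popTops]
  constructor
  · rintro ⟨h1, h2⟩
    have hAb : ∀ j, A (fun j => s j 0) j ↔ A b j := hA _ _ fun j hj => by
      simpa [hj] using h1 j
    refine ⟨fun j => ?_, fun j => ?_⟩
    · have h1 := h1 j; have h2 := h2 j
      by_cases hj : A b j
      · rw [if_pos ((hAb j).2 hj)] at h1 h2; rw [if_pos hj]; exact ⟨h1, h2⟩
      · rw [if_neg (fun h => hj ((hAb j).1 h))] at h2; rw [if_neg hj]; exact h2
    · have h1 := h1 j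
      by_cases hj : A b j
      · simp [hj]
      · rw [if_neg (fun h => hj ((hAb j).1 h))] at h1; simp [hj, h1]
  · rintro ⟨h1, h2⟩
    have hAb : ∀ j, A b j ↔ A (fun j => s j 0) j := hA _ _ fun j hj => by
      have := h1 j; rw [if_pos hj] at this; exact this.1.symm
    refine ⟨fun j => ?_, fun j => ?_⟩
    · have h1 := h1 j; have h2 := h2 j
      by_cases hj : A b j
      · rw [if_pos hj] at h1; rw [if_pos ((hAb j).1 hj)]; exact h1.1
      · rw [if_neg hj] at h2; rw [if_neg (fun h => hj ((hAb j).2 h))]; exact h2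
    · have h1 := h1 j
      by_cases hj : A b j
      · rw [if_pos hj] at h1; rw [if_pos ((hAb j).1 hj)]; exact h1.2
      · rw [if_neg hj] at h1; rw [if_neg (fun h => hj ((hAb j).2 h))]; exact h1

variable {ν : ι → Measure B} [∀ i, IsProbabilityMeasure (ν i)]

omit [Fintype ι] [Finite B] [MeasurableSingletonClass B] in
lemma measurable_mergeTops {Ω : Type*} [MeasurableSpace Ω] {A : Ω → ι → Prop} {s : Ω → ι → ℕ → B}
    {e : Ω → ι → B} (hA : ∀ j, MeasurableSet {ω | A ω j}) (hs : Measurable s) (he : Measurable e) :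
    Measurable fun ω => mergeTops (A ω) (s ω) (e ω) :=
  measurable_pi_iff.2 fun j => Measurable.ite (hA j) (by fun_prop) (by fun_prop)

omit [Fintype ι] [Finite B] [MeasurableSingletonClass B] in
lemma measurable_popTops {Ω : Type*} [MeasurableSpace Ω] {A : Ω → ι → Prop} {s : Ω → ι → ℕ → B}
    (hA : ∀ j, MeasurableSet {ω | A ω j}) (hs : Measurable s) :
    Measurable fun ω => popTops (A ω) (s ω) :=
  measurable_pi_iff.2 fun j => Measurable.ite (hA j) (by fun_prop) (by fun_prop)

lemma measurable_readTops (A : (ι → B) → ι → Prop) : Measurable (readTops A) := by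
  have hA : ∀ j, MeasurableSet {q : (ι → ℕ → B) × (ι → B) | A (fun j => q.1 j 0) j} := fun j =>
    (by fun_prop : Measurable fun q : (ι → ℕ → B) × (ι → B) => fun j => q.1 j 0)
      (MeasurableSet.of_discrete (s := {b : ι → B | A b j}))
  exact (measurable_mergeTops hA measurable_fst measurable_snd).prodMk
    (measurable_popTops hA measurable_fst)

/-- Reading i.i.d. stacks adaptively gives fresh values and leaves i.i.d. stacks. -/
lemma map_readTops {A : (ι → B) → ι → Prop} (hA : IsReadingPolicy A) :
    ((Measure.pi fun j => seqLaw (ν j)).prod (Measure.pi ν)).map (readTops A)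
      = (Measure.pi ν).prod (Measure.pi fun j => seqLaw (ν j)) := by
  have hm := measurable_readTops A
  set P := ((Measure.pi fun j => seqLaw (ν j)).prod (Measure.pi ν)).map (readTops A) with hP
  have hPp : IsProbabilityMeasure P := Measure.isProbabilityMeasure_map hm.aemeasurable
  have hbox : ∀ b C, (∀ j, MeasurableSet (C j)) → P ({b} ×ˢ Set.univ.pi C)
      = Measure.pi ν {b} * Measure.pi (fun j => seqLaw (ν j)) (Set.univ.pi C) := by
    intro b C hC
    rw [hP, Measure.map_apply hm ((measurableSet_singleton b).prod (MeasurableSet.univ_pi hC)),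
      readTops_preimage hA, Measure.prod_prod, Measure.pi_pi, Measure.pi_pi, Measure.pi_pi,
      Measure.pi_singleton, ← Finset.prod_mul_distrib, ← Finset.prod_mul_distrib]
    refine Finset.prod_congr rfl fun j _ => ?_
    -- A stack that is read splits into top and rest; one that is not read stays whole, and the
    -- value `b j` comes from the independent spare sample `e j`.
    by_cases hj : A b j
    · simp only [hj, if_true, measure_univ, mul_one]
      rw [← Measure.prod_prod, ← (measurePreserving_head_tail (ν j)).measure_preimage
        ((measurableSet_singleton _).prod (hC j)).nullMeasurableSet]
      rfl
    · simp only [hj, if_false]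
      rw [mul_comm]
      rfl
  have hsing : ∀ b t, MeasurableSet t → P ({b} ×ˢ t)
      = Measure.pi ν {b} * Measure.pi (fun j => seqLaw (ν j)) t := by
    intro b t ht
    have h1 : ∀ t, MeasurableSet t →
        (P.restrict (Prod.fst ⁻¹' {b})).map Prod.snd t = P ({b} ×ˢ t) := fun t ht => by
      rw [Measure.map_apply measurable_snd ht, Measure.restrict_apply (measurable_snd ht),
        Set.prod_eq, Set.inter_comm]
    have h2 : (P.restrict (Prod.fst ⁻¹' {b})).map Prod.snd
        = Measure.pi ν {b} • Measure.pi (fun j => seqLaw (ν j)) := by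
      refine ext_of_generate_finite _ generateFrom_pi.symm isPiSystem_pi ?_ ?_
      · rintro _ ⟨C, hC, rfl⟩
        have hC : ∀ j, MeasurableSet (C j) := fun j => hC j (Set.mem_univ j)
        rw [h1 _ (MeasurableSet.univ_pi hC), hbox b C hC, Measure.smul_apply, smul_eq_mul]
      · have := hbox b (fun _ => Set.univ) fun _ => MeasurableSet.univ
        rw [Set.pi_univ] at this
        rw [h1 _ MeasurableSet.univ, this, Measure.smul_apply, smul_eq_mul]
    rw [← h1 t ht, h2, Measure.smul_apply, smul_eq_mul]
  symm
  refine Measure.prod_eq fun S t hS ht => ?_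
  obtain ⟨F, rfl⟩ : ∃ F : Finset (ι → B), (F : Set (ι → B)) = S := S.toFinite.exists_finset_coe
  have hu : (F : Set (ι → B)) ×ˢ t = ⋃ b ∈ F, ({b} ×ˢ t) := by ext q; simp
  rw [hu, measure_biUnion_finset, ← sum_measure_singleton, Finset.sum_mul]
  · exact Finset.sum_congr rfl fun b _ => hsing b t ht
  · intro b _ b' _ hbb'
    exact Set.disjoint_left.2 fun q hq hq' => hbb' (hq.1.symm.trans hq'.1)
  · exact fun b _ => (measurableSet_singleton b).prod ht

end Resample

section Rearrange

variable {α β γ δ : Type*} [MeasurableSpace α] [MeasurableSpace β] [MeasurableSpace γ]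
  [MeasurableSpace δ] (μ : Measure α) (ν : Measure β) (ξ : Measure γ) (ζ : Measure δ)
  [IsProbabilityMeasure μ] [IsProbabilityMeasure ν] [IsProbabilityMeasure ξ]
  [IsProbabilityMeasure ζ]

lemma measurePreserving_prod_right_comm :
    MeasurePreserving (fun q : (α × β) × γ => ((q.1.1, q.2), q.1.2)) ((μ.prod ν).prod ξ)
      ((μ.prod ξ).prod ν) :=
  (measurePreserving_prodAssoc μ ξ ν).symm.comp
    (((MeasurePreserving.id μ).prod (Measure.measurePreserving_swap (μ := ν) (ν := ξ))).comp
      (measurePreserving_prodAssoc μ ν ξ))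

lemma measurePreserving_prod_prod_comm :
    MeasurePreserving (fun q : (α × β) × (γ × δ) => ((q.1.1, q.2.1), (q.1.2, q.2.2)))
      ((μ.prod ν).prod (ξ.prod ζ)) ((μ.prod ξ).prod (ν.prod ζ)) :=
  (measurePreserving_prodAssoc μ ξ (ν.prod ζ)).symm.comp
    (((MeasurePreserving.id μ).prod (measurePreserving_prod_left_comm ν ξ ζ)).comp
      (measurePreserving_prodAssoc μ ν (ξ.prod ζ)))

end Rearrange

/-! ### The market run on stacks -/

/-- For each business, the sequence of the fits and quality realizations of its inspections. -/
abbrev Stack (m : ℕ) : Type := Fin m → ℕ → Bool × Bool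

namespace Market

variable {m : ℕ} (M : Market m)

/-- The law of the fits and quality realizations of all inspections. -/
noncomputable def stackLaw : Measure (Stack m) :=
  Measure.pi fun j => seqLaw ((bernoulliMeasure true false (M.fit j)).prod
    (bernoulliMeasure true false (M.quality j)))

instance : IsProbabilityMeasure M.stackLaw := by unfold stackLaw; infer_instance

/-- The law of value, priority order and random numbers for the prices in one round. -/
noncomputable def choiceLaw : Measure ((ℝ × Equiv.Perm (Fin m)) × (Fin m → I)) :=
  ((M.valueLaw : Measure ℝ).prod M.tieLaw.toMeasure).prod (Measure.pi fun _ => volume)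

instance : IsProbabilityMeasure M.choiceLaw := by unfold choiceLaw; infer_instance

lemma measurePreserving_roundLaw_split :
    MeasurePreserving (fun z : Consumer m × (Fin m → I) => (((z.1.1, z.1.2.1), z.2), z.1.2.2))
      M.roundLaw (M.choiceLaw.prod (fitLaw M)) :=
  (measurePreserving_prod_right_comm ((M.valueLaw : Measure ℝ).prod M.tieLaw.toMeasure) (fitLaw M)
    (Measure.pi fun _ => (volume : Measure I))).comp
    ((measurePreserving_prodAssoc (M.valueLaw : Measure ℝ) M.tieLaw.toMeasure (fitLaw M)).symm.prod
      (MeasurePreserving.id (Measure.pi fun _ => (volume : Measure I))))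

lemma measurePreserving_roundLaw_join :
    MeasurePreserving (fun z : ((ℝ × Equiv.Perm (Fin m)) × (Fin m → I)) × (Fin m → Bool × Bool) =>
      (((z.1.1.1, z.1.1.2, z.2), z.1.2) : Consumer m × (Fin m → I)))
      (M.choiceLaw.prod (fitLaw M)) M.roundLaw :=
  ((measurePreserving_prodAssoc (M.valueLaw : Measure ℝ) M.tieLaw.toMeasure (fitLaw M)).prod
    (MeasurePreserving.id (Measure.pi fun _ => (volume : Measure I)))).comp
    (measurePreserving_prod_right_comm ((M.valueLaw : Measure ℝ).prod M.tieLaw.toMeasure)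
      (Measure.pi fun _ => (volume : Measure I)) (fitLaw M))

variable (ρ : PricingRules m)

/-- The businesses that are inspected by a consumer with fits and quality realizations `b`. -/
def inspectionPolicy {n : ℕ} (H : FinHistory m n) (k : (ℝ × Equiv.Perm (Fin m)) × (Fin m → I))
    (b : Fin m → Bool × Bool) (j : Fin m) : Prop :=
  Consumer.Inspects (k.1.1, k.1.2, b) (M.roundIndex ρ H k.2 k.1.1) j

lemma isReadingPolicy_inspectionPolicy {n : ℕ} (H : FinHistory m n)
    (k : (ℝ × Equiv.Perm (Fin m)) × (Fin m → I)) : IsReadingPolicy (M.inspectionPolicy ρ H k) :=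
  fun b b' h _ => Consumer.inspects_congr (a := (k.1.1, k.1.2, b)) (a' := (k.1.1, k.1.2, b')) rfl
    fun i hi => congrArg Prod.fst (h i hi)

/-- The fits and quality realizations of a round, read from the stacks where businesses are
inspected, and the remaining stacks. -/
noncomputable def stackRead {n : ℕ} (q : (FinHistory m n × Stack m) × (Consumer m × (Fin m → I))) :
    (Fin m → Bool × Bool) × Stack m :=
  readTops (M.inspectionPolicy ρ q.1.1 ((q.2.1.1, q.2.1.2.1), q.2.2)) (q.1.2, q.2.1.2.2)

/-- The transition of the history and the stacks. -/
noncomputable def stackStep (n : ℕ) (q : (FinHistory m n × Stack m) × (Consumer m × (Fin m → I))) :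
    FinHistory m (n + 1) × Stack m :=
  (M.step ρ n (q.1.1, ((q.2.1.1, q.2.1.2.1, (M.stackRead ρ q).1), q.2.2)), (M.stackRead ρ q).2)

/-- Given the history, the value, the priority order and the prices, inspection is a reading policy.
So the consumer that it assembles has the right law, and fresh stacks are left that are independent
of the new history. -/
lemma measurePreserving_stackStep (n : ℕ) :
    MeasurePreserving (M.stackStep ρ n) (((M.prefixLaw ρ n).prod M.stackLaw).prod M.roundLaw)
      ((M.prefixLaw ρ (n + 1)).prod M.stackLaw) := by
  have h1 := (measurePreserving_prod_prod_comm (M.prefixLaw ρ n) M.stackLaw M.choiceLaw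
    (fitLaw M)).comp ((MeasurePreserving.id ((M.prefixLaw ρ n).prod M.stackLaw)).prod
      M.measurePreserving_roundLaw_split)
  have h2 : MeasurePreserving
      (fun p : (FinHistory m n × ((ℝ × Equiv.Perm (Fin m)) × (Fin m → I))) ×
        (Stack m × (Fin m → Bool × Bool)) => (p.1, readTops (M.inspectionPolicy ρ p.1.1 p.1.2) p.2))
      (((M.prefixLaw ρ n).prod M.choiceLaw).prod (M.stackLaw.prod (fitLaw M)))
      (((M.prefixLaw ρ n).prod M.choiceLaw).prod ((fitLaw M).prod M.stackLaw)) := by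
    refine (MeasurePreserving.id _).skew_product
      (g := fun y : FinHistory m n × ((ℝ × Equiv.Perm (Fin m)) × (Fin m → I)) =>
        readTops (M.inspectionPolicy ρ y.1 y.2)) ?_ (ae_of_all _ fun y =>
        map_readTops (M.isReadingPolicy_inspectionPolicy ρ y.1 y.2))
    have hA : ∀ j, MeasurableSet {p : (FinHistory m n × ((ℝ × Equiv.Perm (Fin m)) × (Fin m → I))) ×
        (Stack m × (Fin m → Bool × Bool)) |
        M.inspectionPolicy ρ p.1.1 p.1.2 (fun i => p.2.1 i 0) j} := fun j =>
      Consumer.measurableSet_inspects (A := fun p : (FinHistory m n ×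
        ((ℝ × Equiv.Perm (Fin m)) × (Fin m → I))) × (Stack m × (Fin m → Bool × Bool)) =>
          (p.1.2.1.1, p.1.2.1.2, fun i => p.2.1 i 0)) (by fun_prop)
        (fun i => (M.measurable_roundIndex ρ n i).comp (by fun_prop : Measurable
          fun p : (FinHistory m n × ((ℝ × Equiv.Perm (Fin m)) × (Fin m → I))) ×
            (Stack m × (Fin m → Bool × Bool)) => (p.1.1, p.1.2.2, p.1.2.1.1))) j
    exact (measurable_mergeTops hA measurable_snd.fst measurable_snd.snd).prodMk
      (measurable_popTops hA measurable_snd.fst)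
  have h3 := (((MeasurePreserving.id (M.prefixLaw ρ n)).prod M.measurePreserving_roundLaw_join).comp
    (measurePreserving_prodAssoc (M.prefixLaw ρ n) M.choiceLaw (fitLaw M))).prod
      (MeasurePreserving.id M.stackLaw)
  have h4 := (measurePreserving_prodAssoc ((M.prefixLaw ρ n).prod M.choiceLaw) (fitLaw M)
    M.stackLaw).symm
  have h5 : MeasurePreserving (M.step ρ n) ((M.prefixLaw ρ n).prod M.roundLaw)
    (M.prefixLaw ρ (n + 1)) := ⟨M.measurable_step ρ n, rfl⟩
  exact (h5.prod (MeasurePreserving.id M.stackLaw)).comp (h3.comp (h4.comp (h2.comp h1)))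

/-- The law of the stacks and of the randomness of all rounds. -/
noncomputable def worldLaw : Measure (Stack m × (ℕ → Consumer m × (Fin m → I))) :=
  M.stackLaw.prod (seqLaw M.roundLaw)

instance : IsProbabilityMeasure M.worldLaw := by unfold worldLaw; infer_instance

/-- The first `n` rounds and the stacks after them. -/
noncomputable def stackState (q : Stack m × (ℕ → Consumer m × (Fin m → I))) (n : ℕ) :
    FinHistory m n × Stack m :=
  chain (St := fun n => FinHistory m n × Stack m) (M.stackStep ρ) (Fin.elim0, q.1) q.2 n

/-- The infinite history, as a function of the stacks and the randomness of all rounds. -/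
noncomputable def stackRun (q : Stack m × (ℕ → Consumer m × (Fin m → I))) : History m :=
  fun n => (M.stackState ρ q (n + 1)).1 (Fin.last n)

lemma take_stackRun (q : Stack m × (ℕ → Consumer m × (Fin m → I))) (n : ℕ) :
    (M.stackRun ρ q).take n = (M.stackState ρ q n).1 := by
  induction n with
  | zero => funext i; exact i.elim0
  | succ n ih =>
    funext i
    refine Fin.lastCases rfl (fun i => ?_) i
    have : (M.stackState ρ q (n + 1)).1 i.castSucc = (M.stackState ρ q n).1 i :=
      Fin.snoc_castSucc (α := fun _ => Round m) _ _ _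
    rw [this, ← ih]; rfl

lemma measurePreserving_stackState_noise (n : ℕ) :
    MeasurePreserving (fun q => (M.stackState ρ q n, q.2 n)) M.worldLaw
      (((M.prefixLaw ρ n).prod M.stackLaw).prod M.roundLaw) := by
  have hlaw : chainLaw (St := fun n => FinHistory m n × Stack m) M.roundLaw (M.stackStep ρ)
      ((Measure.dirac Fin.elim0).prod M.stackLaw) n = (M.prefixLaw ρ n).prod M.stackLaw := by
    induction n with
    | zero => rfl
    | succ n ih => rw [chainLaw, ih, (M.measurePreserving_stackStep ρ n).map_eq]
  rw [← hlaw]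
  have h1 : MeasurePreserving (fun q : Stack m × (ℕ → Consumer m × (Fin m → I)) =>
      (((Fin.elim0 : FinHistory m 0), q.1), q.2)) M.worldLaw
      (((Measure.dirac Fin.elim0).prod M.stackLaw).prod (seqLaw M.roundLaw)) := by
    refine MeasurePreserving.prod (f := fun s : Stack m => ((Fin.elim0 : FinHistory m 0), s))
      ⟨by fun_prop, ?_⟩ (MeasurePreserving.id _)
    rw [Measure.dirac_prod]
  exact (measurePreserving_chain_noise (St := fun n => FinHistory m n × Stack m) (ν := M.roundLaw)
    (fun n => (M.measurePreserving_stackStep ρ n).measurable)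
    ((Measure.dirac Fin.elim0).prod M.stackLaw) n).comp h1

/-- Running on stacks gives the true law of histories. As `worldLaw` does not involve the search
cost, both markets can share one sample of it. -/
lemma measurePreserving_stackRun :
    MeasurePreserving (M.stackRun ρ) M.worldLaw (M.historyLaw ρ) := by
  have hm : Measurable (M.stackRun ρ) := measurable_pi_iff.2 fun n =>
    (measurable_pi_apply (Fin.last n)).comp
      (M.measurePreserving_stackState_noise ρ (n + 1)).measurable.fst.fst
  refine ⟨hm, ?_⟩
  have : IsProbabilityMeasure (M.worldLaw.map (M.stackRun ρ)) :=
    Measure.isProbabilityMeasure_map hm.aemeasurable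
  refine measure_ext_of_prefix fun n => ?_
  change (M.worldLaw.map (M.stackRun ρ)).map (fun h : History m => h.take n)
    = (M.historyLaw ρ).map fun h => h.take n
  rw [historyLaw_map_take, Measure.map_map (measurable_take n) hm]
  have := (measurePreserving_fst.comp (measurePreserving_fst.comp
    (M.measurePreserving_stackState_noise ρ n))).map_eq
  convert! this using 2
  funext q
  exact M.take_stackRun ρ q n

end Market

/-! ### Beliefs as functions of inspection counts -/

/-- The number of inspections of business `j` in the first `n` rounds. -/
noncomputable def History.inspections {m : ℕ} (h : History m) (j : Fin m) (n : ℕ) : ℕ :=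
  ((Finset.range n).filter fun i => (h i).2.fit j ≠ none).card

namespace History

variable {m : ℕ} (h : History m) (j : Fin m)

lemma inspections_zero : h.inspections j 0 = 0 := rfl

lemma inspections_succ (n : ℕ) :
    h.inspections j (n + 1) = h.inspections j n + if (h n).2.fit j ≠ none then 1 else 0 := by
  rw [inspections, Finset.range_add_one, Finset.filter_insert]
  split_ifs
  · rw [Finset.card_insert_of_notMem (by simp)]; rfl
  · rfl

lemma inspections_mono : Monotone (h.inspections j) :=
  monotone_nat_of_le_succ fun n => by rw [inspections_succ]; exact Nat.le_add_right _ _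

lemma inspections_succ_le (n : ℕ) : h.inspections j (n + 1) ≤ h.inspections j n + 1 := by
  rw [inspections_succ]; split_ifs <;> omega

end History

namespace Stack

variable {m : ℕ} (s : Stack m) (j : Fin m) (k : ℕ)

/-- The fit observed at the inspection `k` of business `j`. -/
def fitObs : Option Bool := some (s j k).1

/-- The quality realization observed (if any) at the inspection `k` of business `j`. -/
def qualityObs : Option Bool := if (s j k).1 then some (s j k).2 else none

end Stack

namespace Market

variable {m : ℕ} (M : Market m)

/-- The belief about the fit probability of business `j` after `k` inspections. -/
noncomputable def fitBelief (s : Stack m) (j : Fin m) (k : ℕ) : Measure I :=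
  bayes (M.priorFit j) (seqLikelihood (s.fitObs j) k)

/-- The belief about the quality of business `j` after `k` inspections. -/
noncomputable def qualityBelief (s : Stack m) (j : Fin m) (k : ℕ) : Measure I :=
  bayes (M.priorQuality j) (seqLikelihood (s.qualityObs j) k)

/-- No quality realization in the stacks has probability `0`. -/
def Plausible (s : Stack m) : Prop := ∀ j k, obsLikelihood (s.qualityObs j k) (M.quality j) ≠ 0

lemma ae_plausible : ∀ᵐ s ∂M.stackLaw, M.Plausible s := by
  refine ae_all_iff.2 fun j => ae_all_iff.2 fun k => ?_
  have hmp : MeasurePreserving (fun s : Stack m => (s j k).2) M.stackLaw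
      (bernoulliMeasure true false (M.quality j)) :=
    (measurePreserving_snd (μ := bernoulliMeasure true false (M.fit j))
      (ν := bernoulliMeasure true false (M.quality j))).comp
      ((measurePreserving_eval_infinitePi (fun _ : ℕ => (bernoulliMeasure true false (M.fit j)).prod
        (bernoulliMeasure true false (M.quality j))) k).comp
      (measurePreserving_eval (fun j => seqLaw ((bernoulliMeasure true false (M.fit j)).prod
        (bernoulliMeasure true false (M.quality j)))) j))
  have hae : ∀ᵐ b ∂bernoulliMeasure true false (M.quality j),
      obsLikelihood (some b) (M.quality j) ≠ 0 := by
    rw [ae_iff_of_countable]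
    intro b hb
    rwa [bernoulliMeasure_singleton] at hb
  filter_upwards [hmp.quasiMeasurePreserving.ae hae] with s hs
  unfold Stack.qualityObs
  split_ifs
  · exact hs
  · simp [obsLikelihood]

section Plausible

variable {M} {s : Stack m} (hs : M.Plausible s) (j : Fin m) (k : ℕ)

lemma fit_seqLikelihood_ne_zero : seqLikelihood (s.fitObs j) k (M.fit j) ≠ 0 :=
  Finset.prod_ne_zero_iff.2 fun _ _ =>
    obsLikelihood_ne_zero_of_mem_Ioo _ (M.fit_pos' j) (M.fit_lt_one' j)

lemma lintegral_fit_ne_zero : ∫⁻ x, seqLikelihood (s.fitObs j) k x ∂(M.priorFit j : Measure I) ≠ 0 := by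
  rw [← setLIntegral_univ]
  exact lintegral_pos_of_mem_support (measurable_seqLikelihood _ _)
    (isOpen_seqLikelihood_ne_zero _ _) (M.fit_mem_support j) (fit_seqLikelihood_ne_zero j k)
    isOpen_univ (Set.mem_univ _)

include hs in
lemma lintegral_quality_ne_zero :
    ∫⁻ x, seqLikelihood (s.qualityObs j) k x ∂(M.priorQuality j : Measure I) ≠ 0 := by
  rw [← setLIntegral_univ]
  exact lintegral_pos_of_mem_support (measurable_seqLikelihood _ _)
    (isOpen_seqLikelihood_ne_zero _ _) (M.quality_mem_support j)
    (Finset.prod_ne_zero_iff.2 fun i _ => hs j i) isOpen_univ (Set.mem_univ _)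

lemma isProbabilityMeasure_fitBelief : IsProbabilityMeasure (M.fitBelief s j k) :=
  isProbabilityMeasure_bayes (seqLikelihood_le_one _ _) (lintegral_fit_ne_zero j k)

include hs in
lemma isProbabilityMeasure_qualityBelief : IsProbabilityMeasure (M.qualityBelief s j k) :=
  isProbabilityMeasure_bayes (seqLikelihood_le_one _ _) (lintegral_quality_ne_zero hs j k)

lemma beliefMean_fitBelief_pos : 0 < beliefMean (M.fitBelief s j k) :=
  beliefMean_bayes_pos (seqLikelihood_le_one _ _) (lintegral_fit_ne_zero j k)
    (measurable_seqLikelihood _ _) (isOpen_seqLikelihood_ne_zero _ _) (M.fit_mem_support j)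
    (fit_seqLikelihood_ne_zero j k) (M.fit_pos' j)

end Plausible

lemma feedbackLikelihood_eq (f : Feedback m) (θ : Fin m → I × I) :
    feedbackLikelihood f θ
      = ∏ j, obsLikelihood (f.fit j) (θ j).1 * obsLikelihood (f.sale j) (θ j).2 := by
  refine Finset.prod_congr rfl fun j _ => ?_
  congr 1
  · rcases f.fit j with _ | _ | _ <;> rfl
  · rcases f.sale j with _ | _ | _ <;> rfl

lemma likelihood_take_succ (h : History m) (n : ℕ) (θ : Fin m → I × I) :
    likelihood (h.take (n + 1)) θ = likelihood (h.take n) θ * feedbackLikelihood (h n).2 θ := by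
  rw [likelihood, Fin.prod_univ_castSucc]
  rfl

variable (ρ : PricingRules m) (q : Stack m × (ℕ → Consumer m × (Fin m → I)))

/-- `A` is the set of businesses inspected in round `n`. The index bound uses the value alone, which
is all that is needed to compare with price `0` and value `vmax`. -/
lemma stackRun_round (n : ℕ) : ∃ A : Fin m → Prop,
    (∀ j, A j → 0 < M.indexAfter ((M.stackRun ρ q).take n) j (((M.stackRun ρ q) n).1 j)
      (q.2 n).1.1) ∧
    (∀ j, ((M.stackRun ρ q) n).2.fit j
      = if A j then (M.stackState ρ q n).2.fitObs j 0 else none) ∧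
    (∀ j, ((M.stackRun ρ q) n).2.sale j
      = if A j then (M.stackState ρ q n).2.qualityObs j 0 else none) ∧
    (M.stackState ρ q (n + 1)).2 = popTops A (M.stackState ρ q n).2 := by
  set H := (M.stackState ρ q n).1 with hH
  set s := (M.stackState ρ q n).2 with hs
  set k : (ℝ × Equiv.Perm (Fin m)) × (Fin m → I) := (((q.2 n).1.1, (q.2 n).1.2.1), (q.2 n).2) with hk
  set A := M.inspectionPolicy ρ H k fun j => s j 0 with hA
  set b := mergeTops A s (q.2 n).1.2.2 with hb
  have hround : M.stackRun ρ q n = M.nextRound ρ H (((q.2 n).1.1, (q.2 n).1.2.1, b), (q.2 n).2) :=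
    Fin.snoc_last (α := fun _ => Round m) _ _
  have hbs : ∀ j, A j → b j = s j 0 := fun j hj => if_pos hj
  have hAb : ∀ j, A j ↔ Consumer.Inspects ((q.2 n).1.1, (q.2 n).1.2.1, b)
      (M.roundIndex ρ H (q.2 n).2 (q.2 n).1.1) j :=
    M.isReadingPolicy_inspectionPolicy ρ H k _ b fun j hj => (hbs j hj).symm
  have hround' : M.stackRun ρ q n
      = (postedPrice ρ H (q.2 n).2, feedbackOf (fun j => if A j then true else false, b)) := by
    rw [hround, nextRound_eq]
    congr 3
    funext j
    exact if_congr (hAb j).symm rfl rfl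
  refine ⟨A, fun j hj => ?_, fun j => ?_, fun j => ?_, rfl⟩
  · rw [take_stackRun, hround']
    exact hj.1
  · rw [hround']
    by_cases hj : A j
    · simp [feedbackOf, hj, hbs j hj, Stack.fitObs]
    · simp [feedbackOf, hj]
  · rw [hround']
    by_cases hj : A j
    · simp [feedbackOf, hj, hbs j hj, Stack.qualityObs]
    · simp [feedbackOf, hj]

lemma fit_stackRun_ne_none_iff {n : ℕ} {A : Fin m → Prop} {s : Stack m} {j : Fin m}
    (h : ((M.stackRun ρ q) n).2.fit j = if A j then s.fitObs j 0 else none) :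
    ((M.stackRun ρ q) n).2.fit j ≠ none ↔ A j := by
  rw [h]
  by_cases hj : A j <;> simp [hj, Stack.fitObs]

/-- The stacks after `n` rounds are what is left of the initial stacks. -/
lemma stackState_snd (n : ℕ) (j : Fin m) (k : ℕ) :
    (M.stackState ρ q n).2 j k = q.1 j ((M.stackRun ρ q).inspections j n + k) := by
  induction n generalizing k with
  | zero =>
    rw [History.inspections_zero, zero_add]; rfl
  | succ n ih =>
    obtain ⟨A, -, hfit, -, hpop⟩ := M.stackRun_round ρ q n
    rw [hpop, History.inspections_succ, if_congr (M.fit_stackRun_ne_none_iff ρ q (hfit j)) rfl rfl]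
    unfold popTops
    by_cases hj : A j
    · rw [if_pos hj, if_pos hj, ih]
      exact congrArg (q.1 j) (by omega)
    · rw [if_neg hj, if_neg hj, ih]
      rfl

/-- Each inspection contributes the next stack entry and nothing else, so timing and prices drop
out. This is why beliefs in the two coupled markets are comparable. -/
lemma likelihood_stackRun (n : ℕ) (θ : Fin m → I × I) :
    likelihood ((M.stackRun ρ q).take n) θ
      = ∏ j, seqLikelihood (q.1.fitObs j) ((M.stackRun ρ q).inspections j n) (θ j).1
        * seqLikelihood (q.1.qualityObs j) ((M.stackRun ρ q).inspections j n) (θ j).2 := by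
  induction n with
  | zero => simp [likelihood, History.inspections, seqLikelihood]
  | succ n ih =>
    obtain ⟨A, -, hfit, hsale, -⟩ := M.stackRun_round ρ q n
    rw [likelihood_take_succ, ih, feedbackLikelihood_eq, ← Finset.prod_mul_distrib]
    refine Finset.prod_congr rfl fun j _ => ?_
    have hs := M.stackState_snd ρ q n j 0
    rw [History.inspections_succ, if_congr (M.fit_stackRun_ne_none_iff ρ q (hfit j)) rfl rfl, hfit,
      hsale]
    by_cases hj : A j
    · simp only [hj, if_true, seqLikelihood, Finset.prod_range_succ, Stack.fitObs, Stack.qualityObs,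
        hs, add_zero]
      ring
    · simp [hj, obsLikelihood]

variable {M ρ q}

lemma posterior_stackRun (hs : M.Plausible q.1) (n : ℕ) (j : Fin m) :
    M.posteriorFit ((M.stackRun ρ q).take n) j
        = M.fitBelief q.1 j ((M.stackRun ρ q).inspections j n) ∧
      M.posteriorQuality ((M.stackRun ρ q).take n) j
        = M.qualityBelief q.1 j ((M.stackRun ρ q).inspections j n) :=
  M.posteriorFit_eq (fun _ => measurable_seqLikelihood _ _) (fun _ => measurable_seqLikelihood _ _)
    (fun _ => seqLikelihood_le_one _ _) (fun _ => seqLikelihood_le_one _ _)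
    (M.likelihood_stackRun ρ q n) (fun i => lintegral_fit_ne_zero i _)
    (fun i => lintegral_quality_ne_zero hs i _) j

variable (M) in
/-- The index of business `j` at price `p` after `k` inspections, for the highest value. -/
noncomputable def stackIndex (s : Stack m) (j : Fin m) (k : ℕ) (p : ℝ≥0) : ℝ :=
  M.index p (beliefMean (M.fitBelief s j k)) (beliefMean (M.qualityBelief s j k)) M.vmax

lemma indexAfter_stackRun (hs : M.Plausible q.1) (n : ℕ) (j : Fin m) (p : ℝ≥0) :
    M.indexAfter ((M.stackRun ρ q).take n) j p M.vmax
      = M.stackIndex q.1 j ((M.stackRun ρ q).inspections j n) p := by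
  rw [indexAfter, stackIndex, (posterior_stackRun hs n j).1, (posterior_stackRun hs n j).2]

variable (M) in
lemma ae_value_le : ∀ᵐ q ∂M.worldLaw, ∀ n, (q.2 n).1.1 ≤ M.vmax := by
  refine ae_all_iff.2 fun n => ?_
  have hmp : MeasurePreserving (fun q : Stack m × (ℕ → Consumer m × (Fin m → I)) => (q.2 n).1.1)
      M.worldLaw M.valueLaw :=
    measurePreserving_fst.comp (measurePreserving_fst.comp
      ((measurePreserving_eval_infinitePi (fun _ : ℕ => M.roundLaw) n).comp measurePreserving_snd))
  filter_upwards [hmp.quasiMeasurePreserving.ae M.value_mem] with q hq using hq.2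

/-- Only businesses with a positive index at price `0` are inspected. -/
lemma stackIndex_pos_of_inspection (hs : M.Plausible q.1) {n : ℕ} (hv : (q.2 n).1.1 ≤ M.vmax)
    {j : Fin m} (hj : ((M.stackRun ρ q) n).2.fit j ≠ none) :
    0 < M.stackIndex q.1 j ((M.stackRun ρ q).inspections j n) 0 := by
  obtain ⟨A, hA, hfit, -, -⟩ := M.stackRun_round ρ q n
  have h := hA j ((M.fit_stackRun_ne_none_iff ρ q (hfit j)).1 hj)
  rw [← indexAfter_stackRun (ρ := ρ) hs]
  refine h.trans_le ?_
  have hQ : 0 ≤ beliefMean (M.posteriorQuality ((M.stackRun ρ q).take n) j) := beliefMean_nonneg _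
  unfold indexAfter index
  have := mul_le_mul_of_nonneg_right hv hQ
  have := ((M.stackRun ρ q n).1 j).2
  simp only [NNReal.coe_zero]
  linarith

end Market

/-! ### More inspections and more learning at the lower cost -/

lemma exists_max_of_bdd {c : ℕ → ℕ} {K : ℕ} (hK : ∀ n, c n ≤ K) : ∃ N, ∀ n, c n ≤ c N := by
  have hfin : (Set.range c).Finite := (Set.finite_Iic K).subset (by rintro _ ⟨n, rfl⟩; exact hK n)
  obtain ⟨_, ⟨N, rfl⟩, hN⟩ := hfin.exists_maximal (Set.range_nonempty c)
  exact ⟨N, fun n => (le_total (c n) (c N)).elim id fun h => hN ⟨n, rfl⟩ h⟩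

/-- Beliefs that are updated along a sequence of observations inherit convergence from one pace of
observation to another one that is not slower in the limit. -/
lemma tendsto_measure_of_counts {b : ℕ → Measure I} (hb : ∀ k, IsProbabilityMeasure (b k))
    (hac : ∀ k l, k ≤ l → b l ≪ b k) {c c' : ℕ → ℕ} (hc : Monotone c)
    (hstep : ∀ n, c (n + 1) ≤ c n + 1) (hc' : Monotone c') (hle : ∀ n, ∃ n', c n ≤ c' n')
    {S : Set I} (hS : MeasurableSet S) (h : Tendsto (fun n => b (c n) S) atTop (𝓝 1)) :
    Tendsto (fun n => b (c' n) S) atTop (𝓝 1) := by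
  -- If `c` is bounded, it is eventually constant and the belief there gives `S` full mass; absolute
  -- continuity passes this on to all later beliefs. If not, `c` grows by steps of at most one and
  -- visits every large count, so the whole sequence `b k S` converges.
  by_cases hbd : ∃ K, ∀ n, c n ≤ K
  · obtain ⟨K, hK⟩ := hbd
    obtain ⟨N, hN'⟩ := exists_max_of_bdd hK
    have hN : ∀ n ≥ N, c n = c N := fun n hn => le_antisymm (hN' n) (hc hn)
    have h1 : b (c N) S = 1 := tendsto_nhds_unique (tendsto_const_nhds.congr' (by
      filter_upwards [eventually_ge_atTop N] with n hn; rw [hN n hn])) h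
    obtain ⟨n', hn'⟩ := hle N
    refine tendsto_const_nhds.congr' ?_
    filter_upwards [eventually_ge_atTop n'] with n hn
    have h0 := hac _ _ (hn'.trans (hc' hn)) ((prob_compl_eq_zero_iff hS).2 h1)
    exact ((prob_compl_eq_zero_iff hS).1 h0).symm
  · push Not at hbd
    have hk : Tendsto (fun k => b k S) atTop (𝓝 1) := by
      refine tendsto_def.2 fun V hV => ?_
      obtain ⟨N, hN⟩ := eventually_atTop.1 (h.eventually_mem hV)
      refine mem_atTop_sets.2 ⟨c N + 1, fun k hk => ?_⟩
      have hex : ∃ n, k ≤ c n := (hbd k).imp fun n hn => hn.le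
      have hn1 : Nat.find hex ≠ 0 := fun h0 => by
        have h1 := Nat.find_spec hex
        rw [h0] at h1
        have := hc (Nat.zero_le N)
        omega
      obtain ⟨p, hp⟩ := Nat.exists_eq_succ_of_ne_zero hn1
      have h1 := Nat.find_spec hex
      have h2 := Nat.find_min hex (m := p) (by omega)
      have h3 := hstep p
      rw [hp] at h1
      have h4 : c (p + 1) = k := by
        change k ≤ c (p + 1) at h1; omega
      have h5 : N ≤ p + 1 := by
        by_contra hlt
        have := hc (show p + 1 ≤ N by omega)
        omega
      have := hN _ h5
      rwa [h4] at this
    refine hk.comp (tendsto_atTop_atTop_of_monotone hc' fun K => ?_)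
    obtain ⟨n, hn⟩ := hbd K
    obtain ⟨n', hn'⟩ := hle n
    exact ⟨n', hn.le.trans hn'⟩

namespace Market

variable {m : ℕ} {M : Market m}

lemma measurable_indexBound (E : Fin m → ℝ → ℝ → ℝ) (n : ℕ) (j : Fin m) :
    Measurable fun H : FinHistory m n =>
      E j (beliefMean (M.posteriorFit H j)) (beliefMean (M.posteriorQuality H j)) :=
  measurable_of_feedback fun F =>
    E j (beliefMean (M.posteriorFit (fun i => ((0 : Fin m → ℝ≥0), F i)) j))
      (beliefMean (M.posteriorQuality (fun i => ((0 : Fin m → ℝ≥0), F i)) j))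

lemma indexAfter_withCost {c' : ℝ≥0} {n : ℕ} (H : FinHistory m n) (j : Fin m) (p : ℝ≥0) (v : ℝ) :
    (M.withCost c').indexAfter H j p v
      = M.indexAfter H j p v + (M.cost - c') / beliefMean (M.posteriorFit H j) := by
  change v * beliefMean (M.posteriorQuality H j) - p - c' / beliefMean (M.posteriorFit H j) = _
  unfold indexAfter index
  ring

/-- At histories where a business could have a positive index in the market with the higher search
cost, its index in the market with the lower search cost is bounded away from `0`, by a number that
depends only on the beliefs. -/
lemma exists_indexBound {c' : ℝ≥0} (hc : c' < M.cost) {ρ ρ' : PricingRules m}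
    (hρ : M.DemandResponsive ρ)
    (hρρ' : ρ' = ρ ∨ (M.withCost c').UniformlyDemandResponsive ρ') :
    ∃ E : Fin m → ℝ → ℝ → ℝ, (∀ j a b, 0 < a → 0 < E j a b) ∧
      ∀ n j (H : FinHistory m n), ∀ᵐ u : I, 0 < beliefMean (M.posteriorFit H j) →
        0 < M.indexAfter H j 0 M.vmax →
        E j (beliefMean (M.posteriorFit H j)) (beliefMean (M.posteriorQuality H j)) ≤
          (M.withCost c').indexAfter H j (ρ'.price j n H u) M.vmax := by
  have hcc : (0 : ℝ) < M.cost - c' := sub_pos.2 (by exact_mod_cast hc)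
  rcases hρρ' with rfl | ⟨δ, hδ, hu⟩
  -- With equal rules, the posted price leaves a positive index at cost `M.cost`; the lower cost
  -- adds `(M.cost - c') / π̂`.
  · refine ⟨fun _ a _ => (M.cost - c') / a, fun _ a _ ha => div_pos hcc ha, fun n j H => ?_⟩
    by_cases h : 0 < M.indexAfter H j 0 M.vmax
    · filter_upwards [hρ n H j ⟨0, h⟩] with u hu _ _
      rw [indexAfter_withCost]
      linarith
    · exact ae_of_all _ fun u _ h' => absurd h' h
  · refine ⟨δ, fun j a b _ => hδ j a b, fun n j H => ?_⟩
    by_cases h : 0 < beliefMean (M.posteriorFit H j) ∧ 0 < M.indexAfter H j 0 M.vmax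
    · have h' : 0 < (M.withCost c').indexAfter H j 0 M.vmax := by
        rw [indexAfter_withCost]
        exact add_pos h.2 (div_pos hcc h.1)
      filter_upwards [hu n H j ⟨0, h'⟩] with u hu _ _
      exact hu
    · exact ae_of_all _ fun u h1 h2 => absurd ⟨h1, h2⟩ h

lemma worldLaw_withCost (c' : ℝ≥0) : (M.withCost c').worldLaw = M.worldLaw := rfl

lemma plausible_withCost {c' : ℝ≥0} {s : Stack m} (hs : M.Plausible s) :
    (M.withCost c').Plausible s := hs

lemma measurePreserving_stackRun_withCost (c' : ℝ≥0) (ρ' : PricingRules m) :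
    MeasurePreserving ((M.withCost c').stackRun ρ') M.worldLaw ((M.withCost c').historyLaw ρ') := by
  rw [← worldLaw_withCost c']
  exact (M.withCost c').measurePreserving_stackRun ρ'

lemma posterior_stackRun_withCost {c' : ℝ≥0} {ρ' : PricingRules m}
    {q : Stack m × (ℕ → Consumer m × (Fin m → I))} (hs : M.Plausible q.1) (n : ℕ) (j : Fin m) :
    M.posteriorFit (((M.withCost c').stackRun ρ' q).take n) j
        = M.fitBelief q.1 j (((M.withCost c').stackRun ρ' q).inspections j n) ∧
      M.posteriorQuality (((M.withCost c').stackRun ρ' q).take n) j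
        = M.qualityBelief q.1 j (((M.withCost c').stackRun ρ' q).inspections j n) :=
  posterior_stackRun (plausible_withCost (c' := c') hs) n j

lemma ae_price_bound {c' : ℝ≥0} {ρ' : PricingRules m} {E : Fin m → ℝ → ℝ → ℝ}
    (hbound : ∀ n j (H : FinHistory m n), ∀ᵐ u : I, 0 < beliefMean (M.posteriorFit H j) →
        0 < M.indexAfter H j 0 M.vmax →
        E j (beliefMean (M.posteriorFit H j)) (beliefMean (M.posteriorQuality H j)) ≤
          (M.withCost c').indexAfter H j (ρ'.price j n H u) M.vmax) :
    ∀ᵐ h ∂(M.withCost c').historyLaw ρ', ∀ n j, 0 < beliefMean (M.posteriorFit (h.take n) j) →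
        0 < M.indexAfter (h.take n) j 0 M.vmax →
        E j (beliefMean (M.posteriorFit (h.take n) j))
          (beliefMean (M.posteriorQuality (h.take n) j)) ≤
          (M.withCost c').indexAfter (h.take n) j ((h n).1 j) M.vmax :=
  (M.withCost c').ae_historyLaw_price ρ'
    (Q := fun n j => {x : FinHistory m n × ℝ≥0 | 0 < beliefMean (M.posteriorFit x.1 j) →
      0 < M.indexAfter x.1 j 0 M.vmax →
      E j (beliefMean (M.posteriorFit x.1 j)) (beliefMean (M.posteriorQuality x.1 j)) ≤
        (M.withCost c').indexAfter x.1 j x.2 M.vmax})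
    (fun n j => MeasurableSet.imp
      (measurableSet_lt measurable_const ((M.measurable_meanFit n j).comp measurable_fst))
      (MeasurableSet.imp (measurableSet_lt measurable_const
        (M.measurable_indexAfter measurable_fst measurable_const measurable_const j))
        (measurableSet_le ((measurable_indexBound E n j).comp measurable_fst)
          ((M.withCost c').measurable_indexAfter measurable_fst measurable_snd measurable_const j))))
    hbound

lemma ae_forall_exists_inspection (M : Market m) (ρ : PricingRules m) :
    ∀ᵐ h ∂M.historyLaw ρ, ∀ (j : Fin m) (k n₀ : ℕ),
      (∀ n ≥ n₀, 1 / ((k : ℝ) + 1) ≤ M.indexAfter (h.take n) j ((h n).1 j) M.vmax) →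
        ∃ n ≥ n₀, (h n).2.fit j ≠ none :=
  ae_all_iff.2 fun j => ae_all_iff.2 fun k => ae_all_iff.2 fun n₀ =>
    M.ae_exists_inspection ρ (Nat.one_div_pos_of_nat (n := k) (α := ℝ)) j n₀

/-- A business whose prices respond to demand is inspected after any number of inspections at which
it has a positive index at price `0`. -/
lemma exists_inspections_gt {M' : Market m} {h' : History m} {j : Fin m} {K n₁ : ℕ}
    {e : ℝ} (he : 0 < e)
    (hpost : ∀ l, h'.inspections j l = K → e ≤ M'.indexAfter (h'.take l) j ((h' l).1 j) M'.vmax)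
    (hrec : ∀ k n₀ : ℕ,
      (∀ n ≥ n₀, 1 / ((k : ℝ) + 1) ≤ M'.indexAfter (h'.take n) j ((h' n).1 j) M'.vmax) →
        ∃ n ≥ n₀, (h' n).2.fit j ≠ none) (hn₁ : K ≤ h'.inspections j n₁) :
    ∃ n, K + 1 ≤ h'.inspections j n := by
  by_contra hcon
  push Not at hcon
  -- If inspections stopped at `K`, the belief would be frozen and the index would stay above `e`
  -- forever, contradicting recurrence.
  have hconst : ∀ l ≥ n₁, h'.inspections j l = K := fun l hl => by
    have h1 := hcon l
    have h2 := h'.inspections_mono j hl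
    omega
  obtain ⟨k, hk⟩ := exists_nat_one_div_lt he
  obtain ⟨l, hl, hlf⟩ := hrec k n₁ fun l hl => hk.le.trans (hpost l (hconst l hl))
  have h1 := hconst l hl
  have h2 := hconst (l + 1) (Nat.le_succ_of_le hl)
  rw [History.inspections_succ, if_pos hlf] at h2
  omega

/-- In the coupled histories, each business is inspected at least as often (in the limit) in the
market with the lower search cost. -/
lemma ae_inspections_le {c' : ℝ≥0} (hc : c' < M.cost) {ρ ρ' : PricingRules m}
    (hρ : M.DemandResponsive ρ)
    (hρρ' : ρ' = ρ ∨ (M.withCost c').UniformlyDemandResponsive ρ') :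
    ∀ᵐ q ∂M.worldLaw, ∀ j n, ∃ n', (M.stackRun ρ q).inspections j n
      ≤ ((M.withCost c').stackRun ρ' q).inspections j n' := by
  obtain ⟨E, hE, hbound⟩ := exists_indexBound hc hρ hρρ'
  have hmp := M.measurePreserving_stackRun_withCost c' ρ'
  have hprice := hmp.quasiMeasurePreserving.ae (ae_price_bound hbound)
  have hrec := hmp.quasiMeasurePreserving.ae ((M.withCost c').ae_forall_exists_inspection ρ')
  filter_upwards [hprice, hrec, M.ae_value_le,
    measurePreserving_fst.quasiMeasurePreserving.ae M.ae_plausible] with q hprice hrec hv hs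
  intro j n
  induction n with
  | zero => exact ⟨0, (History.inspections_zero _ j).trans_le (Nat.zero_le _)⟩
  | succ n ih =>
    obtain ⟨n₁, hn₁⟩ := ih
    rw [History.inspections_succ]
    by_cases hj : (M.stackRun ρ q n).2.fit j ≠ none
    · rw [if_pos hj]
      -- An inspection in the costlier market shows that the belief at this count admits a positive
      -- index. The other market holds the same belief while its count is the same, so it goes on to
      -- the next inspection.
      have halive := stackIndex_pos_of_inspection hs (hv n) hj
      refine exists_inspections_gt (M' := M.withCost c')
        (hE j _ (beliefMean (M.qualityBelief q.1 j ((M.stackRun ρ q).inspections j n)))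
          (beliefMean_fitBelief_pos (M := M) (s := q.1) j ((M.stackRun ρ q).inspections j n)))
        (fun l hl => ?_) (hrec j) hn₁
      have hpost := M.posterior_stackRun_withCost (c' := c') (ρ' := ρ') hs l j
      have h1 := hprice l j
      rw [indexAfter, hpost.1, hpost.2, hl] at h1
      exact h1 (beliefMean_fitBelief_pos j _) halive
    · exact ⟨n₁, by rw [if_neg hj]; exact hn₁⟩

/-- In the coupled histories, the learned set is at least as large in the market with the lower
search cost. -/
lemma ae_learnedSet_subset {c' : ℝ≥0} (hc : c' < M.cost) {ρ ρ' : PricingRules m}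
    (hρ : M.DemandResponsive ρ)
    (hρρ' : ρ' = ρ ∨ (M.withCost c').UniformlyDemandResponsive ρ') :
    ∀ᵐ q ∂M.worldLaw, M.learnedSet (M.stackRun ρ q)
      ⊆ (M.withCost c').learnedSet ((M.withCost c').stackRun ρ' q) := by
  filter_upwards [ae_inspections_le hc hρ hρρ',
    measurePreserving_fst.quasiMeasurePreserving.ae M.ae_plausible] with q hq hs j hj
  have hball : ∀ (x : I) (ε : ℝ), MeasurableSet {y : I | |(y : ℝ) - x| < ε} := fun x ε =>
    measurableSet_lt (by fun_prop) measurable_const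
  refine ⟨fun ε hε => ?_, fun ε hε => ?_⟩
  · have h := hj.1 ε hε
    simp only [(posterior_stackRun hs _ j).1] at h
    have h' := tendsto_measure_of_counts (fun k => isProbabilityMeasure_fitBelief j k)
      (fun k l hkl => bayes_absolutelyContinuous hkl) ((M.stackRun ρ q).inspections_mono j)
      ((M.stackRun ρ q).inspections_succ_le j)
      (((M.withCost c').stackRun ρ' q).inspections_mono j) (hq j) (hball _ _) h
    change Tendsto (fun n => M.posteriorFit (((M.withCost c').stackRun ρ' q).take n) j _) _ _
    simp only [(posterior_stackRun_withCost hs _ j).1]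
    exact h'
  · have h := hj.2 ε hε
    simp only [(posterior_stackRun hs _ j).2] at h
    have h' := tendsto_measure_of_counts (fun k => isProbabilityMeasure_qualityBelief hs j k)
      (fun k l hkl => bayes_absolutelyContinuous hkl) ((M.stackRun ρ q).inspections_mono j)
      ((M.stackRun ρ q).inspections_succ_le j)
      (((M.withCost c').stackRun ρ' q).inspections_mono j) (hq j) (hball _ _) h
    change Tendsto (fun n => M.posteriorQuality (((M.withCost c').stackRun ρ' q).take n) j _) _ _
    simp only [(posterior_stackRun_withCost hs _ j).2]
    exact h'

/-! ### Measurability of learning and the conclusion -/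

/-- Countably many radii suffice, which makes the event of learning measurable; this is needed to
transfer almost sure statements to the law of the pair of histories. -/
lemma forall_tendsto_ball_iff {μ : ℕ → Measure I} (hμ : ∀ n, μ n Set.univ ≤ 1) (x : I) :
    (∀ ε > 0, Tendsto (fun n => μ n {y | |(y : ℝ) - x| < ε}) atTop (𝓝 1)) ↔
      ∀ k : ℕ, Tendsto (fun n => μ n {y | |(y : ℝ) - x| < 1 / ((k : ℝ) + 1)}) atTop (𝓝 1) := by
  refine ⟨fun h k => h _ Nat.one_div_pos_of_nat, fun h ε hε => ?_⟩
  obtain ⟨k, hk⟩ := exists_nat_one_div_lt hε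
  exact tendsto_of_tendsto_of_tendsto_of_le_of_le (h k) tendsto_const_nhds
    (fun n => measure_mono fun y hy => lt_trans hy hk)
    fun n => (measure_mono (Set.subset_univ _)).trans (hμ n)

variable (M) in
lemma measurableSet_learned (j : Fin m) : MeasurableSet {h : History m | M.Learned h j} := by
  have hF : ∀ (h : History m) n, M.posteriorFit (h.take n) j Set.univ ≤ 1 := fun h n => by
    rw [posteriorFit, Measure.map_apply (by fun_prop) MeasurableSet.univ]
    exact M.posterior_univ_le_one _
  have hQ : ∀ (h : History m) n, M.posteriorQuality (h.take n) j Set.univ ≤ 1 := fun h n => by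
    rw [posteriorQuality, Measure.map_apply (by fun_prop) MeasurableSet.univ]
    exact M.posterior_univ_le_one _
  have hmF : ∀ n S, Measurable fun h : History m => M.posteriorFit (h.take n) j S := fun n S =>
    (measurable_of_feedback fun F => M.posteriorFit (fun i => ((0 : Fin m → ℝ≥0), F i)) j S).comp
      (measurable_take n)
  have hmQ : ∀ n S, Measurable fun h : History m => M.posteriorQuality (h.take n) j S := fun n S =>
    (measurable_of_feedback fun F =>
      M.posteriorQuality (fun i => ((0 : Fin m → ℝ≥0), F i)) j S).comp (measurable_take n)
  simp only [Learned, forall_tendsto_ball_iff (hF _), forall_tendsto_ball_iff (hQ _)]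
  simp only [Set.ofPred_and, Set.ofPred_forall]
  exact (MeasurableSet.iInter fun k => measurableSet_tendsto _ fun n => hmF n _).inter
    (MeasurableSet.iInter fun k => measurableSet_tendsto _ fun n => hmQ n _)

lemma exists_isSymmetricEquilibrium_set {S : Set (Fin m)}
    (hS : ∀ j ∈ S, ∀ k ∈ S, M.fit j = M.fit k ∧ M.quality j = M.quality k) :
    ∃ Φ, M.IsSymmetricEquilibrium S Φ := by
  have := M.exists_isSymmetricEquilibrium (S := Finset.univ.filter (· ∈ S)) (by simpa using hS)
  simpa using this

end Market

theorem mainTheorem8 {m : ℕ} (M : Market m) (c' : ℝ≥0) (hc : c' < M.cost)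
    (ρ ρ' : PricingRules m)
    (hρ : M.DemandResponsive ρ) (hρ' : (M.withCost c').DemandResponsive ρ')
    (hρρ' : ρ' = ρ ∨ (M.withCost c').UniformlyDemandResponsive ρ')
    (hsym : M.LearnedSymmetric ρ) (hsym' : (M.withCost c').LearnedSymmetric ρ') :
    ∃ γ : Measure (History m × History m), IsProbabilityMeasure γ ∧
      γ.map Prod.fst = M.historyLaw ρ ∧ γ.map Prod.snd = (M.withCost c').historyLaw ρ' ∧
      ∀ᵐ h ∂γ,
        (∃ Φ, M.IsSymmetricEquilibrium (M.learnedSet h.1) Φ) ∧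
        (∃ Φ', (M.withCost c').IsSymmetricEquilibrium ((M.withCost c').learnedSet h.2) Φ') ∧
        ∀ Φ Φ', M.IsSymmetricEquilibrium (M.learnedSet h.1) Φ →
          (M.withCost c').IsSymmetricEquilibrium ((M.withCost c').learnedSet h.2) Φ' →
          M.consumerWelfare Φ ≤ (M.withCost c').consumerWelfare Φ' ∧
          M.totalWelfare Φ ≤ (M.withCost c').totalWelfare Φ' := by
  have h1 := M.measurePreserving_stackRun ρ
  have h2 := M.measurePreserving_stackRun_withCost c' ρ'
  have hm : Measurable fun q => (M.stackRun ρ q, (M.withCost c').stackRun ρ' q) :=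
    h1.measurable.prodMk h2.measurable
  have hfst : (M.worldLaw.map fun q => (M.stackRun ρ q, (M.withCost c').stackRun ρ' q)).map
      Prod.fst = M.historyLaw ρ := by
    rw [Measure.map_map measurable_fst hm]; exact h1.map_eq
  have hsnd : (M.worldLaw.map fun q => (M.stackRun ρ q, (M.withCost c').stackRun ρ' q)).map
      Prod.snd = (M.withCost c').historyLaw ρ' := by
    rw [Measure.map_map measurable_snd hm]; exact h2.map_eq
  have hsub : ∀ᵐ h ∂(M.worldLaw.map fun q => (M.stackRun ρ q, (M.withCost c').stackRun ρ' q)),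
      M.learnedSet h.1 ⊆ (M.withCost c').learnedSet h.2 := by
    have hmeas : MeasurableSet {h : History m × History m |
        ∀ j, M.Learned h.1 j → (M.withCost c').Learned h.2 j} := by
      simp only [Set.ofPred_forall]
      exact MeasurableSet.iInter fun j => MeasurableSet.imp
        ((M.measurableSet_learned j).preimage measurable_fst)
        (((M.withCost c').measurableSet_learned j).preimage measurable_snd)
    exact (ae_map_iff hm.aemeasurable hmeas).2 (Market.ae_learnedSet_subset hc hρ hρρ')
  refine ⟨M.worldLaw.map fun q => (M.stackRun ρ q, (M.withCost c').stackRun ρ' q),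
    Measure.isProbabilityMeasure_map hm.aemeasurable, hfst, hsnd, ?_⟩
  unfold Market.LearnedSymmetric at hsym hsym'
  rw [← hfst] at hsym
  rw [← hsnd] at hsym'
  filter_upwards [ae_of_ae_map measurable_fst.aemeasurable hsym,
    ae_of_ae_map measurable_snd.aemeasurable hsym', hsub] with h hS hS' hSS'
  exact ⟨Market.exists_isSymmetricEquilibrium_set hS, Market.exists_isSymmetricEquilibrium_set hS',
    fun Φ Φ' hΦ hΦ' => M.welfare_le_of_subset hc hSS' hS' hΦ hΦ'⟩
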